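/- **Type A1.** A four-dimensional homogeneous pseudo-Riemannian manifold $(M,g)$ is *of type A1* if a connected Lie group $G$ acts smoothly, transitively and by isometries on $(M,g)$, such that for some $o\in M$ the Lie algebra $\mathfrak g$ of $G$ has a basis $e_1,\dots,e_5$ whose only non-zero brackets are $$[e_1,e_2]=2e_2,\quad [e_1,e_3]=-2e_3,\quad [e_2,e_3]=e_1,\quad [e_4,e_5]=e_4$$ (so $\mathfrak g\cong\mathfrak{sl}(2,\mathbb R)\oplus\mathfrak s(2)$), and the isotropy algebra at $o$ is $\mathfrak h=\mathrm{span}\{e_3+e_4\}$. (Such a pair $(\mathfrak g,\mathfrak h)$ admits no reductive decomposition.) Elements of $\mathfrak g$ are regarded as tangent vectors at $o$ through the differential of the orbit map $G\to M$, $a\mapsto a\cdot o$, and we put $b:=g_o(e_2,e_2)$. The manifold $(M,g)$ is *locally symmetric* if its curvature tensor $R$ satisfies $\nabla R=0$. **Hypersurfaces.** A (non-degenerate) hypersurface of $(M,g)$ is an isometric immersion $F:(\Sigma^3,g^\Sigma)\to(M^4,g)$ of a non-empty pseudo-Riemannian manifold. With a local normal field $\xi$ along $F$ with $\langle\xi,\xi\rangle=\varepsilon\in\{1,-1\}$,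 its second fundamental form $h$ is given by the Gauss formula $\nabla_XY=\nabla^\Sigma_XY+h(X,Y)\,\xi$, and $$(\nabla^\Sigma h)(X,Y,Z)=X(h(Y,Z))-h(\nabla^\Sigma_XY,Z)-h(Y,\nabla^\Sigma_XZ).$$ The second fundamental form is *Codazzi* if $\nabla^\Sigma h$ is symmetric in its three arguments; the hypersurface is *parallel* if $\nabla^\Sigma h=0$, and *totally geodesic* if $h=0$. **Theorem.** Let $(M,g)$ be a homogeneous pseudo-Riemannian four-manifold of type A1, with $b$ as above. Then $(M,g)$ is locally symmetric if and only if $b=0$. If $(M,g)$ is not locally symmetric (that is, $b\neq 0$), then it has no hypersurface with Codazzi second fundamental form. In particular, it has no parallel and no totally geodesic hypersurface. -/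

import Mathlib

open scoped Manifold ContDiff Bundle

noncomputable section

namespace A1Space

/-- The model space `ℝⁿ`. -/
abbrev Eu (n : ℕ) : Type := EuclideanSpace ℝ (Fin n)

/-- The tangent space at `x` of a manifold modelled on `ℝⁿ`. -/
abbrev Tan (n : ℕ) {M : Type*} [TopologicalSpace M] [ChartedSpace (Eu n) M] (x : M) : Type :=
  TangentSpace 𝓘(ℝ, Eu n) x

/-! ### Pseudo-Riemannian metrics and the Levi-Civita connection -/

section Metric

variable {m n : ℕ}
  {N : Type*} [TopologicalSpace N] [ChartedSpace (Eu m) N]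
  {M : Type*} [TopologicalSpace M] [ChartedSpace (Eu n) M] [IsManifold 𝓘(ℝ, Eu n) ∞ M]

/-- A smooth pseudo-Riemannian metric: a smooth field of non-degenerate symmetric bilinear forms
on the tangent spaces. -/
structure PseudoRiemannianMetric (n : ℕ) (M : Type*) [TopologicalSpace M]
    [ChartedSpace (Eu n) M] [IsManifold 𝓘(ℝ, Eu n) ∞ M] where
  /-- the scalar product on each tangent space -/
  val (x : M) : Tan n x →L[ℝ] Tan n x →L[ℝ] ℝ
  symm (x : M) (v w : Tan n x) : val x v w = val x w v
  nondegenerate (x : M) (v : Tan n x) (hv : ∀ w : Tan n x, val x v w = 0) : v = 0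
  contMDiff : ContMDiff 𝓘(ℝ, Eu n) (𝓘(ℝ, Eu n).prod 𝓘(ℝ, Eu n →L[ℝ] Eu n →L[ℝ] ℝ)) ∞
    (fun x ↦ Bundle.TotalSpace.mk' (Eu n →L[ℝ] Eu n →L[ℝ] ℝ)
      (E := fun x : M ↦ (Tan n x →L[ℝ] Tan n x →L[ℝ] ℝ)) x (val x))

/-- `coordField x i` is the `i`-th coordinate vector field `∂_i` of the preferred chart
around `x`. -/
def coordField (x : M) (i : Fin n) (y : M) : Tan n y :=
  (trivializationAt (Eu n) (TangentSpace 𝓘(ℝ, Eu n) : M → Type _) x).symm y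
    (EuclideanSpace.single i 1)

/-- The `k`-th component of the tangent vector `v` at `y` in the preferred chart around `x`. -/
def coord (x : M) {y : M} (v : Tan n y) (k : Fin n) : ℝ :=
  (trivializationAt (Eu n) (TangentSpace 𝓘(ℝ, Eu n) : M → Type _) x ⟨y, v⟩).2 k

namespace PseudoRiemannianMetric

variable (g : PseudoRiemannianMetric n M)

/-- The components `g_ij` of the metric in the preferred chart around `x`, as functions of the
point `y`. -/
def coeff (x : M) (i j : Fin n) (y : M) : ℝ :=
  g.val y (coordField x i y) (coordField x j y)

/-- The partial derivative `∂_k g_ij` at `x`, in the preferred chart around `x`. -/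
def coeffDeriv (x : M) (k i j : Fin n) : ℝ :=
  mvfderiv 𝓘(ℝ, Eu n) (g.coeff x i j) x (coordField x k x)

/-- The Christoffel symbol `Γ^k_ij = ½ ∑ g^kl (∂_i g_jl + ∂_j g_il - ∂_l g_ij)` of the Levi-Civita
connection at `x`, in the preferred chart around `x`. -/
def christoffel (x : M) (k i j : Fin n) : ℝ :=
  (1 / 2 : ℝ) * ∑ l : Fin n, (Matrix.of fun p q ↦ g.coeff x p q x)⁻¹ k l *
    (g.coeffDeriv x i j l + g.coeffDeriv x j i l - g.coeffDeriv x l i j)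

/-- The Levi-Civita covariant derivative `∇_v V` at `p`, for a vector field `V` along a map
`F : N → M` and a tangent vector `v` of `N` at `p`: its components in the preferred chart around
`F p` are `v(V^k) + ∑ Γ^k_ij (dF v)^i V^j`. -/
def covDerivAlong (F : N → M) (V : (q : N) → Tan n (F q)) (p : N) (v : Tan m p) : Tan n (F p) :=
  ∑ k : Fin n,
    (mvfderiv 𝓘(ℝ, Eu m) (fun q ↦ coord (F p) (V q) k) p v +
      ∑ i : Fin n, ∑ j : Fin n, g.christoffel (F p) k i j *
        coord (F p) (mfderiv 𝓘(ℝ, Eu m) 𝓘(ℝ, Eu n) F p v) i * coord (F p) (V p) j) •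
      coordField (F p) k (F p)

/-- The Levi-Civita connection `∇_X Y` on vector fields of `M`. -/
def nabla (X Y : (x : M) → Tan n x) (x : M) : Tan n x :=
  g.covDerivAlong (fun y : M ↦ y) Y x (X x)

/-- The curvature `R(X,Y)Z = ∇_X ∇_Y Z - ∇_Y ∇_X Z - ∇_[X,Y] Z`. -/
def curvature (X Y Z : (x : M) → Tan n x) (x : M) : Tan n x :=
  g.nabla X (g.nabla Y Z) x - g.nabla Y (g.nabla X Z) x
    - g.nabla (VectorField.mlieBracket 𝓘(ℝ, Eu n) X Y) Z x

/-- The covariant derivative `(∇_W R)(X,Y)Z` of the curvature tensor. -/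
def nablaCurvature (W X Y Z : (x : M) → Tan n x) (x : M) : Tan n x :=
  g.nabla W (g.curvature X Y Z) x - g.curvature (g.nabla W X) Y Z x
    - g.curvature X (g.nabla W Y) Z x - g.curvature X Y (g.nabla W Z) x

end PseudoRiemannianMetric

/-- `V` is a vector field along the map `F` that is smooth on the set `U`. -/
def SmoothAlongOn (F : N → M) (U : Set N) (V : (q : N) → Tan n (F q)) : Prop :=
  ContMDiffOn 𝓘(ℝ, Eu m) 𝓘(ℝ, Eu n).tangent ∞
    (fun q ↦ (⟨F q, V q⟩ : TangentBundle 𝓘(ℝ, Eu n) M)) U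

/-- `X` is a vector field that is smooth on the set `U`. -/
def SmoothFieldOn (U : Set M) (X : (x : M) → Tan n x) : Prop :=
  SmoothAlongOn (m := n) (fun x : M ↦ x) U X

/-- A metric is locally symmetric if its curvature tensor is parallel, `∇R = 0`. -/
def PseudoRiemannianMetric.IsLocallySymmetric (g : PseudoRiemannianMetric n M) : Prop :=
  ∀ U : Set M, IsOpen U → ∀ W X Y Z : (x : M) → Tan n x,
    SmoothFieldOn U W → SmoothFieldOn U X → SmoothFieldOn U Y → SmoothFieldOn U Z →
    ∀ x ∈ U, g.nablaCurvature W X Y Z x = 0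

end Metric

/-! ### Non-degenerate hypersurfaces -/

section Hypersurface

variable {n : ℕ}
  {S : Type*} [TopologicalSpace S] [ChartedSpace (Eu n) S] [IsManifold 𝓘(ℝ, Eu n) ∞ S]
  {M : Type*} [TopologicalSpace M] [ChartedSpace (Eu (n + 1)) M]
  [IsManifold 𝓘(ℝ, Eu (n + 1)) ∞ M]

/-- The differential of a map from an `n`-manifold to an `(n+1)`-manifold. -/
abbrev dMap (F : S → M) (p : S) : Tan n p →L[ℝ] Tan (n + 1) (F p) :=
  mfderiv 𝓘(ℝ, Eu n) 𝓘(ℝ, Eu (n + 1)) F p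

/-- `F : (S, gS) → (M, g)` is an isometric immersion of pseudo-Riemannian manifolds, in
codimension one. As `gS` is non-degenerate, this is a non-degenerate hypersurface. -/
structure IsIsometricHypersurface (gS : PseudoRiemannianMetric n S)
    (g : PseudoRiemannianMetric (n + 1) M) (F : S → M) : Prop where
  smooth : ContMDiff 𝓘(ℝ, Eu n) 𝓘(ℝ, Eu (n + 1)) ∞ F
  immersion (p : S) : Function.Injective (dMap (n := n) F p)
  isometric (p : S) (v w : Tan n p) : gS.val p v w = g.val (F p) (dMap F p v) (dMap F p w)

/-- `ξ` is a smooth normal vector field along `F` on `U` with `⟨ξ, ξ⟩ = ε ∈ {1, -1}`. -/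
structure IsUnitNormalOn (g : PseudoRiemannianMetric (n + 1) M) (F : S → M) (U : Set S)
    (ξ : (p : S) → Tan (n + 1) (F p)) (ε : ℝ) : Prop where
  smooth : SmoothAlongOn (m := n) F U ξ
  sign : ε = 1 ∨ ε = -1
  normal (p : S) (hp : p ∈ U) (v : Tan n p) : g.val (F p) (ξ p) (dMap F p v) = 0
  norm (p : S) (hp : p ∈ U) : g.val (F p) (ξ p) (ξ p) = ε

/-- The second fundamental form `h`, defined by the Gauss formula
`∇_X (dF Y) = dF (∇^S_X Y) + h(X,Y) ξ`; that is, `h(X,Y) = ε ⟨∇_X (dF Y), ξ⟩`. -/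
def secondForm (g : PseudoRiemannianMetric (n + 1) M) (F : S → M)
    (ξ : (p : S) → Tan (n + 1) (F p)) (ε : ℝ) (X Y : (p : S) → Tan n p) (p : S) : ℝ :=
  ε * g.val (F p) (g.covDerivAlong F (fun q ↦ dMap F q (Y q)) p (X p)) (ξ p)

/-- The covariant derivative
`(∇^S h)(X,Y,Z) = X(h(Y,Z)) - h(∇^S_X Y, Z) - h(Y, ∇^S_X Z)` of the second fundamental form. -/
def nablaSecondForm (gS : PseudoRiemannianMetric n S) (g : PseudoRiemannianMetric (n + 1) M)
    (F : S → M) (ξ : (p : S) → Tan (n + 1) (F p)) (ε : ℝ) (X Y Z : (p : S) → Tan n p)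
    (p : S) : ℝ :=
  mvfderiv 𝓘(ℝ, Eu n) (secondForm g F ξ ε Y Z) p (X p)
    - secondForm g F ξ ε (gS.nabla X Y) Z p - secondForm g F ξ ε Y (gS.nabla X Z) p

/-- The hypersurface has a Codazzi second fundamental form: `∇^S h` is symmetric in its three
arguments. A unit normal field, which exists locally and is locally unique up to sign, is only
required locally, so that the hypersurface need not be two-sided. -/
def IsCodazzi (gS : PseudoRiemannianMetric n S) (g : PseudoRiemannianMetric (n + 1) M)
    (F : S → M) : Prop :=
  ∀ p₀ : S, ∃ U : Set S, IsOpen U ∧ p₀ ∈ U ∧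
    ∃ (ξ : (p : S) → Tan (n + 1) (F p)) (ε : ℝ), IsUnitNormalOn g F U ξ ε ∧
      ∀ W : Set S, IsOpen W → W ⊆ U → ∀ X Y Z : (p : S) → Tan n p,
        SmoothFieldOn W X → SmoothFieldOn W Y → SmoothFieldOn W Z → ∀ p ∈ W,
          nablaSecondForm gS g F ξ ε X Y Z p = nablaSecondForm gS g F ξ ε Y X Z p ∧
          nablaSecondForm gS g F ξ ε X Y Z p = nablaSecondForm gS g F ξ ε X Z Y p

/-- The hypersurface is parallel: `∇^S h = 0`. -/
def IsParallel (gS : PseudoRiemannianMetric n S) (g : PseudoRiemannianMetric (n + 1) M)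
    (F : S → M) : Prop :=
  ∀ p₀ : S, ∃ U : Set S, IsOpen U ∧ p₀ ∈ U ∧
    ∃ (ξ : (p : S) → Tan (n + 1) (F p)) (ε : ℝ), IsUnitNormalOn g F U ξ ε ∧
      ∀ W : Set S, IsOpen W → W ⊆ U → ∀ X Y Z : (p : S) → Tan n p,
        SmoothFieldOn W X → SmoothFieldOn W Y → SmoothFieldOn W Z → ∀ p ∈ W,
          nablaSecondForm gS g F ξ ε X Y Z p = 0

/-- The hypersurface is totally geodesic: `h = 0`. -/
def IsTotallyGeodesic (g : PseudoRiemannianMetric (n + 1) M) (F : S → M) : Prop :=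
  ∀ p₀ : S, ∃ U : Set S, IsOpen U ∧ p₀ ∈ U ∧
    ∃ (ξ : (p : S) → Tan (n + 1) (F p)) (ε : ℝ), IsUnitNormalOn g F U ξ ε ∧
      ∀ W : Set S, IsOpen W → W ⊆ U → ∀ X Y : (p : S) → Tan n p,
        SmoothFieldOn W X → SmoothFieldOn W Y → ∀ p ∈ W, secondForm g F ξ ε X Y p = 0

end Hypersurface

/-! ### Homogeneous spaces of type A1 -/

section TypeA1

variable (G : Type*) [TopologicalSpace G] [ChartedSpace (Eu 5) G] [Group G]
  {M : Type*} [TopologicalSpace M] [ChartedSpace (Eu 4) M]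

/-- The differential at the identity of the orbit map `a ↦ a • o`, from the Lie algebra of `G` to
the tangent space of `M` at `o = 1 • o`. -/
def orbitDiff [MulAction G M] (o : M) :
    GroupLieAlgebra 𝓘(ℝ, Eu 5) G →L[ℝ] Tan 4 ((1 : G) • o) :=
  mfderiv 𝓘(ℝ, Eu 5) 𝓘(ℝ, Eu 4) (fun a : G ↦ a • o) 1

/-- The isotropy algebra at `o`: the Lie algebra of the stabilizer of `o`, that is, the kernel of
the differential of the orbit map. -/
def isotropyAlgebra [MulAction G M] (o : M) : Submodule ℝ (GroupLieAlgebra 𝓘(ℝ, Eu 5) G) :=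
  LinearMap.ker (orbitDiff G o).toLinearMap

/-- The action of `G` preserves the metric `g`. -/
def ActsByIsometries [MulAction G M] [IsManifold 𝓘(ℝ, Eu 4) ∞ M]
    (g : PseudoRiemannianMetric 4 M) : Prop :=
  ∀ (a : G) (x : M) (v w : Tan 4 x),
    g.val (a • x) (mfderiv 𝓘(ℝ, Eu 4) 𝓘(ℝ, Eu 4) (fun y : M ↦ a • y) x v)
      (mfderiv 𝓘(ℝ, Eu 4) 𝓘(ℝ, Eu 4) (fun y : M ↦ a • y) x w) = g.val x v w

/-- The basis `e = (e₁, …, e₅)` identifies the pair formed by the Lie algebra `L` and its subspace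
`K` with the pair A1: the non-zero brackets are `[e₁,e₂] = 2e₂`, `[e₁,e₃] = -2e₃`, `[e₂,e₃] = e₁`
and `[e₄,e₅] = e₄`, and `K = span {e₃ + e₄}`. (The vector `eᵢ` is `e (i - 1)` here.) -/
structure IsA1Basis {L : Type*} [AddCommGroup L] [Module ℝ L] [Bracket L L]
    (K : Submodule ℝ L) (e : Module.Basis (Fin 5) ℝ L) : Prop where
  b12 : ⁅e 0, e 1⁆ = (2 : ℝ) • e 1
  b13 : ⁅e 0, e 2⁆ = (-2 : ℝ) • e 2
  b14 : ⁅e 0, e 3⁆ = 0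
  b15 : ⁅e 0, e 4⁆ = 0
  b23 : ⁅e 1, e 2⁆ = e 0
  b24 : ⁅e 1, e 3⁆ = 0
  b25 : ⁅e 1, e 4⁆ = 0
  b34 : ⁅e 2, e 3⁆ = 0
  b35 : ⁅e 2, e 4⁆ = 0
  b45 : ⁅e 3, e 4⁆ = e 3
  isotropy : K = Submodule.span ℝ {e 2 + e 3}

/-- The coefficient `b = ⟨e₂, e₂⟩` of an invariant metric, where the element `e₂` of the Lie algebra
is regarded as a tangent vector of `M` at `o` through the orbit map. -/
def coeffB [MulAction G M] [IsManifold 𝓘(ℝ, Eu 4) ∞ M] (g : PseudoRiemannianMetric 4 M) (o : M)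
    (e : Module.Basis (Fin 5) ℝ (GroupLieAlgebra 𝓘(ℝ, Eu 5) G)) : ℝ :=
  g.val ((1 : G) • o) (orbitDiff G o (e 1)) (orbitDiff G o (e 1))

end TypeA1

end A1Space

end

/-!
Everything happens at the level of Killing fields. Let `k₁, …, k₄` be the fundamental fields on `M`
of translates of `e₁, …, e₄` by the adjoint action, chosen so that a given point `x` plays the role
of the base point, and let `τ` be that of `½ e₁ + e₅ + s e₄`. At `x` one has `k₄ = -k₃`, and
`k₁, k₂, k₃, τ` form a basis of the tangent space (`IsA1Frame`, `exists_isA1Frame`). Invariance of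
the metric under the isotropy algebra forces, at `x`, `⟨k₂, k₃⟩ = ⟨k₁, k₁⟩ / 2 ≠ 0` and the
  vanishing
of all other scalar products of distinct frame fields except `⟨k₂, τ⟩`, which a suitable choice of
`s` removes (`IsA1Frame.gram`). Only `a = ⟨k₁, k₁⟩`, `b = ⟨k₂, k₂⟩` and `t = ⟨τ, τ⟩` remain.

The pair of Lie algebras admits no reductive decomposition, so the usual algebraic formulas for the
curvature of a homogeneous space are not available. Instead, a Killing field `K` is encoded by the
skew endomorphism `A_K v = ∇_v K`. Since the flow of `K` preserves the connection and the
curvature, for Killing fields `K`, `L`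
* `⟨A_L K, Z⟩` is given by brackets of Killing fields alone (`IsKilling.koszul`),
* `R(K, L) = [A_K, A_L] + A_[K,L]` (`IsKilling.riem_apply`),
* `∇_K R` is the derivation `A_K` applied to `R` (`IsKilling.nablaRiem_apply`).

In the frame these formulas give the full curvature tensor at `x`, in terms of `β = 2b / a` and
`γ = b / t`. For `b = 0` a direct check gives `∇R = 0`; otherwise
`(∇_{k₁} R)(k₂, τ) τ = 4β k₃ ≠ 0`.

For hypersurfaces, the equation of Codazzi (`codazzi_equation`), a consequence of the fact that the
connection pulled back along a map has the pulled-back curvature (`curvatureAlong_eq_riem`), shows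
that a Codazzi second fundamental form makes `ν^⊥` invariant under `R(u, v)` for `u, v ⟂ ν`, where
`ν` is the normal vector (`IsCodazzi.val_riem_eq_zero`). Testing this on a few triples of tangent
vectors shows that no non-null `ν` has this property if `b ≠ 0`
(`IsA1Frame.false_of_val_riem_eq_zero`). Parallel and totally geodesic hypersurfaces are Codazzi.
-/

open scoped Manifold ContDiff Bundle Topology
open Bundle VectorField Filter Set

noncomputable section

namespace A1Space

set_option linter.unusedSectionVars false

/-! ### Components in a chart and smooth fields along maps -/

section Coordinates
variable {n : ℕ} {M : Type*} [TopologicalSpace M] [ChartedSpace (Eu n) M]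
  [IsManifold 𝓘(ℝ, Eu n) ∞ M]

/-- The domain of the preferred chart at `x`. -/
abbrev chartDom (n : ℕ) {M : Type*} [TopologicalSpace M] [ChartedSpace (Eu n) M] (x : M) : Set M :=
    (chartAt (Eu n) x).source

lemma coord_eq_continuousLinearMapAt {x y : M} (hy : y ∈ chartDom n x) (v : Tan n y) (k : Fin n) :
    coord x v k = ((trivializationAt (Eu n) (TangentSpace 𝓘(ℝ, Eu n) : M → Type _)
      x).continuousLinearMapAt ℝ y v) k := by
  rw [Trivialization.continuousLinearMapAt_apply, Trivialization.coe_linearMapAt_of_mem]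
  · rfl
  · exact hy

lemma coord_add {x y : M} (hy : y ∈ chartDom n x) (v w : Tan n y) (k : Fin n) :
    coord x (v + w) k = coord x v k + coord x w k := by
  simp only [coord_eq_continuousLinearMapAt hy, map_add]; rfl

lemma coord_smul {x y : M} (hy : y ∈ chartDom n x) (c : ℝ) (v : Tan n y) (k : Fin n) :
    coord x (c • v) k = c * coord x v k := by
  simp only [coord_eq_continuousLinearMapAt hy, map_smul]; rfl

lemma coord_sum {x y : M} (hy : y ∈ chartDom n x) {ι : Type*} (s : Finset ι) (v : ι → Tan n y)
    (k : Fin n) : coord x (∑ i ∈ s, v i) k = ∑ i ∈ s, coord x (v i) k := by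
  simp only [coord_eq_continuousLinearMapAt hy, map_sum]
  simp

lemma coordField_eq_symmL {x y : M} (hy : y ∈ chartDom n x) (i : Fin n) :
    coordField x i y = (trivializationAt (Eu n) (TangentSpace 𝓘(ℝ, Eu n) : M → Type _)
      x).symmL ℝ y (EuclideanSpace.single i 1) :=
  (Trivialization.symmL_apply (R := ℝ)
    (trivializationAt (Eu n) (TangentSpace 𝓘(ℝ, Eu n) : M → Type _) x) hy _).symm

lemma coord_coordField {x y : M} (hy : y ∈ chartDom n x) (i k : Fin n) :
    coord x (coordField x i y) k = if i = k then 1 else 0 := by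
  rw [coord_eq_continuousLinearMapAt hy, coordField_eq_symmL hy,
    Trivialization.continuousLinearMapAt_symmL _ hy]
  simp [eq_comm]

lemma sum_coord_smul_coordField {x y : M} (hy : y ∈ chartDom n x) (v : Tan n y) :
    ∑ k, coord x v k • coordField x k y = v := by
  have h := Trivialization.symmL_continuousLinearMapAt (R := ℝ)
    (trivializationAt (Eu n) (TangentSpace 𝓘(ℝ, Eu n) : M → Type _) x) hy v
  refine Eq.trans ?_ h
  simp only [coord_eq_continuousLinearMapAt hy, coordField_eq_symmL hy]
  rw [← Finset.sum_congr rfl (fun k _ ↦ ContinuousLinearMap.map_smul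
    ((trivializationAt (Eu n) (TangentSpace 𝓘(ℝ, Eu n) : M → Type _) x).symmL ℝ y) _ _),
    ← map_sum]
  refine congrArg _ ?_
  ext k
  simp [Finset.sum_apply, Pi.single_apply]

lemma ext_coord {x y : M} (hy : y ∈ chartDom n x) {v w : Tan n y}
    (h : ∀ k, coord x v k = coord x w k) : v = w := by
  rw [← sum_coord_smul_coordField hy v, ← sum_coord_smul_coordField hy w]
  simp only [h]

lemma coord_eq_mvfderiv {x y : M} (hy : y ∈ chartDom n x) (v : Tan n y) (k : Fin n) :
    coord x v k = mvfderiv 𝓘(ℝ, Eu n) (fun z : M ↦ (extChartAt 𝓘(ℝ, Eu n) x z) k) y v := by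
  rw [coord_eq_continuousLinearMapAt hy, TangentBundle.continuousLinearMapAt_trivializationAt hy]
  have h1 : MDifferentiableAt 𝓘(ℝ, Eu n) 𝓘(ℝ, Eu n) (extChartAt 𝓘(ℝ, Eu n) x) y :=
    mdifferentiableAt_extChartAt hy
  have h2 : MDifferentiableAt 𝓘(ℝ, Eu n) 𝓘(ℝ) (fun z : Eu n ↦ z k) (extChartAt 𝓘(ℝ, Eu n) x y) :=
    (EuclideanSpace.proj (𝕜 := ℝ) k : Eu n →L[ℝ] ℝ).mdifferentiableAt
  have := mvfderiv_comp_apply y h2 h1 v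
  refine Eq.trans ?_ this.symm
  have h3 : mvfderiv 𝓘(ℝ, Eu n) (fun z : Eu n ↦ z k) (extChartAt 𝓘(ℝ, Eu n) x y) =
     (EuclideanSpace.proj (𝕜 := ℝ) k : Eu n →L[ℝ] ℝ) := by
    have := (EuclideanSpace.proj (𝕜 := ℝ) k : Eu n →L[ℝ] ℝ).mfderiv_eq (x := extChartAt 𝓘(ℝ, Eu n)
      x y)
    ext w
    exact congr($this w)
  rw [h3]
  rfl

variable {m : ℕ} {N : Type*} [TopologicalSpace N] [ChartedSpace (Eu m) N]

/-- A real function is smooth at a point. -/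
abbrev SmoothFun (m : ℕ) {N : Type*} [TopologicalSpace N] [ChartedSpace (Eu m) N] (f : N → ℝ)
    (p : N) : Prop :=
  ContMDiffAt 𝓘(ℝ, Eu m) 𝓘(ℝ) ∞ f p

/-- `V` is a vector field along `F` that is smooth at the point `p`. -/
def SmoothAlongAt (m : ℕ) {N : Type*} [TopologicalSpace N] [ChartedSpace (Eu m) N] (F : N → M) (V :
    (q : N) → Tan n (F q)) (p : N) : Prop :=
  ContMDiffAt 𝓘(ℝ, Eu m) 𝓘(ℝ, Eu n).tangent ∞
    (fun q ↦ (⟨F q, V q⟩ : TangentBundle 𝓘(ℝ, Eu n) M)) p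

lemma contMDiffAt_euclidean_iff {f : N → Eu n} {p : N} :
    ContMDiffAt 𝓘(ℝ, Eu m) 𝓘(ℝ, Eu n) ∞ f p ↔ ∀ k, SmoothFun m (fun q ↦ f q k) p := by
  constructor
  · intro h k
    exact (EuclideanSpace.proj (𝕜 := ℝ) k : Eu n →L[ℝ] ℝ).contMDiff.contMDiffAt.comp p h
  · intro h
    exact ((EuclideanSpace.equiv (Fin n) ℝ).symm : (Fin n → ℝ) →L[ℝ] Eu
      n).contMDiff.contMDiffAt.comp
      p (contMDiffAt_pi_space.2 h)

lemma smoothAlongAt_iff {F : N → M} {V : (q : N) → Tan n (F q)} {p : N} {x : M}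
    (hx : F p ∈ chartDom n x) :
    SmoothAlongAt m F V p ↔ ContMDiffAt 𝓘(ℝ, Eu m) 𝓘(ℝ, Eu n) ∞ F p ∧
      ∀ k, SmoothFun m (fun q ↦ coord x (V q) k) p := by
  have hx' : (⟨F p, V p⟩ : TangentBundle 𝓘(ℝ, Eu n) M) ∈
      (trivializationAt (Eu n) (TangentSpace 𝓘(ℝ, Eu n) : M → Type _) x).source := by
    rw [Trivialization.mem_source]; exact hx
  have h := Trivialization.contMDiffAt_iff (n := ∞) (IB := 𝓘(ℝ, Eu n)) (IM := 𝓘(ℝ, Eu m))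
    (e := trivializationAt (Eu n) (TangentSpace 𝓘(ℝ, Eu n) : M → Type _) x)
    (f := fun q ↦ (⟨F q, V q⟩ : TangentBundle 𝓘(ℝ, Eu n) M)) (x₀ := p) hx'
  exact h.trans (and_congr_right fun _ ↦ contMDiffAt_euclidean_iff)

lemma SmoothFun.mdifferentiableAt {f : N → ℝ} {p : N} (hf : SmoothFun m f p) :
    MDifferentiableAt 𝓘(ℝ, Eu m) 𝓘(ℝ) f p :=
  ContMDiffAt.mdifferentiableAt hf (by simp)

lemma SmoothFun.add {f g : N → ℝ} {p : N} (hf : SmoothFun m f p) (hg : SmoothFun m g p) :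
    SmoothFun m (fun q ↦ f q + g q) p := ContMDiffAt.add hf hg

lemma SmoothFun.sub {f g : N → ℝ} {p : N} (hf : SmoothFun m f p) (hg : SmoothFun m g p) :
    SmoothFun m (fun q ↦ f q - g q) p := ContMDiffAt.sub hf hg

lemma SmoothFun.mul {f g : N → ℝ} {p : N} (hf : SmoothFun m f p) (hg : SmoothFun m g p) :
    SmoothFun m (fun q ↦ f q * g q) p := ContMDiffAt.mul hf hg

lemma SmoothFun.sum {ι : Type*} {s : Finset ι} {f : ι → N → ℝ} {p : N}
    (hf : ∀ i ∈ s, SmoothFun m (f i) p) : SmoothFun m (fun q ↦ ∑ i ∈ s, f i q) p :=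
  contMDiffAt_finsetSum hf

lemma SmoothFun.prod {ι : Type*} {s : Finset ι} {f : ι → N → ℝ} {p : N}
    (hf : ∀ i ∈ s, SmoothFun m (f i) p) : SmoothFun m (fun q ↦ ∏ i ∈ s, f i q) p :=
  contMDiffAt_finsetProd hf

lemma SmoothFun.const (c : ℝ) (p : N) : SmoothFun m (fun _ ↦ c) p := contMDiffAt_const

lemma SmoothAlongAt.base {F : N → M} {V : (q : N) → Tan n (F q)} {p : N}
    (h : SmoothAlongAt m F V p) : ContMDiffAt 𝓘(ℝ, Eu m) 𝓘(ℝ, Eu n) ∞ F p :=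
  ((smoothAlongAt_iff (mem_chart_source (Eu n) (F p))).1 h).1

lemma SmoothAlongAt.coord {F : N → M} {V : (q : N) → Tan n (F q)} {p : N}
    (h : SmoothAlongAt m F V p) {x : M} (hx : F p ∈ chartDom n x) (k : Fin n) :
    SmoothFun m (fun q ↦ coord x (V q) k) p :=
  ((smoothAlongAt_iff hx).1 h).2 k

lemma eventually_mem_chartDom {F : N → M} {p : N} {x : M} (hF : ContinuousAt F p)
    (hx : F p ∈ chartDom n x) : ∀ᶠ q in 𝓝 p, F q ∈ chartDom n x :=
  hF.eventually ((chartAt (Eu n) x).open_source.mem_nhds hx)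

lemma SmoothAlongAt.add {F : N → M} {V W : (q : N) → Tan n (F q)} {p : N}
    (hV : SmoothAlongAt m F V p) (hW : SmoothAlongAt m F W p) :
    SmoothAlongAt m F (fun q ↦ V q + W q) p := by
  have hx := mem_chart_source (Eu n) (F p)
  refine (smoothAlongAt_iff hx).2 ⟨hV.base, fun k ↦ ?_⟩
  refine ((hV.coord hx k).add (hW.coord hx k)).congr_of_eventuallyEq ?_
  filter_upwards [eventually_mem_chartDom hV.base.continuousAt hx] with q hq
  exact coord_add hq _ _ _

lemma SmoothAlongAt.smul {F : N → M} {V : (q : N) → Tan n (F q)} {f : N → ℝ} {p : N}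
    (hf : SmoothFun m f p) (hV : SmoothAlongAt m F V p) :
    SmoothAlongAt m F (fun q ↦ f q • V q) p := by
  have hx := mem_chart_source (Eu n) (F p)
  refine (smoothAlongAt_iff hx).2 ⟨hV.base, fun k ↦ ?_⟩
  refine (hf.mul (hV.coord hx k)).congr_of_eventuallyEq ?_
  filter_upwards [eventually_mem_chartDom hV.base.continuousAt hx] with q hq
  exact coord_smul hq _ _ _

lemma SmoothAlongAt.congr {F : N → M} {V W : (q : N) → Tan n (F q)} {p : N}
    (hV : SmoothAlongAt m F V p) (h : ∀ᶠ q in 𝓝 p, W q = V q) : SmoothAlongAt m F W p := by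
  refine ContMDiffAt.congr_of_eventuallyEq hV ?_
  filter_upwards [h] with q hq
  rw [hq]

lemma SmoothAlongAt.zero {F : N → M} {p : N} (hF : ContMDiffAt 𝓘(ℝ, Eu m) 𝓘(ℝ, Eu n) ∞ F p) :
    SmoothAlongAt (n := n) m F (fun _ ↦ 0) p := by
  have hx := mem_chart_source (Eu n) (F p)
  refine (smoothAlongAt_iff hx).2 ⟨hF, fun k ↦ ?_⟩
  refine (SmoothFun.const 0 p).congr_of_eventuallyEq ?_
  filter_upwards [eventually_mem_chartDom hF.continuousAt hx] with q hq
  simpa using coord_smul hq (0 : ℝ) (0 : Tan n (F q)) k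

lemma SmoothAlongAt.sum {F : N → M} {ι : Type*} {s : Finset ι} {V : ι → (q : N) → Tan n (F q)}
    {p : N} (hF : ContMDiffAt 𝓘(ℝ, Eu m) 𝓘(ℝ, Eu n) ∞ F p)
    (hV : ∀ i ∈ s, SmoothAlongAt m F (V i) p) :
    SmoothAlongAt m F (fun q ↦ ∑ i ∈ s, V i q) p := by
  classical
  induction s using Finset.induction_on with
  | empty => simpa using SmoothAlongAt.zero hF
  | insert i s hi ih =>
    simp only [Finset.sum_insert hi]
    exact (hV i (by simp)).add (ih fun j hj ↦ hV j (by simp [hj]))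

/-- `X` is a vector field that is smooth at the point `x`. -/
abbrev SmoothFieldAt (X : (x : M) → Tan n x) (x : M) : Prop :=
  SmoothAlongAt n (fun x : M ↦ x) X x

lemma smoothFieldAt_coordField {x y : M} (hy : y ∈ chartDom n x) (i : Fin n) :
    SmoothFieldAt (coordField x i) y := by
  refine (smoothAlongAt_iff hy).2 ⟨contMDiffAt_id, fun k ↦ ?_⟩
  refine (SmoothFun.const (if i = k then 1 else 0) y).congr_of_eventuallyEq ?_
  filter_upwards [(chartAt (Eu n) x).open_source.mem_nhds hy] with z hz
  exact coord_coordField hz _ _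

lemma SmoothFieldAt.comp {F : N → M} {X : (x : M) → Tan n x} {p : N}
    (hX : SmoothFieldAt X (F p)) (hF : ContMDiffAt 𝓘(ℝ, Eu m) 𝓘(ℝ, Eu n) ∞ F p) :
    SmoothAlongAt m F (fun q ↦ X (F q)) p :=
  ContMDiffAt.comp p (g := fun y : M ↦ (⟨y, X y⟩ : TangentBundle 𝓘(ℝ, Eu n) M)) hX hF

lemma PseudoRiemannianMetric.smoothFun_val (g : PseudoRiemannianMetric n M) {F : N → M}
    {V W : (q : N) → Tan n (F q)} {p : N}
    (hV : SmoothAlongAt m F V p) (hW : SmoothAlongAt m F W p) :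
    SmoothFun m (fun q ↦ g.val (F q) (V q) (W q)) p := by
  have h : ContMDiffAt 𝓘(ℝ, Eu m) (𝓘(ℝ, Eu n).prod 𝓘(ℝ)) ∞
      (fun q ↦ (⟨F q, g.val (F q) (V q) (W q)⟩ : TotalSpace ℝ (Trivial M ℝ))) p :=
    ContMDiffAt.clm_bundle_apply₂ (F₁ := Eu n) (F₂ := Eu n)
      (g.contMDiff.contMDiffAt.comp p hV.base) hV hW
  exact ((contMDiffAt_totalSpace).1 h).2

lemma SmoothFieldAt.deriv_map [IsManifold 𝓘(ℝ, Eu m) ∞ N] {F : N → M} {X : (q : N) → Tan m q} {p :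
    N}
    (hF : ContMDiffAt 𝓘(ℝ, Eu m) 𝓘(ℝ, Eu n) ∞ F p) (hX : SmoothFieldAt X p) :
    SmoothAlongAt m F (fun q ↦ mfderiv 𝓘(ℝ, Eu m) 𝓘(ℝ, Eu n) F q (X q)) p := by
  have h := hF.mfderiv_const (m := ∞) (by simp)
  exact ContMDiffAt.clm_apply_of_inCoordinates (F₁ := Eu m) (F₂ := Eu n) h hX hF

lemma SmoothFieldAt.deriv_fun [IsManifold 𝓘(ℝ, Eu m) ∞ N] {f : N → ℝ} {X : (q : N) → Tan m q} {p :
    N}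
    (hf : SmoothFun m f p) (hX : SmoothFieldAt X p) :
    SmoothFun m (fun q ↦ mvfderiv 𝓘(ℝ, Eu m) f q (X q)) p := by
  have h := ContMDiffAt.mfderiv_const (m := ∞) hf (by simp)
  have h' : ContMDiffAt 𝓘(ℝ, Eu m) 𝓘(ℝ).tangent ∞ (fun q ↦
      (⟨f q, mfderiv 𝓘(ℝ, Eu m) 𝓘(ℝ) f q (X q)⟩ : TangentBundle 𝓘(ℝ) ℝ)) p :=
    ContMDiffAt.clm_apply_of_inCoordinates (F₁ := Eu m) (F₂ := ℝ) h hX hf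
  exact (contMDiff_snd_tangentBundle_modelSpace ℝ 𝓘(ℝ, ℝ)).contMDiffAt.comp p h'

end Coordinates

/-! ### Lie brackets and maps -/

section Bracket
variable {E H M : Type*} [NormedAddCommGroup E] [NormedSpace ℝ E] [CompleteSpace E]
  [TopologicalSpace H]
  {I : ModelWithCorners ℝ E H} [I.Boundaryless] [TopologicalSpace M] [ChartedSpace H M]
  [IsManifold I 3 M]

variable {V : Type*} [NormedAddCommGroup V] [NormedSpace ℝ V]

/-- The derivative of a `C²` map along a differentiable vector field is differentiable, and
`[X, Y]` acts on such maps as the commutator of the derivatives along `X` and `Y`. -/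
theorem mdifferentiableAt_and_mvfderiv_mlieBracket {f : M → V} {X Y : (q : M) → TangentSpace I q}
    {p : M}
    (hf : ContMDiffAt I 𝓘(ℝ, V) 2 f p)
    (hX : MDifferentiableAt I I.tangent (fun q ↦ (⟨q, X q⟩ : TangentBundle I M)) p)
    (hY : MDifferentiableAt I I.tangent (fun q ↦ (⟨q, Y q⟩ : TangentBundle I M)) p) :
    MDifferentiableAt I 𝓘(ℝ, V) (fun q ↦ mvfderiv I f q (X q)) p ∧
    mvfderiv I f p (mlieBracket I X Y p) =
      mvfderiv I (fun q ↦ mvfderiv I f q (Y q)) p (X p) -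
      mvfderiv I (fun q ↦ mvfderiv I f q (X q)) p (Y p) := by
  have hI2 : IsManifold I 2 M := IsManifold.of_le (n := 3) (by norm_cast)
  have hI1 : IsManifold I 1 M := IsManifold.of_le (n := 3) (by norm_cast)
  have hI2' : IsManifold I (minSmoothness ℝ 2) M := by simpa using hI2
  set φ := extChartAt I p with hφ
  have hp : φ.symm (φ p) = p := extChartAt_to_inv p
  have hsm : ContMDiffAt 𝓘(ℝ, E) I 3 φ.symm (φ p) := by
    have := contMDiffOn_extChartAt_symm (I := I) (n := 3) p
    exact this.contMDiffAt (extChartAt_target_mem_nhds p)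
  have hinv : ∀ᶠ y in 𝓝 (φ p), (mfderiv 𝓘(ℝ, E) I φ.symm y).IsInvertible := by
    filter_upwards [extChartAt_target_mem_nhds (I := I) p] with y hy
    have := isInvertible_mfderivWithin_extChartAt_symm (I := I) hy
    rwa [I.range_eq_univ, mfderivWithin_univ] at this
  have hd : ∀ᶠ y in 𝓝 (φ p), MDifferentiableAt 𝓘(ℝ, E) I φ.symm y := by
    filter_upwards [(contMDiffAt_iff_contMDiffAt_nhds (n := 3) (by decide)).1 hsm] with y hy
    exact hy.mdifferentiableAt (by simp)
  have hfd : ∀ᶠ q in 𝓝 p, MDifferentiableAt I 𝓘(ℝ, V) f q := by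
    filter_upwards [(contMDiffAt_iff_contMDiffAt_nhds (n := 2) (by decide)).1 hf] with y hy
    exact hy.mdifferentiableAt (by simp)
  have hcont : Tendsto φ.symm (𝓝 (φ p)) (𝓝 p) := by
    have := hsm.continuousAt.tendsto
    rwa [hp] at this
  -- the derivative of `f` along a field, read in the chart
  have key : ∀ Z : (q : M) → TangentSpace I q, ∀ᶠ y in 𝓝 (φ p),
      fderiv ℝ (f ∘ φ.symm) y (mpullback 𝓘(ℝ, E) I φ.symm Z y) =
        mvfderiv I f (φ.symm y) (Z (φ.symm y)) := by
    intro Z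
    filter_upwards [hinv, hd, hcont.eventually hfd] with y h1 h2 h3
    have h4 := mfderiv_comp_apply y h3 h2 (mpullback 𝓘(ℝ, E) I φ.symm Z y)
    have h5 : (mfderiv 𝓘(ℝ, E) I φ.symm y) (mpullback 𝓘(ℝ, E) I φ.symm Z y) = Z (φ.symm y) := by
      rw [mpullback_apply]
      exact h1.self_apply_inverse _
    rw [h5] at h4
    refine Eq.trans ?_ h4
    have h6 : mfderiv 𝓘(ℝ, E) 𝓘(ℝ, V) (f ∘ φ.symm) y = fderiv ℝ (f ∘ φ.symm) y := mfderiv_eq_fderiv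
    exact congr($h6 (mpullback 𝓘(ℝ, E) I φ.symm Z y)).symm
  have hfs : ContMDiffAt 𝓘(ℝ, E) 𝓘(ℝ, V) 2 (f ∘ φ.symm) (φ p) := by
    refine ContMDiffAt.comp (φ p) (I' := I) ?_ (hsm.of_le (by norm_cast))
    rwa [hp]
  have hZ : ∀ Z : (q : M) → TangentSpace I q,
      MDifferentiableAt I I.tangent (fun q ↦ (⟨q, Z q⟩ : TangentBundle I M)) p →
      DifferentiableAt ℝ (mpullback 𝓘(ℝ, E) I φ.symm Z) (φ p) := by
    intro Z hZ
    have h1 := MDifferentiableAt.mpullback_vectorField (V := Z) (f := φ.symm) (x₀ := φ p)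
      (I := 𝓘(ℝ, E)) (n := 3) (by rwa [hp]) hsm hinv.self_of_nhds (by norm_cast)
    exact ((contMDiff_snd_tangentBundle_modelSpace E 𝓘(ℝ, E)).contMDiffAt.mdifferentiableAt
      one_ne_zero |>.comp _ h1).differentiableAt
  have hb := mpullback_mlieBracket (I := 𝓘(ℝ, E)) (I' := I) (f := φ.symm) (x₀ := φ p)
    (n := 3) (V := X) (W := Y) (by rwa [hp]) (by rwa [hp]) hsm
    (by simp; norm_cast)
  have h1 := fderiv_apply_lieBracket (𝕜 := ℝ) hfs.contDiffAt (by simp) (hZ Y hY) (hZ X hX)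
  have hk := (key (mlieBracket I X Y)).self_of_nhds
  have e1 : mlieBracket 𝓘(ℝ, E) (mpullback 𝓘(ℝ, E) I φ.symm X) (mpullback 𝓘(ℝ, E) I φ.symm Y) =
      lieBracket ℝ (mpullback 𝓘(ℝ, E) I φ.symm X) (mpullback 𝓘(ℝ, E) I φ.symm Y) := by
    rw [← mlieBracketWithin_univ, mlieBracketWithin_eq_lieBracketWithin]
    exact lieBracketWithin_univ
  rw [hb, e1] at hk
  rw [hk] at h1
  -- derivatives in the chart of the functions `df(Z)`
  have hmd : ∀ Z : (q : M) → TangentSpace I q,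
      MDifferentiableAt I I.tangent (fun q ↦ (⟨q, Z q⟩ : TangentBundle I M)) p →
      MDifferentiableAt I 𝓘(ℝ, V) (fun q ↦ mvfderiv I f q (Z q)) p := by
    intro Z hZ'
    have hdf : DifferentiableAt ℝ (fun y ↦ fderiv ℝ (f ∘ φ.symm) y
        (mpullback 𝓘(ℝ, E) I φ.symm Z y)) (φ p) := by
      refine DifferentiableAt.clm_apply ?_ (hZ Z hZ')
      exact (hfs.contDiffAt.fderiv_right (m := 1) (by norm_cast)).differentiableAt (by simp)
    have h3 : MDifferentiableAt I 𝓘(ℝ, E) φ p := mdifferentiableAt_extChartAt (mem_chart_source H p)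
    have h4 := hdf.mdifferentiableAt.comp p h3
    refine h4.congr_of_eventuallyEq ?_
    have h5 : Tendsto φ (𝓝 p) (𝓝 (φ p)) := h3.continuousAt
    filter_upwards [h5.eventually (key Z), extChartAt_source_mem_nhds (I := I) p] with q hq hq'
    have h6 : φ.symm (φ q) = q := φ.left_inv hq'
    rw [Function.comp_apply, hq, h6]
  have h2 : ∀ Z W : (q : M) → TangentSpace I q,
      MDifferentiableAt I I.tangent (fun q ↦ (⟨q, Z q⟩ : TangentBundle I M)) p →
      fderiv ℝ (fun y ↦ fderiv ℝ (f ∘ φ.symm) y (mpullback 𝓘(ℝ, E) I φ.symm Z y)) (φ p)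
        (mpullback 𝓘(ℝ, E) I φ.symm W (φ p)) =
      mvfderiv I (fun q ↦ mvfderiv I f q (Z q)) (φ.symm (φ p)) (W (φ.symm (φ p))) := by
    intro Z W hZ'
    have hev : (fun y ↦ fderiv ℝ (f ∘ φ.symm) y (mpullback 𝓘(ℝ, E) I φ.symm Z y)) =ᶠ[𝓝 (φ p)]
      ((fun q ↦ mvfderiv I f q (Z q)) ∘ φ.symm) := key Z
    rw [hev.fderiv_eq]
    have hmd := hmd Z hZ'
    rw [← hp] at hmd
    have h4 := mfderiv_comp_apply (φ p) hmd hd.self_of_nhds (mpullback 𝓘(ℝ, E) I φ.symm W (φ p))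
    have h5 : (mfderiv 𝓘(ℝ, E) I φ.symm (φ p)) (mpullback 𝓘(ℝ, E) I φ.symm W (φ p)) =
        W (φ.symm (φ p)) := by
      rw [mpullback_apply]
      exact hinv.self_of_nhds.self_apply_inverse _
    rw [h5] at h4
    refine Eq.trans ?_ h4
    have h6 : mfderiv 𝓘(ℝ, E) 𝓘(ℝ, V) ((fun q ↦ mvfderiv I f q (Z q)) ∘ φ.symm) (φ p) =
      fderiv ℝ ((fun q ↦ mvfderiv I f q (Z q)) ∘ φ.symm) (φ p) := mfderiv_eq_fderiv
    exact congr($h6 (mpullback 𝓘(ℝ, E) I φ.symm W (φ p))).symm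
  rw [h2 Y X hY, h2 X Y hX, hp] at h1
  exact ⟨hmd X hX, h1⟩

/-- Brackets of `F`-related vector fields are `F`-related, for an arbitrary `C²` map `F`. -/
theorem mlieBracket_related {E' H' M' : Type*} [NormedAddCommGroup E'] [NormedSpace ℝ E']
    [CompleteSpace E'] [TopologicalSpace H'] {I' : ModelWithCorners ℝ E' H'} [I'.Boundaryless]
    [TopologicalSpace M'] [ChartedSpace H' M'] [IsManifold I' 3 M']
    [FiniteDimensional ℝ E']
    {F : M → M'} {X Y : (q : M) → TangentSpace I q} {X' Y' : (q : M') → TangentSpace I' q} {p : M}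
    (hF : ContMDiffAt I I' 2 F p)
    (hX : MDifferentiableAt I I.tangent (fun q ↦ (⟨q, X q⟩ : TangentBundle I M)) p)
    (hY : MDifferentiableAt I I.tangent (fun q ↦ (⟨q, Y q⟩ : TangentBundle I M)) p)
    (hX' : MDifferentiableAt I' I'.tangent (fun q ↦ (⟨q, X' q⟩ : TangentBundle I' M')) (F p))
    (hY' : MDifferentiableAt I' I'.tangent (fun q ↦ (⟨q, Y' q⟩ : TangentBundle I' M')) (F p))
    (hXX' : ∀ᶠ q in 𝓝 p, mfderiv I I' F q (X q) = X' (F q))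
    (hYY' : ∀ᶠ q in 𝓝 p, mfderiv I I' F q (Y q) = Y' (F q)) :
    mfderiv I I' F p (mlieBracket I X Y p) = mlieBracket I' X' Y' (F p) := by
  set ψ := extChartAt I' (F p) with hψ
  have hψs : ContMDiffAt I' 𝓘(ℝ, E') 2 ψ (F p) := contMDiffAt_extChartAt' (mem_chart_source H' (F
    p))
  have hFd : ∀ᶠ q in 𝓝 p, MDifferentiableAt I I' F q := by
    filter_upwards [(contMDiffAt_iff_contMDiffAt_nhds (n := 2) (by decide)).1 hF] with y hy
    exact hy.mdifferentiableAt (by simp)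
  have hψd : ∀ᶠ q in 𝓝 p, MDifferentiableAt I' 𝓘(ℝ, E') ψ (F q) := by
    refine hF.continuousAt.eventually ?_
    filter_upwards [(contMDiffAt_iff_contMDiffAt_nhds (n := 2) (by decide)).1 hψs] with y hy
    exact hy.mdifferentiableAt (by simp)
  have hc := hψs.comp p hF
  have h1 := (mdifferentiableAt_and_mvfderiv_mlieBracket hc hX hY).2
  have h2 := mdifferentiableAt_and_mvfderiv_mlieBracket hψs hX' hY'
  have h3 := mdifferentiableAt_and_mvfderiv_mlieBracket hψs hY' hX'
  -- `d(ψ ∘ F)(Z) = dψ(Z') ∘ F` for `F`-related fields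
  have key : ∀ (Z W : (q : M) → TangentSpace I q) (Z' W' : (q : M') → TangentSpace I' q),
      (∀ᶠ q in 𝓝 p, mfderiv I I' F q (Z q) = Z' (F q)) →
      (∀ᶠ q in 𝓝 p, mfderiv I I' F q (W q) = W' (F q)) →
      MDifferentiableAt I' 𝓘(ℝ, E') (fun q ↦ mvfderiv I' ψ q (Z' q)) (F p) →
      mvfderiv I (fun q ↦ mvfderiv I (ψ ∘ F) q (Z q)) p (W p) =
        mvfderiv I' (fun q ↦ mvfderiv I' ψ q (Z' q)) (F p) (W' (F p)) := by
    intro Z W Z' W' hZ hW hd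
    have hev : (fun q ↦ mvfderiv I (ψ ∘ F) q (Z q)) =ᶠ[𝓝 p]
        ((fun q ↦ mvfderiv I' ψ q (Z' q)) ∘ F) := by
      filter_upwards [hZ, hFd, hψd] with q h1 h2 h3
      have := mfderiv_comp_apply q h3 h2 (Z q)
      rw [h1] at this
      exact this
    have h4 := mfderiv_comp_apply p hd hFd.self_of_nhds (W p)
    rw [hW.self_of_nhds] at h4
    have h5 := hev.mfderiv_eq (I := I) (I' := 𝓘(ℝ, E'))
    exact (congr($h5 (W p))).trans h4
  rw [key Y X Y' X' hYY' hXX' h3.1, key X Y X' Y' hXX' hYY' h2.1, ← h2.2] at h1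
  have h4 := mfderiv_comp_apply p hψd.self_of_nhds hFd.self_of_nhds (mlieBracket I X Y p)
  have h5 := h4.symm.trans h1
  have hinj := (isInvertible_mfderiv_extChartAt (I := I') (mem_extChartAt_source (F p))).injective
  exact hinj h5
end Bracket

lemma one_le_infty : (1 : WithTop ℕ∞) ≤ ∞ := by exact_mod_cast (le_top : (1 : ℕ∞) ≤ ⊤)

lemma two_le_infty : (2 : WithTop ℕ∞) ≤ ∞ := WithTop.coe_le_coe.2 (le_top : (2 : ℕ∞) ≤ ⊤)

lemma three_le_infty : (3 : WithTop ℕ∞) ≤ ∞ := WithTop.coe_le_coe.2 (le_top : (3 : ℕ∞) ≤ ⊤)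

lemma sum_swap_first_last {ι : Type*} [Fintype ι] (f : ι → ι → ι → ι → ℝ) :
    ∑ i, ∑ j, ∑ l, ∑ r, f i j l r = ∑ r, ∑ j, ∑ l, ∑ i, f i j l r := by
  calc _ = ∑ i, ∑ r, ∑ j, ∑ l, f i j l r := Finset.sum_congr rfl fun i _ ↦ by
        rw [Finset.sum_congr rfl fun j _ ↦ Finset.sum_comm, Finset.sum_comm]
    _ = ∑ r, ∑ i, ∑ j, ∑ l, f i j l r := Finset.sum_comm
    _ = _ := Finset.sum_congr rfl fun r _ ↦ by
        rw [Finset.sum_comm]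
        exact Finset.sum_congr rfl fun j _ ↦ Finset.sum_comm

/-! ### The Levi-Civita derivative along maps -/

section CovariantDerivative
variable {m n : ℕ}
  {N : Type*} [TopologicalSpace N] [ChartedSpace (Eu m) N] [IsManifold 𝓘(ℝ, Eu m) ∞ N]
  {M : Type*} [TopologicalSpace M] [ChartedSpace (Eu n) M] [IsManifold 𝓘(ℝ, Eu n) ∞ M]

lemma SmoothAlongAt.mdifferentiableAt {F : N → M} {V : (q : N) → Tan n (F q)} {p : N}
    (h : SmoothAlongAt m F V p) : MDifferentiableAt 𝓘(ℝ, Eu m) 𝓘(ℝ, Eu n).tangent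
      (fun q ↦ (⟨F q, V q⟩ : TangentBundle 𝓘(ℝ, Eu n) M)) p :=
  ContMDiffAt.mdifferentiableAt h (by simp)

lemma mvfderiv_bracket {f : N → ℝ} {X Y : (q : N) → Tan m q} {p : N}
    (hf : SmoothFun m f p) (hX : SmoothFieldAt X p) (hY : SmoothFieldAt Y p) :
    mvfderiv 𝓘(ℝ, Eu m) f p (mlieBracket 𝓘(ℝ, Eu m) X Y p) =
      mvfderiv 𝓘(ℝ, Eu m) (fun q ↦ mvfderiv 𝓘(ℝ, Eu m) f q (Y q)) p (X p) -
      mvfderiv 𝓘(ℝ, Eu m) (fun q ↦ mvfderiv 𝓘(ℝ, Eu m) f q (X q)) p (Y p) := by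
  have : IsManifold 𝓘(ℝ, Eu m) 3 N := IsManifold.of_le (n := ∞) three_le_infty
  exact (mdifferentiableAt_and_mvfderiv_mlieBracket (hf.of_le two_le_infty) hX.mdifferentiableAt
    hY.mdifferentiableAt).2

lemma SmoothFieldAt.mlieBracket {X Y : (x : M) → Tan n x} {x : M}
    (hX : SmoothFieldAt X x) (hY : SmoothFieldAt Y x) :
    SmoothFieldAt (mlieBracket 𝓘(ℝ, Eu n) X Y) x := by
  have : IsManifold 𝓘(ℝ, Eu n) (((⊤ : ℕ∞) : WithTop ℕ∞) + 1) M :=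
    (inferInstance : IsManifold 𝓘(ℝ, Eu n) ∞ M)
  have : IsManifold 𝓘(ℝ, Eu n) (minSmoothness ℝ 2) M := by
    rw [minSmoothness_of_isRCLikeNormedField]
    exact IsManifold.of_le (n := ∞) two_le_infty
  have h : minSmoothness ℝ (((⊤ : ℕ∞) : WithTop ℕ∞) + 1) ≤ ((⊤ : ℕ∞) : WithTop ℕ∞) := by
    rw [minSmoothness_of_isRCLikeNormedField]
    exact le_rfl
  exact ContMDiffAt.mlieBracket_vectorField (m := ⊤) (n := ⊤) hX hY h

lemma mvfderiv_sum {ι : Type*} {s : Finset ι} {f : ι → N → ℝ} {p : N}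
    (hf : ∀ i ∈ s, SmoothFun m (f i) p) (v : Tan m p) :
    mvfderiv 𝓘(ℝ, Eu m) (fun q ↦ ∑ i ∈ s, f i q) p v =
      ∑ i ∈ s, mvfderiv 𝓘(ℝ, Eu m) (f i) p v := by
  classical
  induction s using Finset.induction_on with
  | empty => simp [mvfderiv_const]
  | insert i s hi ih =>
    simp only [Finset.sum_insert hi]
    rw [mvfderiv_fun_add (hf i (by simp)).mdifferentiableAt
      (SmoothFun.sum fun j hj ↦ hf j (by simp [hj])).mdifferentiableAt]
    rw [add_apply, ih fun j hj ↦ hf j (by simp [hj])]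

lemma mvfderiv_mul_apply {f g : N → ℝ} {p : N} (hf : SmoothFun m f p) (hg : SmoothFun m g p)
    (v : Tan m p) : mvfderiv 𝓘(ℝ, Eu m) (fun q ↦ f q * g q) p v =
      f p * mvfderiv 𝓘(ℝ, Eu m) g p v + g p * mvfderiv 𝓘(ℝ, Eu m) f p v := by
  rw [mvfderiv_fun_mul hf.mdifferentiableAt hg.mdifferentiableAt]
  rfl

lemma mvfderiv_congr {f g : N → ℝ} {p : N} (h : f =ᶠ[𝓝 p] g) (v : Tan m p) :
    mvfderiv 𝓘(ℝ, Eu m) f p v = mvfderiv 𝓘(ℝ, Eu m) g p v := by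
  have := h.mfderiv_eq (I := 𝓘(ℝ, Eu m)) (I' := 𝓘(ℝ))
  exact congr($this v)

lemma mvfderiv_comp_smoothFun {f : M → ℝ} {F : N → M} {p : N} (hf : SmoothFun n f (F p))
    (hF : ContMDiffAt 𝓘(ℝ, Eu m) 𝓘(ℝ, Eu n) ∞ F p) (v : Tan m p) :
    mvfderiv 𝓘(ℝ, Eu m) (fun q ↦ f (F q)) p v =
      mvfderiv 𝓘(ℝ, Eu n) f (F p) (mfderiv 𝓘(ℝ, Eu m) 𝓘(ℝ, Eu n) F p v) :=
  mvfderiv_comp_apply p hf.mdifferentiableAt (hF.mdifferentiableAt (by simp)) v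

variable (g : PseudoRiemannianMetric n M)

namespace PseudoRiemannianMetric

lemma coord_covDerivAlong (F : N → M) (V : (q : N) → Tan n (F q)) (p : N) (v : Tan m p)
    (k : Fin n) : coord (F p) (g.covDerivAlong F V p v) k =
      mvfderiv 𝓘(ℝ, Eu m) (fun q ↦ coord (F p) (V q) k) p v +
      ∑ i : Fin n, ∑ j : Fin n, g.christoffel (F p) k i j *
        coord (F p) (mfderiv 𝓘(ℝ, Eu m) 𝓘(ℝ, Eu n) F p v) i * coord (F p) (V p) j := by
  have hx := mem_chart_source (Eu n) (F p)
  rw [covDerivAlong, coord_sum hx]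
  simp only [coord_smul hx, coord_coordField hx]
  simp

variable {F : N → M} {V W : (q : N) → Tan n (F q)} {p : N}

lemma covDerivAlong_add_dir (v w : Tan m p) : g.covDerivAlong F V p (v + w) =
    g.covDerivAlong F V p v + g.covDerivAlong F V p w := by
  have hx := mem_chart_source (Eu n) (F p)
  refine ext_coord hx fun k ↦ ?_
  simp only [coord_add hx, coord_covDerivAlong, map_add, mul_add, add_mul, Finset.sum_add_distrib]
  ring

lemma covDerivAlong_smul_dir (c : ℝ) (v : Tan m p) : g.covDerivAlong F V p (c • v) =
    c • g.covDerivAlong F V p v := by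
  have hx := mem_chart_source (Eu n) (F p)
  refine ext_coord hx fun k ↦ ?_
  simp only [coord_smul hx, coord_covDerivAlong, map_smul, mul_add, Finset.mul_sum, smul_eq_mul]
  congr 1
  refine Finset.sum_congr rfl fun i _ ↦ Finset.sum_congr rfl fun j _ ↦ ?_
  ring

/-- The covariant derivative as a linear map in the direction. -/
def covDerivL (F : N → M) (V : (q : N) → Tan n (F q)) (p : N) : Tan m p →ₗ[ℝ] Tan n (F p) where
  toFun := g.covDerivAlong F V p
  map_add' := g.covDerivAlong_add_dir
  map_smul' := g.covDerivAlong_smul_dir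

lemma covDerivAlong_sum_dir {ι : Type*} (s : Finset ι) (v : ι → Tan m p) :
    g.covDerivAlong F V p (∑ i ∈ s, v i) = ∑ i ∈ s, g.covDerivAlong F V p (v i) :=
  map_sum (g.covDerivL F V p) v s

lemma covDerivAlong_congr (h : ∀ᶠ q in 𝓝 p, V q = W q) (v : Tan m p) :
    g.covDerivAlong F V p v = g.covDerivAlong F W p v := by
  have hx := mem_chart_source (Eu n) (F p)
  refine ext_coord hx fun k ↦ ?_
  rw [coord_covDerivAlong, coord_covDerivAlong, h.self_of_nhds]
  congr 1
  refine mvfderiv_congr ?_ v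
  filter_upwards [h] with q hq
  rw [hq]

lemma covDerivAlong_add (hV : SmoothAlongAt m F V p) (hW : SmoothAlongAt m F W p) (v : Tan m p) :
    g.covDerivAlong F (fun q ↦ V q + W q) p v =
      g.covDerivAlong F V p v + g.covDerivAlong F W p v := by
  have hx := mem_chart_source (Eu n) (F p)
  refine ext_coord hx fun k ↦ ?_
  have hev : (fun q ↦ coord (F p) (V q + W q) k) =ᶠ[𝓝 p]
      fun q ↦ coord (F p) (V q) k + coord (F p) (W q) k := by
    filter_upwards [eventually_mem_chartDom hV.base.continuousAt hx] with q hq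
    exact coord_add hq _ _ _
  simp only [coord_add hx, coord_covDerivAlong]
  rw [mvfderiv_congr hev, mvfderiv_fun_add (hV.coord hx k).mdifferentiableAt
    (hW.coord hx k).mdifferentiableAt, add_apply]
  simp only [mul_add, Finset.sum_add_distrib]
  ring

lemma covDerivAlong_smul {f : N → ℝ} (hf : SmoothFun m f p) (hV : SmoothAlongAt m F V p)
    (v : Tan m p) : g.covDerivAlong F (fun q ↦ f q • V q) p v =
      mvfderiv 𝓘(ℝ, Eu m) f p v • V p + f p • g.covDerivAlong F V p v := by
  have hx := mem_chart_source (Eu n) (F p)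
  refine ext_coord hx fun k ↦ ?_
  have hev : (fun q ↦ coord (F p) (f q • V q) k) =ᶠ[𝓝 p]
      fun q ↦ f q * coord (F p) (V q) k := by
    filter_upwards [eventually_mem_chartDom hV.base.continuousAt hx] with q hq
    exact coord_smul hq _ _ _
  simp only [coord_add hx, coord_smul hx, coord_covDerivAlong]
  rw [mvfderiv_congr hev, mvfderiv_mul_apply hf (hV.coord hx k), mul_add, Finset.mul_sum]
  simp only [Finset.mul_sum]
  rw [show ∀ a b c d : ℝ, a = b → (f p * c + coord (F p) (V p) k * d) + a =
    d * coord (F p) (V p) k + (f p * c + b) by intros; subst_vars; ring]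
  refine Finset.sum_congr rfl fun i _ ↦ Finset.sum_congr rfl fun j _ ↦ ?_
  ring

lemma covDerivAlong_zero (hF : ContMDiffAt 𝓘(ℝ, Eu m) 𝓘(ℝ, Eu n) ∞ F p) (v : Tan m p) :
    g.covDerivAlong F (fun _ ↦ 0) p v = 0 := by
  have h := g.covDerivAlong_smul (SmoothFun.const 0 p) (SmoothAlongAt.zero hF) v
  simp only [smul_zero, zero_smul, add_zero] at h
  exact h

lemma covDerivAlong_sum {ι : Type*} {s : Finset ι} {V : ι → (q : N) → Tan n (F q)}
    (hF : ContMDiffAt 𝓘(ℝ, Eu m) 𝓘(ℝ, Eu n) ∞ F p)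
    (hV : ∀ i ∈ s, SmoothAlongAt m F (V i) p) (v : Tan m p) :
    g.covDerivAlong F (fun q ↦ ∑ i ∈ s, V i q) p v = ∑ i ∈ s, g.covDerivAlong F (V i) p v := by
  classical
  induction s using Finset.induction_on with
  | empty => simpa using g.covDerivAlong_zero hF v
  | insert i s hi ih =>
    simp only [Finset.sum_insert hi]
    rw [g.covDerivAlong_add (hV i (by simp))
      (SmoothAlongAt.sum hF fun j hj ↦ hV j (by simp [hj])), ih fun j hj ↦ hV j (by simp [hj])]

/-- The chain rule: along `F`, a vector field of the target is differentiated in the direction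
`dF v`. -/
lemma covDerivAlong_comp {X : (x : M) → Tan n x} (hX : SmoothFieldAt X (F p))
    (hF : ContMDiffAt 𝓘(ℝ, Eu m) 𝓘(ℝ, Eu n) ∞ F p) (v : Tan m p) :
    g.covDerivAlong F (fun q ↦ X (F q)) p v =
      g.covDerivAlong (fun y : M ↦ y) X (F p) (mfderiv 𝓘(ℝ, Eu m) 𝓘(ℝ, Eu n) F p v) := by
  have hx := mem_chart_source (Eu n) (F p)
  refine ext_coord hx fun k ↦ ?_
  rw [coord_covDerivAlong, coord_covDerivAlong g (fun y : M ↦ y),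
    mvfderiv_comp_smoothFun (hX.coord hx k) hF]
  have : mfderiv 𝓘(ℝ, Eu n) 𝓘(ℝ, Eu n) (fun y : M ↦ y) (F p) = ContinuousLinearMap.id ℝ _ :=
    mfderiv_id
  rw [this]
  rfl

lemma coeffDeriv_symm (x : M) (k i j : Fin n) : g.coeffDeriv x k i j = g.coeffDeriv x k j i := by
  have : g.coeff x i j = g.coeff x j i := by ext y; exact g.symm _ _ _
  rw [coeffDeriv, coeffDeriv, this]

lemma christoffel_symm (x : M) (k i j : Fin n) : g.christoffel x k i j = g.christoffel x k j i := by
  simp only [christoffel]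
  congr 1
  refine Finset.sum_congr rfl fun l _ ↦ ?_
  rw [g.coeffDeriv_symm x l i j]
  ring

/-- The Levi-Civita connection pulled back along `F` has no torsion. -/
lemma covDerivAlong_torsion {X Y : (q : N) → Tan m q}
    (hF : ContMDiffAt 𝓘(ℝ, Eu m) 𝓘(ℝ, Eu n) ∞ F p)
    (hX : SmoothFieldAt X p) (hY : SmoothFieldAt Y p) :
    g.covDerivAlong F (fun q ↦ mfderiv 𝓘(ℝ, Eu m) 𝓘(ℝ, Eu n) F q (Y q)) p (X p) -
      g.covDerivAlong F (fun q ↦ mfderiv 𝓘(ℝ, Eu m) 𝓘(ℝ, Eu n) F q (X q)) p (Y p) =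
    mfderiv 𝓘(ℝ, Eu m) 𝓘(ℝ, Eu n) F p (mlieBracket 𝓘(ℝ, Eu m) X Y p) := by
  have hx := mem_chart_source (Eu n) (F p)
  rw [sub_eq_iff_eq_add]
  refine ext_coord hx fun k ↦ ?_
  have hφ : SmoothFun n (fun z : M ↦ (extChartAt 𝓘(ℝ, Eu n) (F p) z) k) (F p) := by
    have := contMDiffAt_euclidean_iff.1 (contMDiffAt_extChartAt (I := 𝓘(ℝ, Eu n)) (n := ∞) (x := F
      p))
    exact this k
  have hc : SmoothFun m (fun q ↦ (extChartAt 𝓘(ℝ, Eu n) (F p) (F q)) k) p := hφ.comp p hF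
  have key : ∀ Z : (q : N) → Tan m q, ∀ᶠ q in 𝓝 p,
      coord (F p) (mfderiv 𝓘(ℝ, Eu m) 𝓘(ℝ, Eu n) F q (Z q)) k =
      mvfderiv 𝓘(ℝ, Eu m) (fun q ↦ (extChartAt 𝓘(ℝ, Eu n) (F p) (F q)) k) q (Z q) := by
    intro Z
    have h1 := (contMDiffAt_iff_contMDiffAt_nhds (n := 1) (by decide)).1
      (hF.of_le one_le_infty)
    filter_upwards [eventually_mem_chartDom hF.continuousAt hx, h1] with q hq hq1
    rw [coord_eq_mvfderiv hq]
    refine (mvfderiv_comp_apply q ?_ (hq1.mdifferentiableAt (by simp)) _).symm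
    have := contMDiffAt_euclidean_iff.1 (contMDiffAt_extChartAt' (I := 𝓘(ℝ, Eu n)) (n := ∞) hq)
    exact (this k).mdifferentiableAt
  have hsym : ∑ i : Fin n, ∑ j : Fin n, g.christoffel (F p) k i j *
        coord (F p) (mfderiv 𝓘(ℝ, Eu m) 𝓘(ℝ, Eu n) F p (X p)) i *
        coord (F p) (mfderiv 𝓘(ℝ, Eu m) 𝓘(ℝ, Eu n) F p (Y p)) j =
      ∑ i : Fin n, ∑ j : Fin n, g.christoffel (F p) k i j *
        coord (F p) (mfderiv 𝓘(ℝ, Eu m) 𝓘(ℝ, Eu n) F p (Y p)) i *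
        coord (F p) (mfderiv 𝓘(ℝ, Eu m) 𝓘(ℝ, Eu n) F p (X p)) j := by
    rw [Finset.sum_comm]
    refine Finset.sum_congr rfl fun i _ ↦ Finset.sum_congr rfl fun j _ ↦ ?_
    rw [g.christoffel_symm]; ring
  have hb := mvfderiv_bracket hc hX hY
  rw [coord_add hx, coord_covDerivAlong, coord_covDerivAlong, hsym, mvfderiv_congr (key X),
    mvfderiv_congr (key Y), (key (mlieBracket 𝓘(ℝ, Eu m) X Y)).self_of_nhds, hb]
  ring

/-- The Gram matrix of the coordinate fields. -/
def gram (x : M) : Matrix (Fin n) (Fin n) ℝ := Matrix.of fun p q ↦ g.coeff x p q x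

lemma val_eq_sum {x y : M} (hy : y ∈ chartDom n x) (v w : Tan n y) :
    g.val y v w = ∑ i, ∑ j, g.coeff x i j y * (coord x v i * coord x w j) := by
  conv_lhs => rw [← sum_coord_smul_coordField hy v, ← sum_coord_smul_coordField hy w]
  simp only [map_sum, map_smul, sum_apply, smul_apply, smul_eq_mul, coeff, Finset.mul_sum]
  rw [Finset.sum_comm]
  refine Finset.sum_congr rfl fun i _ ↦ Finset.sum_congr rfl fun j _ ↦ ?_
  ring

/-- The Gram matrix is invertible because the metric is non-degenerate. -/
lemma isUnit_gram_det (x : M) : IsUnit (g.gram x).det := by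
  rw [isUnit_iff_ne_zero]
  intro h0
  obtain ⟨v, hv, hv0⟩ := Matrix.exists_mulVec_eq_zero_iff.2 h0
  have hx := mem_chart_source (Eu n) x
  apply hv
  set w : Tan n x := ∑ k, v k • coordField x k x with hw
  have hwk : ∀ k, coord x w k = v k := by
    intro k
    rw [hw, coord_sum hx]
    simp [coord_smul hx, coord_coordField hx]
  have hw0 : w = 0 := by
    refine g.nondegenerate x w fun u ↦ ?_
    rw [g.symm, g.val_eq_sum hx]
    refine Finset.sum_eq_zero fun i _ ↦ ?_
    have h1 := congrFun hv0 i
    simp only [Matrix.mulVec, dotProduct, gram, Matrix.of_apply, Pi.zero_apply] at h1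
    calc ∑ j, g.coeff x i j x * (coord x u i * coord x w j)
        = coord x u i * ∑ j, g.coeff x i j x * v j := by
          rw [Finset.mul_sum]
          refine Finset.sum_congr rfl fun j _ ↦ ?_
          rw [hwk]; ring
      _ = 0 := by rw [h1, mul_zero]
  ext k
  rw [← hwk k, hw0]
  have := coord_smul hx (0 : ℝ) (0 : Tan n x) k
  simpa using this

lemma sum_coeff_christoffel (x : M) (k i j : Fin n) :
    ∑ l, g.coeff x k l x * g.christoffel x l i j =
      (1 / 2 : ℝ) * (g.coeffDeriv x i j k + g.coeffDeriv x j i k - g.coeffDeriv x k i j) := by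
  have h := Matrix.mul_nonsing_inv _ (g.isUnit_gram_det x)
  have h1 : ∀ l, ∑ r, g.coeff x k r x * (Matrix.of fun p q ↦ g.coeff x p q x)⁻¹ r l =
      if k = l then 1 else 0 := by
    intro l
    have := congrFun (congrFun h k) l
    rw [Matrix.mul_apply, Matrix.one_apply] at this
    exact this
  simp only [christoffel, Finset.mul_sum]
  rw [Finset.sum_comm]
  calc _ = ∑ l, (∑ r, g.coeff x k r x * (Matrix.of fun p q ↦ g.coeff x p q x)⁻¹ r l) *
          ((1 / 2 : ℝ) * (g.coeffDeriv x i j l + g.coeffDeriv x j i l - g.coeffDeriv x l i j)) := by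
        refine Finset.sum_congr rfl fun l _ ↦ ?_
        rw [Finset.sum_mul]
        refine Finset.sum_congr rfl fun r _ ↦ ?_
        ring
    _ = _ := by simp [h1]

lemma coeffDeriv_eq_christoffel (x : M) (l i j : Fin n) : g.coeffDeriv x l i j =
    ∑ k, g.coeff x i k x * g.christoffel x k l j + ∑ k, g.coeff x j k x * g.christoffel x k l i :=
      by
  rw [sum_coeff_christoffel, sum_coeff_christoffel, g.coeffDeriv_symm x l j i,
    g.coeffDeriv_symm x j l i, g.coeffDeriv_symm x i l j]
  ring

/-- The Levi-Civita connection pulled back along `F` is compatible with the metric. -/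
lemma mvfderiv_val (hV : SmoothAlongAt m F V p) (hW : SmoothAlongAt m F W p) (v : Tan m p) :
    mvfderiv 𝓘(ℝ, Eu m) (fun q ↦ g.val (F q) (V q) (W q)) p v =
      g.val (F p) (g.covDerivAlong F V p v) (W p) +
        g.val (F p) (V p) (g.covDerivAlong F W p v) := by
  have hx := mem_chart_source (Eu n) (F p)
  have hF := hV.base
  have hev : (fun q ↦ g.val (F q) (V q) (W q)) =ᶠ[𝓝 p] fun q ↦ ∑ i, ∑ j,
      g.coeff (F p) i j (F q) * (coord (F p) (V q) i * coord (F p) (W q) j) := by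
    filter_upwards [eventually_mem_chartDom hF.continuousAt hx] with q hq
    exact g.val_eq_sum hq _ _
  have hc : ∀ i j, SmoothFun n (g.coeff (F p) i j) (F p) := fun i j ↦
    g.smoothFun_val (smoothFieldAt_coordField hx i) (smoothFieldAt_coordField hx j)
  have hc' : ∀ i j, SmoothFun m (fun q ↦ g.coeff (F p) i j (F q)) p := fun i j ↦
    (hc i j).comp p hF
  have hdc : ∀ i j, mvfderiv 𝓘(ℝ, Eu m) (fun q ↦ g.coeff (F p) i j (F q)) p v =
      ∑ l, g.coeffDeriv (F p) l i j * coord (F p) (mfderiv 𝓘(ℝ, Eu m) 𝓘(ℝ, Eu n) F p v) l := by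
    intro i j
    rw [mvfderiv_comp_smoothFun (hc i j) hF]
    conv_lhs => rw [← sum_coord_smul_coordField hx (mfderiv 𝓘(ℝ, Eu m) 𝓘(ℝ, Eu n) F p v)]
    rw [map_sum]
    refine Finset.sum_congr rfl fun l _ ↦ ?_
    rw [map_smul, smul_eq_mul, mul_comm]
    rfl
  rw [mvfderiv_congr hev, mvfderiv_sum fun i _ ↦ SmoothFun.sum fun j _ ↦
    (hc' i j).mul ((hV.coord hx i).mul (hW.coord hx j))]
  rw [g.val_eq_sum hx, g.val_eq_sum hx]
  have h1 : ∀ i j, mvfderiv 𝓘(ℝ, Eu m) (fun q ↦ g.coeff (F p) i j (F q) *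
      (coord (F p) (V q) i * coord (F p) (W q) j)) p v =
      g.coeff (F p) i j (F p) * (coord (F p) (V p) i *
        mvfderiv 𝓘(ℝ, Eu m) (fun q ↦ coord (F p) (W q) j) p v + coord (F p) (W p) j *
        mvfderiv 𝓘(ℝ, Eu m) (fun q ↦ coord (F p) (V q) i) p v) +
      (coord (F p) (V p) i * coord (F p) (W p) j) *
      ∑ l, g.coeffDeriv (F p) l i j * coord (F p) (mfderiv 𝓘(ℝ, Eu m) 𝓘(ℝ, Eu n) F p v) l := by
    intro i j
    rw [mvfderiv_mul_apply (hc' i j) ((hV.coord hx i).mul (hW.coord hx j)), hdc,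
      mvfderiv_mul_apply (hV.coord hx i) (hW.coord hx j)]
  have h2 : ∀ i, mvfderiv 𝓘(ℝ, Eu m) (fun q ↦ ∑ j, g.coeff (F p) i j (F q) *
      (coord (F p) (V q) i * coord (F p) (W q) j)) p v = ∑ j, _ := fun i ↦
    (mvfderiv_sum (fun j _ ↦ (hc' i j).mul ((hV.coord hx i).mul (hW.coord hx j))) v).trans
      (Finset.sum_congr rfl fun j _ ↦ h1 i j)
  simp only [h2, coord_covDerivAlong]
  -- the remaining identity expresses that the derivatives of `g_ij` come from the `Γ^k_ij`
  set u := fun l ↦ coord (F p) (mfderiv 𝓘(ℝ, Eu m) 𝓘(ℝ, Eu n) F p v) l with hu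
  set a := fun i ↦ coord (F p) (V p) i with ha
  set b := fun i ↦ coord (F p) (W p) i with hb
  have h3 : ∑ i, ∑ j, (a i * b j) * ∑ l, g.coeffDeriv (F p) l i j * u l =
      ∑ i, ∑ j, g.coeff (F p) i j (F p) *
        ((∑ l, ∑ r, g.christoffel (F p) i l r * u l * a r) * b j) +
      ∑ i, ∑ j, g.coeff (F p) i j (F p) *
        (a i * ∑ l, ∑ r, g.christoffel (F p) j l r * u l * b r) := by
    have hs : ∀ i j, g.coeff (F p) i j (F p) = g.coeff (F p) j i (F p) := fun i j ↦ g.symm _ _ _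
    have e1 : ∑ i, ∑ j, (a i * b j) * ∑ l, g.coeffDeriv (F p) l i j * u l =
        ∑ i, ∑ j, ∑ l, ∑ k, g.coeff (F p) i k (F p) * g.christoffel (F p) k l j * u l * a i * b j +
        ∑ i, ∑ j, ∑ l, ∑ k, g.coeff (F p) j k (F p) * g.christoffel (F p) k l i * u l * a i * b j
          := by
      simp only [← Finset.sum_add_distrib, Finset.mul_sum]
      refine Finset.sum_congr rfl fun i _ ↦ Finset.sum_congr rfl fun j _ ↦
        Finset.sum_congr rfl fun l _ ↦ ?_
      rw [coeffDeriv_eq_christoffel, ← Finset.sum_add_distrib, Finset.sum_mul, Finset.mul_sum]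
      refine Finset.sum_congr rfl fun k _ ↦ ?_
      ring
    have e2 : ∑ i, ∑ j, g.coeff (F p) i j (F p) *
        (a i * ∑ l, ∑ r, g.christoffel (F p) j l r * u l * b r) =
        ∑ i, ∑ j, ∑ l, ∑ k, g.coeff (F p) i k (F p) * g.christoffel (F p) k l j * u l * a i * b j
          := by
      simp only [Finset.mul_sum]
      refine Finset.sum_congr rfl fun i _ ↦ ?_
      rw [Finset.sum_comm]
      rw [Finset.sum_congr rfl fun l _ ↦ Finset.sum_comm, Finset.sum_comm]
      refine Finset.sum_congr rfl fun j _ ↦ Finset.sum_congr rfl fun l _ ↦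
        Finset.sum_congr rfl fun k _ ↦ ?_
      ring
    have e3 : ∑ i, ∑ j, g.coeff (F p) i j (F p) *
        ((∑ l, ∑ r, g.christoffel (F p) i l r * u l * a r) * b j) =
        ∑ i, ∑ j, ∑ l, ∑ k, g.coeff (F p) j k (F p) * g.christoffel (F p) k l i * u l * a i * b j
          := by
      simp only [Finset.mul_sum, Finset.sum_mul]
      rw [sum_swap_first_last]
      refine Finset.sum_congr rfl fun i _ ↦ Finset.sum_congr rfl fun j _ ↦
        Finset.sum_congr rfl fun l _ ↦ Finset.sum_congr rfl fun k _ ↦ ?_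
      rw [hs j k]
      ring
    rw [e1, e2, e3, add_comm]
  simp only [mul_add, add_mul, Finset.sum_add_distrib]
  rw [h3]
  have e4 : ∑ i, ∑ j, g.coeff (F p) i j (F p) * (b j *
        mvfderiv 𝓘(ℝ, Eu m) (fun q ↦ coord (F p) (V q) i) p v) =
      ∑ i, ∑ j, g.coeff (F p) i j (F p) * (
        mvfderiv 𝓘(ℝ, Eu m) (fun q ↦ coord (F p) (V q) i) p v * b j) :=
    Finset.sum_congr rfl fun i _ ↦ Finset.sum_congr rfl fun j _ ↦ by ring
  rw [e4]
  ring

end PseudoRiemannianMetric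
end CovariantDerivative

/-! ### Smoothness of covariant derivatives -/

section Smoothness
variable {m n : ℕ}
  {N : Type*} [TopologicalSpace N] [ChartedSpace (Eu m) N] [IsManifold 𝓘(ℝ, Eu m) ∞ N]
  {M : Type*} [TopologicalSpace M] [ChartedSpace (Eu n) M] [IsManifold 𝓘(ℝ, Eu n) ∞ M]

lemma SmoothFun.congr {f h : N → ℝ} {p : N} (hf : SmoothFun m f p) (e : ∀ᶠ q in 𝓝 p, h q = f q) :
    SmoothFun m h p := ContMDiffAt.congr_of_eventuallyEq hf e

lemma SmoothFun.det {f : Fin n → Fin n → N → ℝ} {p : N} (hf : ∀ i j, SmoothFun m (f i j) p) :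
    SmoothFun m (fun q ↦ (Matrix.of fun i j ↦ f i j q).det) p := by
  simp only [Matrix.det_apply']
  exact SmoothFun.sum fun σ _ ↦ (SmoothFun.const _ p).mul (SmoothFun.prod fun i _ ↦ hf _ _)

variable (g : PseudoRiemannianMetric n M)

namespace PseudoRiemannianMetric

variable {F : N → M} {V W : (q : N) → Tan n (F q)} {p : N}

/-- A vector field along `F` is smooth as soon as its products with the coordinate fields are, by
Cramer's rule for the Gram matrix. -/
lemma smoothAlongAt_of_val (hF : ContMDiffAt 𝓘(ℝ, Eu m) 𝓘(ℝ, Eu n) ∞ F p)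
    (h : ∀ l, SmoothFun m (fun q ↦ g.val (F q) (V q) (coordField (F p) l (F q))) p) :
    SmoothAlongAt m F V p := by
  have hx := mem_chart_source (Eu n) (F p)
  refine (smoothAlongAt_iff hx).2 ⟨hF, fun k ↦ ?_⟩
  set A : N → Matrix (Fin n) (Fin n) ℝ := fun q ↦ Matrix.of fun i j ↦ g.coeff (F p) i j (F q)
  have hA : ∀ i j, SmoothFun m (fun q ↦ g.coeff (F p) i j (F q)) p := fun i j ↦
    ContMDiffAt.comp p (g.smoothFun_val (smoothFieldAt_coordField hx i)
      (smoothFieldAt_coordField hx j)) hF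
  have hdet : SmoothFun m (fun q ↦ (A q).det) p := SmoothFun.det hA
  have hdet0 : (A p).det ≠ 0 := (g.isUnit_gram_det (F p)).ne_zero
  set b : N → Fin n → ℝ := fun q l ↦ g.val (F q) (V q) (coordField (F p) l (F q))
  have hcr : SmoothFun m (fun q ↦ ((A q).updateCol k (b q)).det) p := by
    refine SmoothFun.det (f := fun i j q ↦ (A q).updateCol k (b q) i j) fun i j ↦ ?_
    by_cases hj : j = k
    · subst hj
      simpa using h i
    · simp only [Matrix.updateCol_ne hj]
      exact hA i j
  refine SmoothFun.congr (SmoothFun.mul (ContMDiffAt.inv₀ hdet hdet0) hcr) ?_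
  filter_upwards [eventually_mem_chartDom hF.continuousAt hx,
    hdet.continuousAt.eventually_ne hdet0] with q hq hq0
  have hb : (A q).mulVec (fun j ↦ coord (F p) (V q) j) = b q := by
    ext l
    show _ = g.val (F q) (V q) (coordField (F p) l (F q))
    rw [g.symm]
    conv_rhs => rw [← sum_coord_smul_coordField hq (V q)]
    simp only [map_sum, map_smul, smul_eq_mul, Matrix.mulVec, dotProduct, A, Matrix.of_apply, coeff]
    exact Finset.sum_congr rfl fun j _ ↦ mul_comm _ _
  rw [← Matrix.cramer_apply, Matrix.cramer_eq_adjugate_mulVec, ← hb, Matrix.mulVec_mulVec,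
    Matrix.adjugate_mul, Matrix.smul_mulVec, Matrix.one_mulVec]
  simp only [Pi.smul_apply, smul_eq_mul]
  field_simp

/-- The Koszul formula along a map. The function `P U V` is the scalar product of `dF U` and `dF V`;
it is a variable so that, for an isometric immersion, it can be given as the scalar product of `U`
and `V` in the source. -/
lemma koszul (hF : ContMDiffAt 𝓘(ℝ, Eu m) 𝓘(ℝ, Eu n) ∞ F p) {X Y Z : (q : N) → Tan m q}
    (hX : SmoothFieldAt X p) (hY : SmoothFieldAt Y p) (hZ : SmoothFieldAt Z p) {P : (U V : (q : N)
      → Tan m q) → N → ℝ}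
    (hP : ∀ U V, P U V = fun q ↦ g.val (F q) (mfderiv 𝓘(ℝ, Eu m) 𝓘(ℝ, Eu n) F q (U q))
      (mfderiv 𝓘(ℝ, Eu m) 𝓘(ℝ, Eu n) F q (V q))) :
    2 * g.val (F p) (g.covDerivAlong F
        (fun q ↦ mfderiv 𝓘(ℝ, Eu m) 𝓘(ℝ, Eu n) F q (Y q)) p (X p))
        (mfderiv 𝓘(ℝ, Eu m) 𝓘(ℝ, Eu n) F p (Z p)) =
      mvfderiv 𝓘(ℝ, Eu m) (P Y Z) p (X p) + mvfderiv 𝓘(ℝ, Eu m) (P X Z) p (Y p) -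
      mvfderiv 𝓘(ℝ, Eu m) (P X Y) p (Z p) + P (mlieBracket 𝓘(ℝ, Eu m) X Y) Z p -
      P (mlieBracket 𝓘(ℝ, Eu m) X Z) Y p - P (mlieBracket 𝓘(ℝ, Eu m) Y Z) X p := by
  simp only [hP]
  rw [g.mvfderiv_val (hY.deriv_map hF) (hZ.deriv_map hF),
    g.mvfderiv_val (hX.deriv_map hF) (hZ.deriv_map hF),
    g.mvfderiv_val (hX.deriv_map hF) (hY.deriv_map hF), ← g.covDerivAlong_torsion hF hX hY,
    ← g.covDerivAlong_torsion hF hX hZ, ← g.covDerivAlong_torsion hF hY hZ]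
  simp only [map_sub, sub_apply]
  rw [g.symm _ (mfderiv 𝓘(ℝ, Eu m) 𝓘(ℝ, Eu n) F p (Y p)) (g.covDerivAlong F _ p (X p)),
    g.symm _ (mfderiv 𝓘(ℝ, Eu m) 𝓘(ℝ, Eu n) F p (X p)) (g.covDerivAlong F _ p (Y p)),
    g.symm _ (mfderiv 𝓘(ℝ, Eu m) 𝓘(ℝ, Eu n) F p (X p)) (g.covDerivAlong F _ p (Z p))]
  ring

lemma mfderiv_self (x : M) : mfderiv 𝓘(ℝ, Eu n) 𝓘(ℝ, Eu n) (fun y : M ↦ y) x =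
    ContinuousLinearMap.id ℝ _ := mfderiv_id

lemma contMDiffAt_self (x : M) : ContMDiffAt 𝓘(ℝ, Eu n) 𝓘(ℝ, Eu n) ∞ (fun y : M ↦ y) x :=
  contMDiffAt_id

lemma nabla_koszul {X Y Z : (x : M) → Tan n x} {x : M}
    (hX : SmoothFieldAt X x) (hY : SmoothFieldAt Y x) (hZ : SmoothFieldAt Z x) :
    2 * g.val x (g.nabla X Y x) (Z x) =
      mvfderiv 𝓘(ℝ, Eu n) (fun q ↦ g.val q (Y q) (Z q)) x (X x) +
      mvfderiv 𝓘(ℝ, Eu n) (fun q ↦ g.val q (X q) (Z q)) x (Y x) -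
      mvfderiv 𝓘(ℝ, Eu n) (fun q ↦ g.val q (X q) (Y q)) x (Z x) +
      g.val x (mlieBracket 𝓘(ℝ, Eu n) X Y x) (Z x) -
      g.val x (mlieBracket 𝓘(ℝ, Eu n) X Z x) (Y x) -
      g.val x (mlieBracket 𝓘(ℝ, Eu n) Y Z x) (X x) := by
  have h := g.koszul (contMDiffAt_self x) hX hY hZ (P := fun U V q ↦ g.val q (U q) (V q)) (by
    intro U V
    simp only [mfderiv_self]
    rfl)
  simp only [mfderiv_self] at h
  exact h

lemma nabla_sub_nabla {X Y : (x : M) → Tan n x} {x : M}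
    (hX : SmoothFieldAt X x) (hY : SmoothFieldAt Y x) :
    g.nabla X Y x - g.nabla Y X x = mlieBracket 𝓘(ℝ, Eu n) X Y x := by
  have h := g.covDerivAlong_torsion (contMDiffAt_self x) hX hY
  simp only [mfderiv_self] at h
  exact h

/-- The fields `∇_{∂_i} ∂_j` are smooth: the Koszul formula shows that their products with
coordinate fields are. -/
lemma smoothFieldAt_nabla_coordField {x y : M} (hy : y ∈ chartDom n x) (i j : Fin n) :
    SmoothFieldAt (g.nabla (coordField x i) (coordField x j)) y := by
  refine g.smoothAlongAt_of_val (contMDiffAt_self y) fun l ↦ ?_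
  have hyy := mem_chart_source (Eu n) y
  have h1 : ∀ i, SmoothFieldAt (coordField x i) y := fun i ↦ smoothFieldAt_coordField hy i
  have h2 : SmoothFieldAt (coordField y l) y := smoothFieldAt_coordField hyy l
  have hs : ∀ {U V W : (x : M) → Tan n x}, SmoothFieldAt U y → SmoothFieldAt V y →
      SmoothFieldAt W y → SmoothFun n (fun z ↦
        mvfderiv 𝓘(ℝ, Eu n) (fun q ↦ g.val q (U q) (V q)) z (W z)) y := fun hU hV hW ↦
    SmoothFieldAt.deriv_fun (g.smoothFun_val hU hV) hW
  refine SmoothFun.congr ((SmoothFun.const (1 / 2) y).mul (((((hs (h1 j) h2 (h1 i)).add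
    (hs (h1 i) h2 (h1 j))).sub (hs (h1 i) (h1 j) h2)).add
    (g.smoothFun_val ((h1 i).mlieBracket (h1 j)) h2)).sub
    (g.smoothFun_val ((h1 i).mlieBracket h2) (h1 j)) |>.sub
    (g.smoothFun_val ((h1 j).mlieBracket h2) (h1 i)))) ?_
  filter_upwards [(chartAt (Eu n) x).open_source.mem_nhds hy,
    (chartAt (Eu n) y).open_source.mem_nhds hyy] with z hz hz'
  rw [← g.nabla_koszul (smoothFieldAt_coordField hz i) (smoothFieldAt_coordField hz j)
    (smoothFieldAt_coordField hz' l)]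
  ring

/-- The field `V` along `F` is smooth at all points near `p`. This is stronger than smoothness at
`p` in the sense of `SmoothAlongAt`, which asks for `C^r` regularity on a neighborhood depending on
`r`. -/
def _root_.A1Space.SmoothNear (m : ℕ) {N : Type*} [TopologicalSpace N] [ChartedSpace (Eu m) N]
    (F : N → M) (V : (q : N) → Tan n (F q)) (p : N) : Prop :=
  ∀ᶠ q in 𝓝 p, SmoothAlongAt m F V q

/-- The vector field `X` is smooth near the point `x`. -/
abbrev _root_.A1Space.SmoothFieldNear (X : (x : M) → Tan n x) (x : M) : Prop :=
  SmoothNear n (fun y : M ↦ y) X x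

lemma _root_.A1Space.SmoothNear.at (h : SmoothNear m F V p) : SmoothAlongAt m F V p :=
  h.self_of_nhds

lemma _root_.A1Space.SmoothNear.eventually (h : SmoothNear m F V p) :
    ∀ᶠ q in 𝓝 p, SmoothNear m F V q := eventually_eventually_nhds.2 h

lemma _root_.A1Space.smoothFieldNear_coordField {x y : M} (hy : y ∈ chartDom n x) (i : Fin n) :
    SmoothFieldNear (coordField x i) y := by
  filter_upwards [(chartAt (Eu n) x).open_source.mem_nhds hy] with z hz
  exact smoothFieldAt_coordField hz i

/-- The covariant derivative expanded in the coordinate frame of a fixed chart; in contrast to the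
definition, the chart does not depend on the point. -/
lemma covDerivAlong_eq_sum {x : M} (hx : F p ∈ chartDom n x) (hV : SmoothAlongAt m F V p)
    (v : Tan m p) : g.covDerivAlong F V p v = ∑ k,
      (mvfderiv 𝓘(ℝ, Eu m) (fun q ↦ coord x (V q) k) p v • coordField x k (F p) +
      coord x (V p) k • ∑ i, coord x (mfderiv 𝓘(ℝ, Eu m) 𝓘(ℝ, Eu n) F p v) i •
        g.nabla (coordField x i) (coordField x k) (F p)) := by
  have hev : ∀ᶠ q in 𝓝 p, V q = ∑ k, coord x (V q) k • coordField x k (F q) := by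
    filter_upwards [eventually_mem_chartDom hV.base.continuousAt hx] with q hq
    exact (sum_coord_smul_coordField hq _).symm
  have hE : ∀ k, SmoothAlongAt m F (fun q ↦ coordField x k (F q)) p := fun k ↦
    (smoothFieldAt_coordField hx k).comp hV.base
  rw [g.covDerivAlong_congr hev, g.covDerivAlong_sum hV.base fun k _ ↦ (hE k).smul (hV.coord hx k)]
  refine Finset.sum_congr rfl fun k _ ↦ ?_
  rw [g.covDerivAlong_smul (hV.coord hx k) (hE k),
    g.covDerivAlong_comp (smoothFieldAt_coordField hx k) hV.base]
  congr 2
  conv_lhs => rw [← sum_coord_smul_coordField hx (mfderiv 𝓘(ℝ, Eu m) 𝓘(ℝ, Eu n) F p v)]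
  rw [covDerivAlong_sum_dir]
  exact Finset.sum_congr rfl fun i _ ↦ g.covDerivAlong_smul_dir _ _

lemma _root_.A1Space.SmoothNear.covDerivAlong (hV : SmoothNear m F V p) {X : (q : N) → Tan m q}
    (hX : SmoothFieldAt X p) :
    SmoothAlongAt m F (fun q ↦ g.covDerivAlong F V q (X q)) p := by
  have hx := mem_chart_source (Eu n) (F p)
  have hF := hV.at.base
  have hE : ∀ k, SmoothAlongAt m F (fun q ↦ coordField (F p) k (F q)) p := fun k ↦
    (smoothFieldAt_coordField hx k).comp hF
  have hs : SmoothAlongAt m F (fun q ↦ ∑ k,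
      (mvfderiv 𝓘(ℝ, Eu m) (fun q ↦ coord (F p) (V q) k) q (X q) • coordField (F p) k (F q) +
      coord (F p) (V q) k • ∑ i, coord (F p) (mfderiv 𝓘(ℝ, Eu m) 𝓘(ℝ, Eu n) F q (X q)) i •
        g.nabla (coordField (F p) i) (coordField (F p) k) (F q))) p := by
    refine SmoothAlongAt.sum hF fun k _ ↦ ?_
    refine (SmoothAlongAt.smul (SmoothFieldAt.deriv_fun (hV.at.coord hx k) hX) (hE k)).add
      (SmoothAlongAt.smul (hV.at.coord hx k) ?_)
    refine SmoothAlongAt.sum hF fun i _ ↦ ?_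
    exact SmoothAlongAt.smul ((hX.deriv_map hF).coord hx i)
      ((g.smoothFieldAt_nabla_coordField hx i k).comp hF)
  refine hs.congr ?_
  filter_upwards [hV, eventually_mem_chartDom hF.continuousAt hx] with q hq hq'
  exact g.covDerivAlong_eq_sum hq' hq _

lemma _root_.A1Space.SmoothNear.near_covDerivAlong (hV : SmoothNear m F V p) {X : (q : N) → Tan m q}
    (hX : SmoothFieldNear X p) :
    SmoothNear m F (fun q ↦ g.covDerivAlong F V q (X q)) p := by
  filter_upwards [hX, hV.eventually] with q h1 h2
  exact h2.covDerivAlong g h1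

lemma _root_.A1Space.SmoothNear.nabla {X Y : (x : M) → Tan n x} {x : M} (hX : SmoothFieldNear X x)
    (hY : SmoothFieldNear Y x) : SmoothFieldNear (g.nabla X Y) x := hY.near_covDerivAlong g hX

lemma _root_.A1Space.SmoothNear.mlieBracket {X Y : (x : M) → Tan n x} {x : M}
    (hX : SmoothFieldNear X x) (hY : SmoothFieldNear Y x) :
    SmoothFieldNear (mlieBracket 𝓘(ℝ, Eu n) X Y) x := by
  filter_upwards [hX, hY] with y h1 h2
  exact SmoothFieldAt.mlieBracket h1 h2

end PseudoRiemannianMetric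
end Smoothness

/-! ### The curvature tensor -/

section Curvature
variable {m n : ℕ}
  {N : Type*} [TopologicalSpace N] [ChartedSpace (Eu m) N] [IsManifold 𝓘(ℝ, Eu m) ∞ N]
  {M : Type*} [TopologicalSpace M] [ChartedSpace (Eu n) M] [IsManifold 𝓘(ℝ, Eu n) ∞ M]

/-- The components in the preferred chart at `x`, as linear forms on the tangent space at `x`. -/
def coordL (x : M) (k : Fin n) : Tan n x →ₗ[ℝ] ℝ where
  toFun v := coord x v k
  map_add' v w := coord_add (mem_chart_source (Eu n) x) v w k
  map_smul' c v := coord_smul (mem_chart_source (Eu n) x) c v k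

lemma coordL_apply (x : M) (k : Fin n) (v : Tan n x) : coordL x k v = coord x v k := rfl

lemma SmoothFieldNear.comp {F : N → M} {p : N} {X : (x : M) → Tan n x}
    (hX : SmoothFieldNear X (F p)) (hF : ∀ᶠ q in 𝓝 p, ContMDiffAt 𝓘(ℝ, Eu m) 𝓘(ℝ, Eu n) ∞ F q) :
    SmoothNear m F (fun q ↦ X (F q)) p := by
  filter_upwards [hF, hF.self_of_nhds.continuousAt.eventually hX] with q h1 h2
  exact SmoothFieldAt.comp h2 h1

namespace PseudoRiemannianMetric
variable (g : PseudoRiemannianMetric n M)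

/-- The curvature tensor at `x`, as a trilinear map. It is defined by its components in the
preferred chart at `x`; see `curvature_eq_riem` for its meaning. -/
def riem (x : M) : Tan n x →ₗ[ℝ] Tan n x →ₗ[ℝ] Tan n x →ₗ[ℝ] Tan n x :=
  ∑ i, ∑ j, ∑ k, (coordL x i).smulRight ((coordL x j).smulRight ((coordL x k).smulRight
    (g.curvature (coordField x i) (coordField x j) (coordField x k) x)))

lemma riem_apply (x : M) (u v w : Tan n x) : g.riem x u v w =
    ∑ i, ∑ j, ∑ k, coord x u i • coord x v j • coord x w k •
      g.curvature (coordField x i) (coordField x j) (coordField x k) x := by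
  simp [riem, coordL_apply]

variable {F : N → M} {V : (q : N) → Tan n (F q)} {p : N}

lemma covDerivAlong_comp_eq_sum {x : M} (hx : F p ∈ chartDom n x) {Z : (x : M) → Tan n x}
    (hZ : SmoothFieldAt Z (F p)) (hF : ContMDiffAt 𝓘(ℝ, Eu m) 𝓘(ℝ, Eu n) ∞ F p) (v : Tan m p) :
    g.covDerivAlong F (fun q ↦ Z (F q)) p v =
      ∑ l, coord x (mfderiv 𝓘(ℝ, Eu m) 𝓘(ℝ, Eu n) F p v) l •
        g.nabla (coordField x l) Z (F p) := by
  rw [g.covDerivAlong_comp hZ hF]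
  conv_lhs => rw [← sum_coord_smul_coordField hx (mfderiv 𝓘(ℝ, Eu m) 𝓘(ℝ, Eu n) F p v)]
  rw [covDerivAlong_sum_dir]
  exact Finset.sum_congr rfl fun i _ ↦ g.covDerivAlong_smul_dir _ _

/-- The second covariant derivative along `F` of a field of the target. -/
lemma covDerivAlong_covDerivAlong_comp {Z : (x : M) → Tan n x} (hZ : SmoothFieldNear Z (F p))
    (hF : ∀ᶠ q in 𝓝 p, ContMDiffAt 𝓘(ℝ, Eu m) 𝓘(ℝ, Eu n) ∞ F q)
    {Y : (q : N) → Tan m q} (hY : SmoothFieldAt Y p) (v : Tan m p) :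
    g.covDerivAlong F (fun q ↦ g.covDerivAlong F (fun r ↦ Z (F r)) q (Y q)) p v =
      ∑ l, (mvfderiv 𝓘(ℝ, Eu m)
          (fun q ↦ coord (F p) (mfderiv 𝓘(ℝ, Eu m) 𝓘(ℝ, Eu n) F q (Y q)) l) p v •
          g.nabla (coordField (F p) l) Z (F p) +
        coord (F p) (mfderiv 𝓘(ℝ, Eu m) 𝓘(ℝ, Eu n) F p (Y p)) l •
          ∑ i, coord (F p) (mfderiv 𝓘(ℝ, Eu m) 𝓘(ℝ, Eu n) F p v) i •
            g.nabla (coordField (F p) i) (g.nabla (coordField (F p) l) Z) (F p)) := by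
  have hx := mem_chart_source (Eu n) (F p)
  have hFp := hF.self_of_nhds
  have hev : ∀ᶠ q in 𝓝 p, g.covDerivAlong F (fun r ↦ Z (F r)) q (Y q) =
      ∑ l, coord (F p) (mfderiv 𝓘(ℝ, Eu m) 𝓘(ℝ, Eu n) F q (Y q)) l •
        g.nabla (coordField (F p) l) Z (F q) := by
    filter_upwards [hF, hFp.continuousAt.eventually hZ,
      eventually_mem_chartDom hFp.continuousAt hx] with q h1 h2 h3
    exact g.covDerivAlong_comp_eq_sum h3 h2 h1 _
  have hD : ∀ l, SmoothFieldAt (g.nabla (coordField (F p) l) Z) (F p) := fun l ↦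
    ((smoothFieldNear_coordField hx l).nabla g hZ).at
  have hc : ∀ l, SmoothFun m
      (fun q ↦ coord (F p) (mfderiv 𝓘(ℝ, Eu m) 𝓘(ℝ, Eu n) F q (Y q)) l) p := fun l ↦
    (hY.deriv_map hFp).coord hx l
  rw [g.covDerivAlong_congr hev, g.covDerivAlong_sum hFp fun l _ ↦ SmoothAlongAt.smul (hc l) ((hD
    l).comp hFp)]
  refine Finset.sum_congr rfl fun l _ ↦ ?_
  rw [g.covDerivAlong_smul (hc l) ((hD l).comp hFp), g.covDerivAlong_comp_eq_sum hx (hD l) hFp]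

/-- The curvature of the Levi-Civita connection pulled back along `F`. -/
def curvatureAlong (F : N → M) (X Y : (q : N) → Tan m q) (V : (q : N) → Tan n (F q)) (p : N) :
    Tan n (F p) :=
  g.covDerivAlong F (fun q ↦ g.covDerivAlong F V q (Y q)) p (X p) -
    g.covDerivAlong F (fun q ↦ g.covDerivAlong F V q (X q)) p (Y p) -
    g.covDerivAlong F V p (mlieBracket 𝓘(ℝ, Eu m) X Y p)

lemma curvatureAlong_comp {Z : (x : M) → Tan n x} (hZ : SmoothFieldNear Z (F p))
    (hF : ∀ᶠ q in 𝓝 p, ContMDiffAt 𝓘(ℝ, Eu m) 𝓘(ℝ, Eu n) ∞ F q)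
    {X Y : (q : N) → Tan m q} (hX : SmoothFieldAt X p) (hY : SmoothFieldAt Y p) :
    g.curvatureAlong F X Y (fun q ↦ Z (F q)) p =
      ∑ i, ∑ j, coord (F p) (mfderiv 𝓘(ℝ, Eu m) 𝓘(ℝ, Eu n) F p (X p)) i •
        coord (F p) (mfderiv 𝓘(ℝ, Eu m) 𝓘(ℝ, Eu n) F p (Y p)) j •
        g.curvature (coordField (F p) i) (coordField (F p) j) Z (F p) := by
  have hx := mem_chart_source (Eu n) (F p)
  have hFp := hF.self_of_nhds
  have hE := fun i : Fin n ↦ smoothFieldAt_coordField hx i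
  set D := g.covDerivL (m := n) (fun y : M ↦ y) Z (F p) with hD
  have e3 : g.covDerivAlong F (fun q ↦ Z (F q)) p (mlieBracket 𝓘(ℝ, Eu m) X Y p) =
      D (mfderiv 𝓘(ℝ, Eu m) 𝓘(ℝ, Eu n) F p (mlieBracket 𝓘(ℝ, Eu m) X Y p)) :=
    g.covDerivAlong_comp hZ.at hFp _
  have hn : ∀ U : (x : M) → Tan n x, D (U (F p)) = g.nabla U Z (F p) := fun U ↦ rfl
  have hcurv : ∀ i j, g.curvature (coordField (F p) i) (coordField (F p) j) Z (F p) =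
      g.nabla (coordField (F p) i) (g.nabla (coordField (F p) j) Z) (F p) -
      g.nabla (coordField (F p) j) (g.nabla (coordField (F p) i) Z) (F p) -
      (D (g.nabla (coordField (F p) i) (coordField (F p) j) (F p)) -
        D (g.nabla (coordField (F p) j) (coordField (F p) i) (F p))) := by
    intro i j
    rw [← map_sub, g.nabla_sub_nabla (hE i) (hE j)]
    rfl
  rw [curvatureAlong, g.covDerivAlong_covDerivAlong_comp hZ hF hY,
    g.covDerivAlong_covDerivAlong_comp hZ hF hX, e3, ← g.covDerivAlong_torsion hFp hX hY,
    g.covDerivAlong_eq_sum hx (hY.deriv_map hFp), g.covDerivAlong_eq_sum hx (hX.deriv_map hFp)]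
  simp only [hcurv, map_sub, map_sum, map_add, map_smul, hn, smul_sub, Finset.sum_sub_distrib,
    Finset.sum_add_distrib, Finset.smul_sum]
  have hsw : ∀ (x y : Fin n → ℝ) (f : Fin n → Fin n → Tan n (F p)),
      ∑ i, ∑ j, x i • y j • f i j = ∑ j, ∑ i, y j • x i • f i j := by
    intro x y f
    rw [Finset.sum_comm]
    exact Finset.sum_congr rfl fun j _ ↦ Finset.sum_congr rfl fun i _ ↦ smul_comm _ _ _
  set x := fun i ↦ coord (F p) (mfderiv 𝓘(ℝ, Eu m) 𝓘(ℝ, Eu n) F p (X p)) i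
  set y := fun i ↦ coord (F p) (mfderiv 𝓘(ℝ, Eu m) 𝓘(ℝ, Eu n) F p (Y p)) i
  have h1 := hsw x y fun i j ↦
    g.nabla (coordField (F p) i) (g.nabla (coordField (F p) j) Z) (F p)
  have h2 := hsw x y fun i j ↦ D (g.nabla (coordField (F p) i) (coordField (F p) j) (F p))
  simp only [x, y, hn] at h1 h2
  rw [h1, h2]
  abel

/-- The curvature of the pulled-back connection is linear over functions in the field `V`. -/
lemma curvatureAlong_eq_sum (hV : SmoothNear m F V p)
    {X Y : (q : N) → Tan m q} (hX : SmoothFieldNear X p) (hY : SmoothFieldNear Y p) :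
    g.curvatureAlong F X Y V p = ∑ k, coord (F p) (V p) k •
      g.curvatureAlong F X Y (fun q ↦ coordField (F p) k (F q)) p := by
  have hx := mem_chart_source (Eu n) (F p)
  have hFe : ∀ᶠ q in 𝓝 p, ContMDiffAt 𝓘(ℝ, Eu m) 𝓘(ℝ, Eu n) ∞ F q := by
    filter_upwards [hV] with q hq using hq.base
  have hF := hFe.self_of_nhds
  have hE : ∀ k, SmoothNear m F (fun q ↦ coordField (F p) k (F q)) p := fun k ↦
    SmoothFieldNear.comp (smoothFieldNear_coordField hx k) hFe
  have hfe : ∀ k, ∀ᶠ q in 𝓝 p, SmoothFun m (fun q ↦ coord (F p) (V q) k) q := fun k ↦ by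
    filter_upwards [hV, eventually_mem_chartDom hF.continuousAt hx] with q h1 h2
    exact h1.coord h2 k
  have hf := fun k ↦ (hfe k).self_of_nhds
  have hVe : ∀ᶠ q in 𝓝 p, V q = ∑ k, coord (F p) (V q) k • coordField (F p) k (F q) := by
    filter_upwards [eventually_mem_chartDom hF.continuousAt hx] with q hq
    exact (sum_coord_smul_coordField hq _).symm
  -- first covariant derivatives near `p`
  have h1 : ∀ᶠ q in 𝓝 p, ∀ v : Tan m q, g.covDerivAlong F V q v = ∑ k,
      (mvfderiv 𝓘(ℝ, Eu m) (fun q ↦ coord (F p) (V q) k) q v • coordField (F p) k (F q) +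
      coord (F p) (V q) k • g.covDerivAlong F (fun q ↦ coordField (F p) k (F q)) q v) := by
    filter_upwards [hFe, eventually_eventually_nhds.2 hVe, eventually_all.2 hfe,
      eventually_all.2 fun k ↦ (hE k).eventually] with q a1 a2 a3 a4 v
    rw [g.covDerivAlong_congr a2, g.covDerivAlong_sum a1 fun k _ ↦ SmoothAlongAt.smul (a3 k) (a4
      k).at]
    exact Finset.sum_congr rfl fun k _ ↦ g.covDerivAlong_smul (a3 k) (a4 k).at v
  have h2 : ∀ {Y : (q : N) → Tan m q}, SmoothFieldNear Y p → ∀ v : Tan m p,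
      g.covDerivAlong F (fun q ↦ g.covDerivAlong F V q (Y q)) p v = ∑ k,
      ((mvfderiv 𝓘(ℝ, Eu m) (fun q ↦ mvfderiv 𝓘(ℝ, Eu m) (fun q ↦ coord (F p) (V q) k) q (Y q))
          p v • coordField (F p) k (F p) +
        mvfderiv 𝓘(ℝ, Eu m) (fun q ↦ coord (F p) (V q) k) p (Y p) •
          g.covDerivAlong F (fun q ↦ coordField (F p) k (F q)) p v) +
      (mvfderiv 𝓘(ℝ, Eu m) (fun q ↦ coord (F p) (V q) k) p v •
          g.covDerivAlong F (fun q ↦ coordField (F p) k (F q)) p (Y p) +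
        coord (F p) (V p) k • g.covDerivAlong F
          (fun q ↦ g.covDerivAlong F (fun q ↦ coordField (F p) k (F q)) q (Y q)) p v)) := by
    intro Y hY v
    have hev : ∀ᶠ q in 𝓝 p, g.covDerivAlong F V q (Y q) = _ := h1.mono fun q hq ↦ hq (Y q)
    have b1 := fun k ↦ SmoothFieldAt.deriv_fun (hf k) hY.at
    have b2 := fun k ↦ (hE k).covDerivAlong g hY.at
    rw [g.covDerivAlong_congr hev, g.covDerivAlong_sum hF fun k _ ↦
      (SmoothAlongAt.smul (b1 k) (hE k).at).add (SmoothAlongAt.smul (hf k) (b2 k))]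
    refine Finset.sum_congr rfl fun k _ ↦ ?_
    rw [g.covDerivAlong_add (SmoothAlongAt.smul (b1 k) (hE k).at)
      (SmoothAlongAt.smul (hf k) (b2 k)), g.covDerivAlong_smul (b1 k) (hE k).at,
      g.covDerivAlong_smul (hf k) (b2 k)]
  rw [curvatureAlong, h2 hX, h2 hY, h1.self_of_nhds, ← Finset.sum_sub_distrib,
    ← Finset.sum_sub_distrib]
  refine Finset.sum_congr rfl fun k _ ↦ ?_
  rw [mvfderiv_bracket (hf k) hX.at hY.at, curvatureAlong]
  module

/-- The curvature of the pulled-back connection is the pulled-back curvature. -/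
theorem curvatureAlong_eq_riem (hV : SmoothNear m F V p)
    {X Y : (q : N) → Tan m q} (hX : SmoothFieldNear X p) (hY : SmoothFieldNear Y p) :
    g.curvatureAlong F X Y V p = g.riem (F p) (mfderiv 𝓘(ℝ, Eu m) 𝓘(ℝ, Eu n) F p (X p))
      (mfderiv 𝓘(ℝ, Eu m) 𝓘(ℝ, Eu n) F p (Y p)) (V p) := by
  have hx := mem_chart_source (Eu n) (F p)
  have hFe : ∀ᶠ q in 𝓝 p, ContMDiffAt 𝓘(ℝ, Eu m) 𝓘(ℝ, Eu n) ∞ F q := by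
    filter_upwards [hV] with q hq using hq.base
  rw [g.curvatureAlong_eq_sum hV hX hY, riem_apply]
  simp only [g.curvatureAlong_comp (smoothFieldNear_coordField hx _) hFe hX.at hY.at,
    Finset.smul_sum]
  rw [Finset.sum_comm]
  refine Finset.sum_congr rfl fun i _ ↦ ?_
  rw [Finset.sum_comm]
  refine Finset.sum_congr rfl fun j _ ↦ Finset.sum_congr rfl fun k _ ↦ ?_
  module

/-- The curvature is a tensor: it only depends on the values of the fields at the point. -/
theorem curvature_eq_riem {X Y Z : (x : M) → Tan n x} {x : M} (hX : SmoothFieldNear X x)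
    (hY : SmoothFieldNear Y x) (hZ : SmoothFieldNear Z x) :
    g.curvature X Y Z x = g.riem x (X x) (Y x) (Z x) := by
  have h := g.curvatureAlong_eq_riem hZ hX hY
  simp only [mfderiv_self] at h
  exact h

lemma smoothFieldNear_curvature {X Y Z : (x : M) → Tan n x} {x : M} (hX : SmoothFieldNear X x)
    (hY : SmoothFieldNear Y x) (hZ : SmoothFieldNear Z x) :
    SmoothFieldNear (g.curvature X Y Z) x := by
  have h1 := hX.nabla g (hY.nabla g hZ)
  have h2 := hY.nabla g (hX.nabla g hZ)
  have h3 := (SmoothNear.mlieBracket hX hY).nabla g hZ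
  filter_upwards [h1, h2, h3] with y a1 a2 a3
  have e : ∀ {U : (x : M) → Tan n x}, SmoothFieldAt U y → SmoothFieldAt (fun x ↦ -U x) y := by
    intro U hU
    refine (SmoothAlongAt.smul (SmoothFun.const (-1) y) hU).congr (Eventually.of_forall fun z ↦ ?_)
    simp
  refine ((a1.add (e a2)).add (e a3)).congr (Eventually.of_forall fun z ↦ ?_)
  rw [curvature]
  abel

end PseudoRiemannianMetric
end Curvature

/-! ### The covariant derivative of the curvature tensor -/

section NablaCurvature
variable {n : ℕ}
  {M : Type*} [TopologicalSpace M] [ChartedSpace (Eu n) M] [IsManifold 𝓘(ℝ, Eu n) ∞ M]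

namespace PseudoRiemannianMetric
variable (g : PseudoRiemannianMetric n M)

/-- The covariant derivative of a field `φ` of endomorphisms is tensorial. -/
lemma nabla_endomorphism {x : M} (φ : (y : M) → Tan n y →ₗ[ℝ] Tan n y)
    (hφ : ∀ {X : (y : M) → Tan n y}, SmoothFieldAt X x → SmoothFieldAt (fun y ↦ φ y (X y)) x)
    {X : (y : M) → Tan n y} (W : (y : M) → Tan n y) (hX : SmoothFieldAt X x) :
    g.nabla W (fun y ↦ φ y (X y)) x - φ x (g.nabla W X x) =
      ∑ k, coord x (X x) k • (g.nabla W (fun y ↦ φ y (coordField x k y)) x -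
        φ x (g.nabla W (coordField x k) x)) := by
  have hx := mem_chart_source (Eu n) x
  have hE := fun k ↦ smoothFieldAt_coordField (M := M) hx k
  have hf := fun k ↦ hX.coord hx k
  have e1 : ∀ᶠ y in 𝓝 x, X y = ∑ k, coord x (X y) k • coordField x k y := by
    filter_upwards [(chartAt (Eu n) x).open_source.mem_nhds hx] with y hy
    exact (sum_coord_smul_coordField hy _).symm
  have e2 : ∀ᶠ y in 𝓝 x, φ y (X y) = ∑ k, coord x (X y) k • φ y (coordField x k y) := by
    filter_upwards [e1] with y hy
    conv_lhs => rw [hy]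
    simp only [map_sum, map_smul]
  have h1 : g.nabla W X x = ∑ k, (mvfderiv 𝓘(ℝ, Eu n) (fun y ↦ coord x (X y) k) x (W x) •
      coordField x k x + coord x (X x) k • g.nabla W (coordField x k) x) := by
    rw [nabla, g.covDerivAlong_congr e1, g.covDerivAlong_sum (contMDiffAt_self x)
      fun k _ ↦ SmoothAlongAt.smul (hf k) (hE k)]
    exact Finset.sum_congr rfl fun k _ ↦ g.covDerivAlong_smul (hf k) (hE k) _
  have h2 : g.nabla W (fun y ↦ φ y (X y)) x =
      ∑ k, (mvfderiv 𝓘(ℝ, Eu n) (fun y ↦ coord x (X y) k) x (W x) •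
      φ x (coordField x k x) + coord x (X x) k • g.nabla W (fun y ↦ φ y (coordField x k y)) x) := by
    rw [nabla, g.covDerivAlong_congr e2, g.covDerivAlong_sum (contMDiffAt_self x)
      fun k _ ↦ SmoothAlongAt.smul (hf k) (hφ (hE k))]
    exact Finset.sum_congr rfl fun k _ ↦ g.covDerivAlong_smul (hf k) (hφ (hE k)) _
  rw [h1, h2]
  simp only [map_sum, map_add, map_smul, ← Finset.sum_sub_distrib]
  exact Finset.sum_congr rfl fun k _ ↦ by module

lemma smoothFieldAt_riem {X Y Z : (x : M) → Tan n x} {x : M} (hX : SmoothFieldAt X x)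
    (hY : SmoothFieldAt Y x) (hZ : SmoothFieldAt Z x) :
    SmoothFieldAt (fun y ↦ g.riem y (X y) (Y y) (Z y)) x := by
  have hx := mem_chart_source (Eu n) x
  have hE := fun k ↦ smoothFieldNear_coordField (M := M) hx k
  have h0 := contMDiffAt_self (n := n) x
  have hs : SmoothFieldAt (fun y ↦ ∑ i, ∑ j, ∑ k, coord x (X y) i • coord x (Y y) j •
      coord x (Z y) k • g.curvature (coordField x i) (coordField x j) (coordField x k) y) x := by
    refine SmoothAlongAt.sum h0 fun i _ ↦ SmoothAlongAt.sum h0 fun j _ ↦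
      SmoothAlongAt.sum h0 fun k _ ↦ ?_
    exact SmoothAlongAt.smul (hX.coord hx i) (SmoothAlongAt.smul (hY.coord hx j)
      (SmoothAlongAt.smul (hZ.coord hx k) (g.smoothFieldNear_curvature (hE i) (hE j) (hE k)).at))
  refine hs.congr ?_
  filter_upwards [(chartAt (Eu n) x).open_source.mem_nhds hx] with y hy
  conv_lhs => rw [← sum_coord_smul_coordField hy (X y), ← sum_coord_smul_coordField hy (Y y),
    ← sum_coord_smul_coordField hy (Z y)]
  simp only [map_sum, map_smul, LinearMap.sum_apply, LinearMap.smul_apply]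
  simp only [fun i j k ↦ (g.curvature_eq_riem (smoothFieldNear_coordField hy i)
    (smoothFieldNear_coordField hy j) (smoothFieldNear_coordField hy k)).symm]
  simp only [Finset.smul_sum]
  refine Eq.trans (Finset.sum_congr rfl fun k _ ↦ Finset.sum_comm) (Finset.sum_comm.trans ?_)
  refine Finset.sum_congr rfl fun i _ ↦ Finset.sum_comm.trans ?_
  refine Finset.sum_congr rfl fun j _ ↦ Finset.sum_congr rfl fun k _ ↦ ?_
  module

lemma nablaCurvature_eq_riem {W X Y Z : (x : M) → Tan n x} {x : M} (hW : SmoothFieldNear W x)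
    (hX : SmoothFieldNear X x) (hY : SmoothFieldNear Y x) (hZ : SmoothFieldNear Z x) :
    g.nablaCurvature W X Y Z x = g.nabla W (fun y ↦ g.riem y (X y) (Y y) (Z y)) x -
      g.riem x (g.nabla W X x) (Y x) (Z x) - g.riem x (X x) (g.nabla W Y x) (Z x) -
      g.riem x (X x) (Y x) (g.nabla W Z x) := by
  have e : ∀ᶠ y in 𝓝 x, g.curvature X Y Z y = g.riem y (X y) (Y y) (Z y) := by
    filter_upwards [hX.eventually, hY.eventually, hZ.eventually] with y h1 h2 h3
    exact g.curvature_eq_riem h1 h2 h3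
  rw [nablaCurvature, nabla, g.covDerivAlong_congr e, g.curvature_eq_riem (hW.nabla g hX) hY hZ,
    g.curvature_eq_riem hX (hW.nabla g hY) hZ, g.curvature_eq_riem hX hY (hW.nabla g hZ)]
  rfl

/-- The covariant derivative of the curvature tensor at `x`, as a multilinear map in the direction
and the three arguments, defined by its components in the preferred chart at `x`. -/
def nablaRiem (x : M) : Tan n x →ₗ[ℝ] Tan n x →ₗ[ℝ] Tan n x →ₗ[ℝ] Tan n x →ₗ[ℝ] Tan n x :=
  ∑ l, ∑ i, ∑ j, ∑ k, (coordL x l).smulRight ((coordL x i).smulRight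
    ((coordL x j).smulRight ((coordL x k).smulRight
      (g.nablaCurvature (coordField x l) (coordField x i) (coordField x j) (coordField x k) x))))

/-- The covariant derivative of the curvature is a tensor: it only depends on the values of the
fields at the point. -/
theorem nablaCurvature_eq_nablaRiem {W X Y Z : (x : M) → Tan n x} {x : M}
    (hW : SmoothFieldNear W x)
    (hX : SmoothFieldNear X x) (hY : SmoothFieldNear Y x) (hZ : SmoothFieldNear Z x) :
    g.nablaCurvature W X Y Z x = g.nablaRiem x (W x) (X x) (Y x) (Z x) := by
  have hx := mem_chart_source (Eu n) x
  have hE := fun k ↦ smoothFieldNear_coordField (M := M) hx k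
  -- linearity in each of the four arguments
  have s1 : ∀ {X Y Z : (x : M) → Tan n x}, SmoothFieldNear X x → SmoothFieldNear Y x →
      SmoothFieldNear Z x → g.nablaCurvature W X Y Z x =
        ∑ l, coord x (W x) l • g.nablaCurvature (coordField x l) X Y Z x := by
    intro X Y Z hX hY hZ
    have d : ∀ U : (x : M) → Tan n x, g.nabla W U x =
        ∑ l, coord x (W x) l • g.nabla (coordField x l) U x := by
      intro U
      conv_lhs => rw [nabla, ← sum_coord_smul_coordField hx (W x)]
      rw [covDerivAlong_sum_dir]
      exact Finset.sum_congr rfl fun l _ ↦ g.covDerivAlong_smul_dir _ _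
    rw [g.nablaCurvature_eq_riem hW hX hY hZ, d, d X, d Y, d Z]
    simp only [map_sum, map_smul, LinearMap.sum_apply, LinearMap.smul_apply,
      ← Finset.sum_sub_distrib]
    refine Finset.sum_congr rfl fun l _ ↦ ?_
    rw [g.nablaCurvature_eq_riem (hE l) hX hY hZ]
    module
  have s2 : ∀ {W Y Z : (x : M) → Tan n x}, SmoothFieldNear W x → SmoothFieldNear Y x →
      SmoothFieldNear Z x → g.nablaCurvature W X Y Z x =
        ∑ l, coord x (X x) l • g.nablaCurvature W (coordField x l) Y Z x := by
    intro W Y Z hW hY hZ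
    have h := g.nabla_endomorphism (fun y ↦ ((g.riem y).flip (Y y)).flip (Z y))
      (fun hU ↦ g.smoothFieldAt_riem hU hY.at hZ.at) W hX.at
    simp only [LinearMap.flip_apply] at h
    rw [g.nablaCurvature_eq_riem hW hX hY hZ, h]
    conv_lhs => rw [← sum_coord_smul_coordField hx (X x)]
    simp only [coord_sum hx, coord_smul hx, coord_coordField hx]
    simp only [map_sum, map_smul, LinearMap.sum_apply, LinearMap.smul_apply,
      ← Finset.sum_sub_distrib]
    simp only [mul_ite, mul_one, mul_zero, Finset.sum_ite_eq', Finset.mem_univ, if_true]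
    refine Finset.sum_congr rfl fun l _ ↦ ?_
    rw [g.nablaCurvature_eq_riem hW (hE l) hY hZ]
    module
  have s3 : ∀ {W X Z : (x : M) → Tan n x}, SmoothFieldNear W x → SmoothFieldNear X x →
      SmoothFieldNear Z x → g.nablaCurvature W X Y Z x =
        ∑ l, coord x (Y x) l • g.nablaCurvature W X (coordField x l) Z x := by
    intro W X Z hW hX hZ
    have h := g.nabla_endomorphism (fun y ↦ (g.riem y (X y)).flip (Z y))
      (fun hU ↦ g.smoothFieldAt_riem hX.at hU hZ.at) W hY.at
    simp only [LinearMap.flip_apply] at h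
    rw [g.nablaCurvature_eq_riem hW hX hY hZ, sub_right_comm (g.nabla W _ x), h]
    conv_lhs => rw [← sum_coord_smul_coordField hx (Y x)]
    simp only [coord_sum hx, coord_smul hx, coord_coordField hx]
    simp only [map_sum, map_smul, LinearMap.sum_apply, LinearMap.smul_apply,
      ← Finset.sum_sub_distrib]
    simp only [mul_ite, mul_one, mul_zero, Finset.sum_ite_eq', Finset.mem_univ, if_true]
    refine Finset.sum_congr rfl fun l _ ↦ ?_
    rw [g.nablaCurvature_eq_riem hW hX (hE l) hZ]
    module
  have s4 : ∀ {W X Y : (x : M) → Tan n x}, SmoothFieldNear W x → SmoothFieldNear X x →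
      SmoothFieldNear Y x → g.nablaCurvature W X Y Z x =
        ∑ l, coord x (Z x) l • g.nablaCurvature W X Y (coordField x l) x := by
    intro W X Y hW hX hY
    have h := g.nabla_endomorphism (fun y ↦ g.riem y (X y) (Y y))
      (fun hU ↦ g.smoothFieldAt_riem hX.at hY.at hU) W hZ.at
    rw [g.nablaCurvature_eq_riem hW hX hY hZ, sub_right_comm,
      sub_right_comm _ _ (g.riem x (X x) (Y x) _), h]
    conv_lhs => rw [← sum_coord_smul_coordField hx (Z x)]
    simp only [coord_sum hx, coord_smul hx, coord_coordField hx]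
    simp only [map_sum, map_smul, ← Finset.sum_sub_distrib]
    simp only [mul_ite, mul_one, mul_zero, Finset.sum_ite_eq', Finset.mem_univ, if_true]
    refine Finset.sum_congr rfl fun l _ ↦ ?_
    rw [g.nablaCurvature_eq_riem hW hX hY (hE l)]
    module
  rw [s1 hX hY hZ]
  simp only [s2 (hE _) hY hZ, s3 (hE _) (hE _) hZ, s4 (hE _) (hE _) (hE _)]
  simp [nablaRiem, coordL_apply, Finset.smul_sum]

end PseudoRiemannianMetric
end NablaCurvature

/-! ### The equation of Codazzi -/

section HypersurfaceEquations
variable {n : ℕ}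
  {S : Type*} [TopologicalSpace S] [ChartedSpace (Eu n) S] [IsManifold 𝓘(ℝ, Eu n) ∞ S]
  {M : Type*} [TopologicalSpace M] [ChartedSpace (Eu (n + 1)) M]
  [IsManifold 𝓘(ℝ, Eu (n + 1)) ∞ M]

lemma smoothFieldOn_iff {U : Set S} (hU : IsOpen U) {X : (p : S) → Tan n p} :
    SmoothFieldOn U X ↔ ∀ p ∈ U, SmoothFieldAt X p :=
  ⟨fun h _ hp ↦ ContMDiffOn.contMDiffAt h (hU.mem_nhds hp),
    fun h _ hp ↦ ContMDiffAt.contMDiffWithinAt (h _ hp)⟩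

lemma SmoothFieldOn.near {U : Set S} (hU : IsOpen U) {X : (p : S) → Tan n p}
    (hX : SmoothFieldOn U X) {p : S} (hp : p ∈ U) : SmoothFieldNear X p := by
  filter_upwards [hU.mem_nhds hp] with q hq
  exact (smoothFieldOn_iff hU).1 hX q hq

lemma smoothFieldOn_of_near {U : Set S} {X : (p : S) → Tan n p}
    (h : ∀ p ∈ U, SmoothFieldNear X p) : SmoothFieldOn U X :=
  fun p hp ↦ ContMDiffAt.contMDiffWithinAt (h p hp).at

variable {gS : PseudoRiemannianMetric n S} {g : PseudoRiemannianMetric (n + 1) M} {F : S → M}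
  {U : Set S} {ξ : (p : S) → Tan (n + 1) (F p)} {ε : ℝ}

/-- The vectors orthogonal to the normal are the tangent vectors, by a dimension count. -/
lemma IsIsometricHypersurface.exists_eq_dMap (hF : IsIsometricHypersurface gS g F) {p : S}
    {ν w : Tan (n + 1) (F p)} (hν : g.val (F p) ν ν ≠ 0)
    (hn : ∀ v, g.val (F p) ν (dMap F p v) = 0) (hw : g.val (F p) ν w = 0) :
    ∃ u : Tan n p, dMap F p u = w := by
  have hfd : FiniteDimensional ℝ (Tan (n + 1) (F p)) :=
    inferInstanceAs (FiniteDimensional ℝ (Eu (n + 1)))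
  have hfd' : FiniteDimensional ℝ (Tan n p) := inferInstanceAs (FiniteDimensional ℝ (Eu n))
  have d1 : Module.finrank ℝ (Tan (n + 1) (F p)) = n + 1 :=
    finrank_euclideanSpace_fin (𝕜 := ℝ) (n := n + 1)
  have d2 : Module.finrank ℝ (Tan n p) = n := finrank_euclideanSpace_fin (𝕜 := ℝ) (n := n)
  set L : Tan (n + 1) (F p) →ₗ[ℝ] ℝ := (g.val (F p) ν).toLinearMap with hL
  set D : Tan n p →ₗ[ℝ] Tan (n + 1) (F p) := (dMap F p).toLinearMap with hD
  have h1 : LinearMap.range D ≤ LinearMap.ker L := by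
    rintro _ ⟨v, rfl⟩
    exact hn v
  have h2 : Module.finrank ℝ (LinearMap.range D) = n := by
    rw [LinearMap.finrank_range_of_inj (hF.immersion p), d2]
  have h3 : Module.finrank ℝ (LinearMap.range L) = 1 := by
    have : LinearMap.range L = ⊤ := by
      rw [LinearMap.range_eq_top]
      exact LinearMap.surjective (fun h ↦ hν congr($h ν))
    rw [this, finrank_top, Module.finrank_self]
  have h4 := LinearMap.finrank_range_add_finrank_ker L
  have h5 : LinearMap.range D = LinearMap.ker L :=
    Submodule.eq_of_le_of_finrank_eq h1 (by omega)
  have h6 : w ∈ LinearMap.ker L := hw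
  rw [← h5] at h6
  exact h6

/-- The tangential part of the Gauss formula: both sides satisfy the same Koszul formula. -/
lemma IsIsometricHypersurface.val_covDerivAlong (hF : IsIsometricHypersurface gS g F) {p : S}
    {X Y : (q : S) → Tan n q} (hX : SmoothFieldAt X p) (hY : SmoothFieldAt Y p) (u : Tan n p) :
    g.val (F p) (g.covDerivAlong F (fun q ↦ dMap F q (Y q)) p (X p)) (dMap F p u) =
      gS.val p (gS.nabla X Y p) u := by
  have hx := mem_chart_source (Eu n) p
  set Z : (q : S) → Tan n q := fun q ↦ ∑ k, coord p u k • coordField p k q with hZ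
  have hZs : SmoothFieldAt Z p := SmoothAlongAt.sum (PseudoRiemannianMetric.contMDiffAt_self p)
    fun k _ ↦ SmoothAlongAt.smul (SmoothFun.const _ p) (smoothFieldAt_coordField hx k)
  have hZp : Z p = u := sum_coord_smul_coordField hx u
  have h1 := gS.nabla_koszul hX hY hZs
  have h2 := g.koszul (hF.smooth p) hX hY hZs (P := fun U V q ↦ gS.val q (U q) (V q))
    (fun U V ↦ funext fun q ↦ hF.isometric q (U q) (V q))
  rw [hZp] at h1 h2
  linarith

/-- The skew part of `∇^S h` is the normal part of the ambient curvature. -/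
theorem codazzi_equation (hF : IsIsometricHypersurface gS g F) (hU : IsOpen U)
    (hξ : IsUnitNormalOn g F U ξ ε) {p : S} (hp : p ∈ U) {X Y Z : (q : S) → Tan n q}
    (hX : SmoothFieldNear X p) (hY : SmoothFieldNear Y p) (hZ : SmoothFieldNear Z p) :
    nablaSecondForm gS g F ξ ε X Y Z p - nablaSecondForm gS g F ξ ε Y X Z p =
      ε * g.val (F p) (g.riem (F p) (dMap F p (X p)) (dMap F p (Y p)) (dMap F p (Z p))) (ξ p) := by
  have hFs := hF.smooth
  have hξs : SmoothAlongAt n F ξ p := ContMDiffOn.contMDiffAt hξ.smooth (hU.mem_nhds hp)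
  have hε : ε * ε = 1 := by rcases hξ.sign with h | h <;> simp [h]
  have hε0 : ε ≠ 0 := by rintro rfl; simp at hε
  have hpush : ∀ {V : (q : S) → Tan n q}, SmoothFieldNear V p →
      SmoothNear n F (fun q ↦ dMap F q (V q)) p := by
    intro V hV
    filter_upwards [hV] with q hq
    exact SmoothFieldAt.deriv_map (hFs q) hq
  -- `X (h(Y,Z))` in terms of the second covariant derivative
  have key : ∀ {X Y : (q : S) → Tan n q}, SmoothFieldNear X p → SmoothFieldNear Y p →
      mvfderiv 𝓘(ℝ, Eu n) (secondForm g F ξ ε Y Z) p (X p) =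
        ε * g.val (F p) (g.covDerivAlong F
          (fun q ↦ g.covDerivAlong F (fun q ↦ dMap F q (Z q)) q (Y q)) p (X p)) (ξ p) -
        secondForm g F ξ ε X (gS.nabla Y Z) p := by
    intro X Y hX hY
    have hYZ := (hpush hZ).covDerivAlong g hY.at
    have hnab : SmoothFieldNear (gS.nabla Y Z) p := hY.nabla gS hZ
    have hs : SmoothFun n (fun q ↦ g.val (F q)
        (g.covDerivAlong F (fun q ↦ dMap F q (Z q)) q (Y q)) (ξ q)) p := g.smoothFun_val hYZ hξs
    have e1 : mvfderiv 𝓘(ℝ, Eu n) (secondForm g F ξ ε Y Z) p (X p) = ε * mvfderiv 𝓘(ℝ, Eu n)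
        (fun q ↦ g.val (F q) (g.covDerivAlong F (fun q ↦ dMap F q (Z q)) q (Y q)) (ξ q)) p (X p) :=
          by
      refine (mvfderiv_mul_apply (SmoothFun.const ε p) hs (X p)).trans ?_
      simp [mvfderiv_const]
    -- `∇_X ξ` is tangential
    have e2 : g.val (F p) (ξ p) (g.covDerivAlong F ξ p (X p)) = 0 := by
      have h := g.mvfderiv_val hξs hξs (X p)
      have hc : (fun q ↦ g.val (F q) (ξ q) (ξ q)) =ᶠ[𝓝 p] fun _ ↦ ε := by
        filter_upwards [hU.mem_nhds hp] with q hq using hξ.norm q hq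
      rw [mvfderiv_congr hc, g.symm _ (g.covDerivAlong F ξ p (X p))] at h
      simp only [mvfderiv_const] at h
      have h' : (0 : ℝ) = _ := h
      linarith
    obtain ⟨u, hu⟩ := hF.exists_eq_dMap (by rw [hξ.norm p hp]; exact hε0) (hξ.normal p hp) e2
    -- the Gauss formula, paired with the tangential vector `∇_X ξ`
    have e3 : g.val (F p) (g.covDerivAlong F (fun q ↦ dMap F q (Z q)) p (Y p))
        (g.covDerivAlong F ξ p (X p)) =
        g.val (F p) (dMap F p (gS.nabla Y Z p)) (g.covDerivAlong F ξ p (X p)) := by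
      rw [← hu, hF.val_covDerivAlong hY.at hZ.at, hF.isometric]
    have e4 := g.mvfderiv_val (hpush hnab).at hξs (X p)
    have hc : (fun q ↦ g.val (F q) (dMap F q (gS.nabla Y Z q)) (ξ q)) =ᶠ[𝓝 p] fun _ ↦ 0 := by
      filter_upwards [hU.mem_nhds hp] with q hq
      rw [g.symm, hξ.normal q hq]
    rw [mvfderiv_congr hc] at e4
    simp only [mvfderiv_const] at e4
    have e4' : (0 : ℝ) = _ := e4
    rw [e1, g.mvfderiv_val hYZ hξs, e3, secondForm]
    linear_combination (-ε) * e4'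
  have hdir : secondForm g F ξ ε (gS.nabla X Y) Z p - secondForm g F ξ ε (gS.nabla Y X) Z p =
      ε * g.val (F p) (g.covDerivAlong F (fun q ↦ dMap F q (Z q)) p
        (mlieBracket 𝓘(ℝ, Eu n) X Y p)) (ξ p) := by
    rw [← gS.nabla_sub_nabla hX.at hY.at]
    have := map_sub (g.covDerivL F (fun q ↦ dMap F q (Z q)) p) (gS.nabla X Y p) (gS.nabla Y X p)
    have h' : g.covDerivAlong F (fun q ↦ dMap F q (Z q)) p (gS.nabla X Y p - gS.nabla Y X p) =
      g.covDerivAlong F (fun q ↦ dMap F q (Z q)) p (gS.nabla X Y p) -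
      g.covDerivAlong F (fun q ↦ dMap F q (Z q)) p (gS.nabla Y X p) := this
    rw [h', map_sub, sub_apply, mul_sub]
    rfl
  have hR := g.curvatureAlong_eq_riem (hpush hZ) hX hY
  rw [← hR, PseudoRiemannianMetric.curvatureAlong, map_sub, map_sub, sub_apply, sub_apply,
    nablaSecondForm, nablaSecondForm, key hX hY, key hY hX]
  linear_combination -hdir

/-- A tangent vector extends to a field that is smooth near the point. -/
lemma exists_smoothFieldOn (p : S) (v : Tan n p) : ∃ X : (q : S) → Tan n q,
    SmoothFieldOn (chartDom n p) X ∧ X p = v := by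
  have hx := mem_chart_source (Eu n) p
  refine ⟨fun q ↦ ∑ k, coord p v k • coordField p k q, ?_, sum_coord_smul_coordField hx v⟩
  refine (smoothFieldOn_iff (chartAt (Eu n) p).open_source).2 fun q hq ↦ ?_
  exact SmoothAlongAt.sum (PseudoRiemannianMetric.contMDiffAt_self q)
    fun k _ ↦ SmoothAlongAt.smul (SmoothFun.const _ q) (smoothFieldAt_coordField hq k)

lemma SmoothFieldOn.mono {U W : Set S} {X : (q : S) → Tan n q} (h : SmoothFieldOn U X)
    (hW : W ⊆ U) : SmoothFieldOn W X := ContMDiffOn.mono h hW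

/-- At every point of a Codazzi hypersurface, the curvature of the ambient space maps triples of
tangent vectors to tangent vectors. -/
theorem IsCodazzi.val_riem_eq_zero (hF : IsIsometricHypersurface gS g F) (h : IsCodazzi gS g F)
    (p : S) : ∃ ν : Tan (n + 1) (F p), g.val (F p) ν ν ≠ 0 ∧ ∀ u v w : Tan (n + 1) (F p),
      g.val (F p) ν u = 0 → g.val (F p) ν v = 0 → g.val (F p) ν w = 0 →
        g.val (F p) (g.riem (F p) u v w) ν = 0 := by
  obtain ⟨U, hU, hp, ξ, ε, hξ, hsym⟩ := h p
  have hε0 : ε ≠ 0 := by rcases hξ.sign with h | h <;> simp [h]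
  have hν : g.val (F p) (ξ p) (ξ p) ≠ 0 := by rw [hξ.norm p hp]; exact hε0
  refine ⟨ξ p, hν, fun u v w hu hv hw ↦ ?_⟩
  obtain ⟨u, rfl⟩ := hF.exists_eq_dMap hν (hξ.normal p hp) hu
  obtain ⟨v, rfl⟩ := hF.exists_eq_dMap hν (hξ.normal p hp) hv
  obtain ⟨w, rfl⟩ := hF.exists_eq_dMap hν (hξ.normal p hp) hw
  obtain ⟨X, hX, rfl⟩ := exists_smoothFieldOn p u
  obtain ⟨Y, hY, rfl⟩ := exists_smoothFieldOn p v
  obtain ⟨Z, hZ, rfl⟩ := exists_smoothFieldOn p w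
  have ho := (chartAt (Eu n) p).open_source
  have hx := mem_chart_source (Eu n) p
  have h1 := (hsym (U ∩ chartDom n p) (hU.inter ho) inter_subset_left X Y Z
    (hX.mono inter_subset_right) (hY.mono inter_subset_right) (hZ.mono inter_subset_right)
    p ⟨hp, hx⟩).1
  have h2 := codazzi_equation hF hU hξ hp (hX.near ho hx) (hY.near ho hx) (hZ.near ho hx)
  rw [h1, sub_self] at h2
  exact (mul_eq_zero.1 h2.symm).resolve_left hε0

lemma IsParallel.isCodazzi (h : IsParallel gS g F) : IsCodazzi gS g F := by
  intro p
  obtain ⟨U, hU, hp, ξ, ε, hξ, h0⟩ := h p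
  refine ⟨U, hU, hp, ξ, ε, hξ, fun W hW hWU X Y Z hX hY hZ q hq ↦ ?_⟩
  rw [h0 W hW hWU X Y Z hX hY hZ q hq, h0 W hW hWU Y X Z hY hX hZ q hq,
    h0 W hW hWU X Z Y hX hZ hY q hq]
  exact ⟨rfl, rfl⟩

lemma IsTotallyGeodesic.isParallel (gS : PseudoRiemannianMetric n S)
    (h : IsTotallyGeodesic g F) : IsParallel gS g F := by
  intro p
  obtain ⟨U, hU, hp, ξ, ε, hξ, h0⟩ := h p
  refine ⟨U, hU, hp, ξ, ε, hξ, fun W hW hWU X Y Z hX hY hZ q hq ↦ ?_⟩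
  have hn : ∀ {Y : (q : S) → Tan n q}, SmoothFieldOn W Y → SmoothFieldOn W (gS.nabla X Y) :=
    fun hY ↦ smoothFieldOn_of_near fun q hq ↦ (hX.near hW hq).nabla gS (hY.near hW hq)
  have hc : secondForm g F ξ ε Y Z =ᶠ[𝓝 q] fun _ ↦ 0 := by
    filter_upwards [hW.mem_nhds hq] with r hr using h0 W hW hWU Y Z hY hZ r hr
  rw [nablaSecondForm, mvfderiv_congr hc, h0 W hW hWU _ Z (hn hY) hZ q hq,
    h0 W hW hWU Y _ hY (hn hZ) q hq]
  simp [mvfderiv_const]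

end HypersurfaceEquations

/-! ### Fundamental fields of a group action -/

section Action
variable {k n : ℕ}
  {G : Type*} [TopologicalSpace G] [ChartedSpace (Eu k) G] [Group G] [LieGroup 𝓘(ℝ, Eu k) ∞ G]
  {M : Type*} [TopologicalSpace M] [ChartedSpace (Eu n) M] [IsManifold 𝓘(ℝ, Eu n) ∞ M]
  [MulAction G M] [ContMDiffSMul 𝓘(ℝ, Eu k) 𝓘(ℝ, Eu n) ∞ G M]

/-- The fundamental vector field of a group action generated by the element `w` of the Lie
algebra. Its value at `x` is the derivative of the orbit map at `1`, which is a tangent vector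
at `1 • x`, that is, at `x`. -/
def fundField (n : ℕ) {M : Type*} [TopologicalSpace M] [ChartedSpace (Eu n) M] [MulAction G M]
    (w : GroupLieAlgebra 𝓘(ℝ, Eu k) G) (x : M) : Tan n x :=
  (mfderiv 𝓘(ℝ, Eu k) 𝓘(ℝ, Eu n) (fun a : G ↦ a • x) 1 : Eu k →L[ℝ] Eu n) w

lemma totalSpace_mk_eq {x y : M} (h : y = x) (v : Eu n) :
    (⟨y, v⟩ : TangentBundle 𝓘(ℝ, Eu n) M) = ⟨x, v⟩ := by subst h; rfl

lemma contMDiff_orbit (x : M) :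
    ContMDiff 𝓘(ℝ, Eu k) 𝓘(ℝ, Eu n) ∞ (fun a : G ↦ a • x) :=
  ContMDiff.smul (f := fun a : G ↦ a) (g := fun _ ↦ x) contMDiff_id contMDiff_const

lemma smoothFieldAt_fundField (w : GroupLieAlgebra 𝓘(ℝ, Eu k) G) (x : M) :
    SmoothFieldAt (fundField n w) x := by
  have hs : ContMDiffAt (𝓘(ℝ, Eu n).prod 𝓘(ℝ, Eu k)) 𝓘(ℝ, Eu n) ∞
      (Function.uncurry fun (y : M) (a : G) ↦ a • y) (x, 1) :=
    (ContMDiff.smul (f := fun z : M × G ↦ z.2) (g := fun z ↦ z.1) contMDiff_snd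
      contMDiff_fst).contMDiffAt
  have h := ContMDiffAt.mfderiv (m := ∞) (fun (y : M) (a : G) ↦ a • y) (fun _ ↦ (1 : G)) hs
    contMDiffAt_const (by simp)
  have hw : ContMDiffAt 𝓘(ℝ, Eu n) 𝓘(ℝ, Eu k).tangent ∞
      (fun _ : M ↦ (⟨1, w⟩ : TangentBundle 𝓘(ℝ, Eu k) G)) x := contMDiffAt_const
  have h1 : ContMDiffAt 𝓘(ℝ, Eu n) 𝓘(ℝ, Eu n) ∞ (fun y : M ↦ (1 : G) • y) x :=
    (ContMDiffSMul.contMDiff_const_smul (I := 𝓘(ℝ, Eu k)) (1 : G)).contMDiffAt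
  have h2 := ContMDiffAt.clm_apply_of_inCoordinates (F₁ := Eu k) (F₂ := Eu n) h hw h1
  refine ContMDiffAt.congr_of_eventuallyEq h2 (Eventually.of_forall fun y ↦ ?_)
  exact (totalSpace_mk_eq (one_smul G y) _).symm

/-- Identification of tangent spaces at equal points. -/
lemma fundField_apply (w : GroupLieAlgebra 𝓘(ℝ, Eu k) G) {x y : M} (h : x = y) :
    (mfderiv 𝓘(ℝ, Eu k) 𝓘(ℝ, Eu n) (fun a : G ↦ a • x) 1 : Eu k →L[ℝ] Eu n) w =
      fundField n w y := by subst h; rfl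

/-- The orbit maps relate the right-invariant fields of the group, which are the fundamental fields
of its action on itself by left multiplication, to the fundamental fields on `M`. -/
lemma mfderiv_orbit_fundField (w : GroupLieAlgebra 𝓘(ℝ, Eu k) G) (x : M) (a : G) :
    mfderiv 𝓘(ℝ, Eu k) 𝓘(ℝ, Eu n) (fun b : G ↦ b • x) a (fundField k w a) =
      fundField n w (a • x) := by
  have h1 : MDifferentiableAt 𝓘(ℝ, Eu k) 𝓘(ℝ, Eu n) (fun b : G ↦ b • x) ((1 : G) • a) :=
    (contMDiff_orbit x).contMDiffAt.mdifferentiableAt (by simp)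
  have h2 : MDifferentiableAt 𝓘(ℝ, Eu k) 𝓘(ℝ, Eu k) (fun b : G ↦ b • a) 1 :=
    (contMDiff_orbit a).contMDiffAt.mdifferentiableAt (by simp)
  have h := mfderiv_comp (1 : G) h1 h2
  have e : (fun b : G ↦ b • x) ∘ (fun b : G ↦ b • a) = fun b : G ↦ b • (a • x) := by
    ext b; simp [mul_smul]
  rw [e] at h
  have h3 := congr($h w)
  refine Eq.trans ?_ h3.symm
  have : ∀ c : G, a = c → ∀ u : Eu k,
    (mfderiv 𝓘(ℝ, Eu k) 𝓘(ℝ, Eu n) (fun b : G ↦ b • x) a : Eu k →L[ℝ] Eu n) u =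
    (mfderiv 𝓘(ℝ, Eu k) 𝓘(ℝ, Eu n) (fun b : G ↦ b • x) c : Eu k →L[ℝ] Eu n) u := by
    rintro c rfl u; rfl
  exact this _ (one_smul G a).symm _

lemma contMDiff_group_inv : ContMDiff 𝓘(ℝ, Eu k) 𝓘(ℝ, Eu k) ∞ (fun a : G ↦ a⁻¹) :=
  contMDiff_inv 𝓘(ℝ, Eu k) ∞

lemma mfderiv_inv_one (w : GroupLieAlgebra 𝓘(ℝ, Eu k) G) :
    (mfderiv 𝓘(ℝ, Eu k) 𝓘(ℝ, Eu k) (fun a : G ↦ a⁻¹) 1 : Eu k →L[ℝ] Eu k) w = -(w : Eu k) := by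
  have hmul : MDifferentiableAt (𝓘(ℝ, Eu k).prod 𝓘(ℝ, Eu k)) 𝓘(ℝ, Eu k)
      (fun z : G × G ↦ z.1 * z.2) (1, 1⁻¹) :=
    (contMDiff_mul 𝓘(ℝ, Eu k) ∞).contMDiffAt.mdifferentiableAt (by simp)
  have hinv : MDifferentiableAt 𝓘(ℝ, Eu k) 𝓘(ℝ, Eu k) (fun a : G ↦ a⁻¹) 1 :=
    contMDiff_group_inv.contMDiffAt.mdifferentiableAt (by simp)
  have hid : MDifferentiableAt 𝓘(ℝ, Eu k) 𝓘(ℝ, Eu k) (fun a : G ↦ a) 1 := mdifferentiableAt_id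
  have h := mfderiv_comp (1 : G) hmul (hid.prodMk hinv)
  have e : (fun z : G × G ↦ z.1 * z.2) ∘ (fun a : G ↦ (a, a⁻¹)) = fun _ ↦ 1 := by
    ext a; simp
  rw [e, mfderiv_const] at h
  have h1 : (0 : Eu k) = _ := congr($h w)
  have h2 := mfderiv_prodMk hid hinv
  have h3 := mfderiv_prod_eq_add_apply hmul
    (v := mfderiv 𝓘(ℝ, Eu k) (𝓘(ℝ, Eu k).prod 𝓘(ℝ, Eu k)) (fun a : G ↦ (a, a⁻¹)) 1 w)
  have h4 := h1.trans h3
  rw [h2] at h4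
  have h5 : ∀ (f : G → G), (f = fun a ↦ a) → ∀ (c : G) (u : Eu k),
      (mfderiv 𝓘(ℝ, Eu k) 𝓘(ℝ, Eu k) f c : Eu k →L[ℝ] Eu k) u = u := by
    rintro f rfl c u
    exact congr($(mfderiv_id (I := 𝓘(ℝ, Eu k)) (x := c)) u)
  have h6 : (0 : Eu k) = @HAdd.hAdd (Eu k) (Eu k) (Eu k) _ w (
      (mfderiv 𝓘(ℝ, Eu k) 𝓘(ℝ, Eu k) (fun a : G ↦ a⁻¹) 1 : Eu k →L[ℝ] Eu k) w) :=
    h4.trans (congrArg₂ (fun u v : Eu k ↦ u + v)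
      ((h5 _ (by ext z; simp) _ _).trans (h5 (fun a ↦ a) rfl _ _)) (h5 _ (by ext z; simp) _ _))
  exact (neg_eq_of_add_eq_zero_right h6.symm).symm

/-- Inversion relates left-invariant fields to the opposites of right-invariant fields. -/
lemma mfderiv_inv_mulInvariantVectorField (w : GroupLieAlgebra 𝓘(ℝ, Eu k) G) (a : G) :
    mfderiv 𝓘(ℝ, Eu k) 𝓘(ℝ, Eu k) (fun b : G ↦ b⁻¹) a (mulInvariantVectorField w a) =
      -fundField k w a⁻¹ := by
  have hinv : ∀ c : G, MDifferentiableAt 𝓘(ℝ, Eu k) 𝓘(ℝ, Eu k) (fun a : G ↦ a⁻¹) c := fun c ↦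
    contMDiff_group_inv.contMDiffAt.mdifferentiableAt (by simp)
  have hl : MDifferentiableAt 𝓘(ℝ, Eu k) 𝓘(ℝ, Eu k) (fun b : G ↦ a * b) 1 :=
    contMDiff_mul_left.contMDiffAt.mdifferentiableAt (n := ∞) (by simp)
  have hr : MDifferentiableAt 𝓘(ℝ, Eu k) 𝓘(ℝ, Eu k) (fun b : G ↦ b • a⁻¹) (1⁻¹) :=
    (contMDiff_orbit a⁻¹).contMDiffAt.mdifferentiableAt (by simp)
  have h1 := mfderiv_comp (1 : G) (hinv (a * 1)) hl
  have h2 := mfderiv_comp (1 : G) hr (hinv 1)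
  have e : (fun b : G ↦ b⁻¹) ∘ (fun b : G ↦ a * b) =
      (fun b : G ↦ b • a⁻¹) ∘ (fun b : G ↦ b⁻¹) := by
    ext b; simp
  rw [e, h2] at h1
  have h3 := congr($h1 w)
  have t1 : ∀ c : G, a = c → ∀ u : Eu k,
    (mfderiv 𝓘(ℝ, Eu k) 𝓘(ℝ, Eu k) (fun b : G ↦ b⁻¹) a : Eu k →L[ℝ] Eu k) u =
    (mfderiv 𝓘(ℝ, Eu k) 𝓘(ℝ, Eu k) (fun b : G ↦ b⁻¹) c : Eu k →L[ℝ] Eu k) u := by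
    rintro c rfl u; rfl
  have t2 : ∀ c : G, 1 = c → ∀ u : Eu k,
    (mfderiv 𝓘(ℝ, Eu k) 𝓘(ℝ, Eu k) (fun b : G ↦ b • a⁻¹) c : Eu k →L[ℝ] Eu k) u =
    (mfderiv 𝓘(ℝ, Eu k) 𝓘(ℝ, Eu k) (fun b : G ↦ b • a⁻¹) 1 : Eu k →L[ℝ] Eu k) u := by
    rintro c rfl u; rfl
  refine (t1 _ (mul_one a).symm _).trans (h3.symm.trans ?_)
  refine (t2 _ inv_one.symm _).trans ?_
  have h4 := mfderiv_inv_one (G := G) w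
  refine (congrArg (mfderiv 𝓘(ℝ, Eu k) 𝓘(ℝ, Eu k) (fun b : G ↦ b • a⁻¹) 1 : Eu k →L[ℝ] Eu k)
    h4).trans ?_
  exact map_neg (mfderiv 𝓘(ℝ, Eu k) 𝓘(ℝ, Eu k) (fun b : G ↦ b • a⁻¹) 1 : Eu k →L[ℝ] Eu k) _

lemma mdifferentiableAt_leftInvariantField (w : GroupLieAlgebra 𝓘(ℝ, Eu k) G) (a : G) :
    MDifferentiableAt 𝓘(ℝ, Eu k) 𝓘(ℝ, Eu k).tangent
      (fun b : G ↦ (⟨b, mulInvariantVectorField w b⟩ : TangentBundle 𝓘(ℝ, Eu k) G)) a := by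
  have : LieGroup 𝓘(ℝ, Eu k) (minSmoothness ℝ 3) G := by
    rw [minSmoothness_of_isRCLikeNormedField]
    exact LieGroup.of_le (n := ∞) three_le_infty
  exact mdifferentiableAt_mulInvariantVectorField w

lemma SmoothFieldAt.neg {X : (x : M) → Tan n x} {x : M} (h : SmoothFieldAt X x) :
    SmoothFieldAt (fun y ↦ -X y) x := by
  refine (SmoothAlongAt.smul (SmoothFun.const (-1) x) h).congr (Eventually.of_forall fun z ↦ ?_)
  simp

/-- The bracket of right-invariant fields is opposite to that of left-invariant ones, since
inversion exchanges the two up to sign. -/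
lemma mlieBracket_fundField_one (v w : GroupLieAlgebra 𝓘(ℝ, Eu k) G) :
    mlieBracket 𝓘(ℝ, Eu k) (fundField (M := G) k v) (fundField k w) 1 = -fundField k ⁅v, w⁆ 1 := by
  have h3 : IsManifold 𝓘(ℝ, Eu k) 3 G := IsManifold.of_le (n := ∞) three_le_infty
  have h := mlieBracket_related (I := 𝓘(ℝ, Eu k)) (I' := 𝓘(ℝ, Eu k)) (F := fun a : G ↦ a⁻¹)
    (p := (1 : G)) (X := mulInvariantVectorField v) (Y := mulInvariantVectorField w)
    (X' := fun a ↦ -fundField k v a) (Y' := fun a ↦ -fundField k w a)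
    (contMDiff_group_inv.contMDiffAt.of_le two_le_infty)
    (mdifferentiableAt_leftInvariantField v 1)
    (mdifferentiableAt_leftInvariantField w 1)
    (SmoothFieldAt.neg (smoothFieldAt_fundField v _)).mdifferentiableAt
    (SmoothFieldAt.neg (smoothFieldAt_fundField w _)).mdifferentiableAt
    (Eventually.of_forall fun a ↦ mfderiv_inv_mulInvariantVectorField v a)
    (Eventually.of_forall fun a ↦ mfderiv_inv_mulInvariantVectorField w a)
  have h1 : ∀ u : GroupLieAlgebra 𝓘(ℝ, Eu k) G, fundField k u (1 : G) = u := by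
    intro u
    have : (fun b : G ↦ b • (1 : G)) = fun b ↦ b := by ext b; simp
    rw [fundField, this]
    exact congr($(mfderiv_id (I := 𝓘(ℝ, Eu k)) (x := (1 : G))) u)
  have h2 : ∀ c : G, c = 1 → (mlieBracket 𝓘(ℝ, Eu k) (fun a : G ↦ -fundField k v a)
      (fun a ↦ -fundField k w a) c : Eu k) = mlieBracket 𝓘(ℝ, Eu k) (fun a : G ↦ -fundField k v a)
      (fun a ↦ -fundField k w a) 1 := by rintro c rfl; rfl
  have h4 : (mlieBracket 𝓘(ℝ, Eu k) (fun a : G ↦ -fundField k v a)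
      (fun a ↦ -fundField k w a) 1 : Eu k) =
      mlieBracket 𝓘(ℝ, Eu k) (fundField k v) (fundField k w) (1 : G) := by
    have hneg : ∀ u : GroupLieAlgebra 𝓘(ℝ, Eu k) G, (fun a : G ↦ -fundField k u a) =
        (-1 : ℝ) • fundField k u := by
      intro u; ext1 a; simp
    rw [hneg, hneg, mlieBracket_const_smul_left, mlieBracket_const_smul_right]
    · simp
    · exact (smoothFieldAt_fundField w 1).mdifferentiableAt
    · exact (smoothFieldAt_fundField v 1).mdifferentiableAt
  rw [h1]
  refine h4.symm.trans ((h2 _ inv_one).symm.trans (h.symm.trans ?_))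
  exact mfderiv_inv_one ⁅v, w⁆

/-- The map sending an element of the Lie algebra to its fundamental field reverses brackets. -/
theorem mlieBracket_fundField (v w : GroupLieAlgebra 𝓘(ℝ, Eu k) G) (x : M) :
    mlieBracket 𝓘(ℝ, Eu n) (fundField n v) (fundField n w) x = -fundField n ⁅v, w⁆ x := by
  have h3 : IsManifold 𝓘(ℝ, Eu k) 3 G := IsManifold.of_le (n := ∞) three_le_infty
  have h3' : IsManifold 𝓘(ℝ, Eu n) 3 M := IsManifold.of_le (n := ∞) three_le_infty
  have h := mlieBracket_related (I := 𝓘(ℝ, Eu k)) (I' := 𝓘(ℝ, Eu n)) (F := fun a : G ↦ a • x)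
    (p := (1 : G)) (X := fundField k v) (Y := fundField k w)
    (X' := fundField n v) (Y' := fundField n w)
    ((contMDiff_orbit x).contMDiffAt.of_le two_le_infty)
    (smoothFieldAt_fundField v _).mdifferentiableAt
    (smoothFieldAt_fundField w _).mdifferentiableAt
    (smoothFieldAt_fundField v _).mdifferentiableAt
    (smoothFieldAt_fundField w _).mdifferentiableAt
    (Eventually.of_forall fun a ↦ mfderiv_orbit_fundField v x a)
    (Eventually.of_forall fun a ↦ mfderiv_orbit_fundField w x a)
  have h2 : ∀ y : M, y = x → (mlieBracket 𝓘(ℝ, Eu n) (fundField n v) (fundField n w) y : Eu n) =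
      mlieBracket 𝓘(ℝ, Eu n) (fundField n v) (fundField n w) x := by rintro y rfl; rfl
  have h4 : ∀ y : M, y = x → (fundField n ⁅v, w⁆ y : Eu n) = fundField n ⁅v, w⁆ x := by
    rintro y rfl; rfl
  refine (h2 _ (one_smul G x)).symm.trans (h.symm.trans ?_)
  rw [mlieBracket_fundField_one]
  refine (map_neg _ _).trans (congrArg (fun u : Eu n ↦ -u) ?_)
  exact (mfderiv_orbit_fundField ⁅v, w⁆ x 1).trans (h4 _ (one_smul G x))

/-- The adjoint action of `a`: the differential at `1` of the conjugation by `a`, regarded as an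
endomorphism of the tangent space at `1` although it takes values in that at `a * 1 * a⁻¹`. -/
def Ad (a : G) : GroupLieAlgebra 𝓘(ℝ, Eu k) G →ₗ[ℝ] GroupLieAlgebra 𝓘(ℝ, Eu k) G :=
  (mfderiv 𝓘(ℝ, Eu k) 𝓘(ℝ, Eu k) (fun b : G ↦ a * b * a⁻¹) 1 : Eu k →L[ℝ] Eu k).toLinearMap

lemma contMDiff_conj (a : G) :
    ContMDiff 𝓘(ℝ, Eu k) 𝓘(ℝ, Eu k) ∞ (fun b : G ↦ a * b * a⁻¹) :=
  contMDiff_mul_right.comp contMDiff_mul_left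

/-- The action of `a` maps the fundamental field of `w` to that of `Ad a w`. -/
lemma fundField_Ad (a : G) (w : GroupLieAlgebra 𝓘(ℝ, Eu k) G) (x : M) :
    fundField n (Ad a w) (a • x) =
      mfderiv 𝓘(ℝ, Eu n) 𝓘(ℝ, Eu n) (fun y : M ↦ a • y) x (fundField n w x) := by
  have h1 : MDifferentiableAt 𝓘(ℝ, Eu k) 𝓘(ℝ, Eu n) (fun b : G ↦ b • (a • x)) (a * 1 * a⁻¹) :=
    (contMDiff_orbit _).contMDiffAt.mdifferentiableAt (by simp)
  have h2 : MDifferentiableAt 𝓘(ℝ, Eu k) 𝓘(ℝ, Eu k) (fun b : G ↦ a * b * a⁻¹) 1 :=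
    (contMDiff_conj a).contMDiffAt.mdifferentiableAt (by simp)
  have h3 : MDifferentiableAt 𝓘(ℝ, Eu n) 𝓘(ℝ, Eu n) (fun y : M ↦ a • y) ((1 : G) • x) :=
    (ContMDiffSMul.contMDiff_const_smul (I := 𝓘(ℝ, Eu k)) a).contMDiffAt.mdifferentiableAt
      (n := ∞) (by simp)
  have h4 : MDifferentiableAt 𝓘(ℝ, Eu k) 𝓘(ℝ, Eu n) (fun b : G ↦ b • x) 1 :=
    (contMDiff_orbit _).contMDiffAt.mdifferentiableAt (by simp)
  have e1 := mfderiv_comp (1 : G) h1 h2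
  have e2 := mfderiv_comp (1 : G) h3 h4
  have e : (fun b : G ↦ b • (a • x)) ∘ (fun b : G ↦ a * b * a⁻¹) =
      (fun y : M ↦ a • y) ∘ (fun b : G ↦ b • x) := by
    ext b; simp [mul_smul]
  rw [e, e2] at e1
  have e3 := congr($e1 w)
  have t1 : ∀ c : G, c = 1 → ∀ u : Eu k,
    (mfderiv 𝓘(ℝ, Eu k) 𝓘(ℝ, Eu n) (fun b : G ↦ b • (a • x)) 1 : Eu k →L[ℝ] Eu n) u =
    (mfderiv 𝓘(ℝ, Eu k) 𝓘(ℝ, Eu n) (fun b : G ↦ b • (a • x)) c : Eu k →L[ℝ] Eu n) u := by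
    rintro c rfl u; rfl
  have t2 : ∀ y : M, y = x → ∀ u : Eu n,
    (mfderiv 𝓘(ℝ, Eu n) 𝓘(ℝ, Eu n) (fun z : M ↦ a • z) y : Eu n →L[ℝ] Eu n) u =
    (mfderiv 𝓘(ℝ, Eu n) 𝓘(ℝ, Eu n) (fun z : M ↦ a • z) x : Eu n →L[ℝ] Eu n) u := by
    rintro y rfl u; rfl
  exact (t1 (a * 1 * a⁻¹) (by simp) _).trans (e3.symm.trans (t2 _ (one_smul G x) _))

/-- Conjugation by `a` relates the left-invariant fields of `w` and `Ad a w`. -/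
lemma Ad_mulInvariantVectorField (a : G) (w : GroupLieAlgebra 𝓘(ℝ, Eu k) G) (b : G) :
    mfderiv 𝓘(ℝ, Eu k) 𝓘(ℝ, Eu k) (fun b : G ↦ a * b * a⁻¹) b (mulInvariantVectorField w b) =
      mulInvariantVectorField (Ad a w) (a * b * a⁻¹) := by
  have h1 : MDifferentiableAt 𝓘(ℝ, Eu k) 𝓘(ℝ, Eu k) (fun b : G ↦ a * b * a⁻¹) (b * 1) :=
    (contMDiff_conj a).contMDiffAt.mdifferentiableAt (by simp)
  have h2 : MDifferentiableAt 𝓘(ℝ, Eu k) 𝓘(ℝ, Eu k) (fun b : G ↦ a * b * a⁻¹) 1 :=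
    (contMDiff_conj a).contMDiffAt.mdifferentiableAt (by simp)
  have h3 : MDifferentiableAt 𝓘(ℝ, Eu k) 𝓘(ℝ, Eu k) (fun c : G ↦ b * c) 1 :=
    contMDiff_mul_left.contMDiffAt.mdifferentiableAt (n := ∞) (by simp)
  have h4 : MDifferentiableAt 𝓘(ℝ, Eu k) 𝓘(ℝ, Eu k) (fun c : G ↦ (a * b * a⁻¹) * c)
      (a * 1 * a⁻¹) :=
    contMDiff_mul_left.contMDiffAt.mdifferentiableAt (n := ∞) (by simp)
  have e1 := mfderiv_comp (1 : G) h1 h3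
  have e2 := mfderiv_comp (1 : G) h4 h2
  have e : (fun b : G ↦ a * b * a⁻¹) ∘ (fun c : G ↦ b * c) =
      (fun c : G ↦ (a * b * a⁻¹) * c) ∘ (fun b : G ↦ a * b * a⁻¹) := by
    ext c; simp [mul_assoc]
  rw [e, e2] at e1
  have e3 := congr($e1 w)
  have t1 : ∀ c : G, b = c → ∀ u : Eu k,
    (mfderiv 𝓘(ℝ, Eu k) 𝓘(ℝ, Eu k) (fun b : G ↦ a * b * a⁻¹) b : Eu k →L[ℝ] Eu k) u =
    (mfderiv 𝓘(ℝ, Eu k) 𝓘(ℝ, Eu k) (fun b : G ↦ a * b * a⁻¹) c : Eu k →L[ℝ] Eu k) u := by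
    rintro c rfl u; rfl
  have t2 : ∀ c : G, c = 1 → ∀ u : Eu k,
    (mfderiv 𝓘(ℝ, Eu k) 𝓘(ℝ, Eu k) (fun d : G ↦ (a * b * a⁻¹) * d) c : Eu k →L[ℝ] Eu k) u =
    (mfderiv 𝓘(ℝ, Eu k) 𝓘(ℝ, Eu k) (fun d : G ↦ (a * b * a⁻¹) * d) 1 : Eu k →L[ℝ] Eu k) u := by
    rintro c rfl u; rfl
  exact (t1 _ (mul_one b).symm _).trans (e3.symm.trans (t2 _ (by simp) _))

/-- The adjoint action preserves brackets. -/
lemma Ad_lie (a : G) (v w : GroupLieAlgebra 𝓘(ℝ, Eu k) G) : Ad a ⁅v, w⁆ = ⁅Ad a v, Ad a w⁆ := by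
  have h3 : IsManifold 𝓘(ℝ, Eu k) 3 G := IsManifold.of_le (n := ∞) three_le_infty
  have h := mlieBracket_related (I := 𝓘(ℝ, Eu k)) (I' := 𝓘(ℝ, Eu k))
    (F := fun b : G ↦ a * b * a⁻¹)
    (p := (1 : G)) (X := mulInvariantVectorField v) (Y := mulInvariantVectorField w)
    (X' := mulInvariantVectorField (Ad a v)) (Y' := mulInvariantVectorField (Ad a w))
    ((contMDiff_conj a).contMDiffAt.of_le two_le_infty)
    (mdifferentiableAt_leftInvariantField v 1)
    (mdifferentiableAt_leftInvariantField w 1)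
    (mdifferentiableAt_leftInvariantField _ _)
    (mdifferentiableAt_leftInvariantField _ _)
    (Eventually.of_forall fun b ↦ Ad_mulInvariantVectorField a v b)
    (Eventually.of_forall fun b ↦ Ad_mulInvariantVectorField a w b)
  have h2 : ∀ c : G, c = 1 → (mlieBracket 𝓘(ℝ, Eu k) (mulInvariantVectorField (Ad a v))
      (mulInvariantVectorField (Ad a w)) c : Eu k) = mlieBracket 𝓘(ℝ, Eu k)
      (mulInvariantVectorField (Ad a v)) (mulInvariantVectorField (Ad a w)) 1 := by
    rintro c rfl; rfl
  exact Eq.trans h (h2 _ (by simp))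

end Action

/-! ### Curves -/

section Curves
variable {m n : ℕ}
  {N : Type*} [TopologicalSpace N] [ChartedSpace (Eu m) N] [IsManifold 𝓘(ℝ, Eu m) ∞ N]
  {M : Type*} [TopologicalSpace M] [ChartedSpace (Eu n) M] [IsManifold 𝓘(ℝ, Eu n) ∞ M]

/-- The velocity at `0` of a curve, as an element of the model space, with which all tangent spaces
are identified by definition. -/
def velocity (γ : ℝ → M) : Eu n :=
  (mfderiv 𝓘(ℝ) 𝓘(ℝ, Eu n) γ 0 : ℝ →L[ℝ] Eu n) 1

lemma exists_curve (x : M) (v : Tan n x) : ∃ γ : ℝ → M,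
    ContMDiffAt 𝓘(ℝ) 𝓘(ℝ, Eu n) ∞ γ 0 ∧ γ 0 = x ∧ velocity γ = v := by
  have hx := mem_extChartAt_source (I := 𝓘(ℝ, Eu n)) x
  have ht := mem_extChartAt_target (I := 𝓘(ℝ, Eu n)) x
  set ψ := extChartAt 𝓘(ℝ, Eu n) x with hψ
  obtain ⟨u, hu⟩ : ∃ u : Eu n,
      (mfderiv 𝓘(ℝ, Eu n) 𝓘(ℝ, Eu n) ψ.symm (ψ x) : Eu n →L[ℝ] Eu n) u = v := by
    have h := isInvertible_mfderivWithin_extChartAt_symm ht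
    rw [ModelWithCorners.range_eq_univ, mfderivWithin_univ] at h
    exact h.bijective.surjective v
  set l : ℝ → Eu n := fun t ↦ ψ x + t • u with hl
  have hls : ContDiff ℝ ∞ l := by fun_prop
  have hl0 : l 0 = ψ x := by simp [hl]
  have hsm : ContMDiffAt 𝓘(ℝ, Eu n) 𝓘(ℝ, Eu n) ∞ ψ.symm (l 0) := by
    rw [hl0]
    exact (contMDiffOn_extChartAt_symm x).contMDiffAt (extChartAt_target_mem_nhds x)
  refine ⟨ψ.symm ∘ l, hsm.comp 0 hls.contMDiff.contMDiffAt, ?_, ?_⟩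
  · simp only [Function.comp, hl0]
    exact ψ.left_inv hx
  · have h1 := mfderiv_comp (0 : ℝ) (hsm.mdifferentiableAt (by simp))
      (hls.contMDiff.contMDiffAt.mdifferentiableAt (by simp))
    have h2 := congr($h1 (1 : ℝ))
    refine Eq.trans h2 ?_
    have h3 : (mfderiv 𝓘(ℝ) 𝓘(ℝ, Eu n) l 0 : ℝ →L[ℝ] Eu n) 1 = u := by
      have : HasDerivAt l u 0 := by
        have := ((hasDerivAt_id (0 : ℝ)).smul_const u).const_add (ψ x)
        rwa [one_smul] at this
      rw [mfderiv_eq_fderiv]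
      exact this.deriv
    have h4 : ∀ y : Eu n, y = ψ x → ∀ u : Eu n,
      (mfderiv 𝓘(ℝ, Eu n) 𝓘(ℝ, Eu n) ψ.symm y : Eu n →L[ℝ] Eu n) u =
      (mfderiv 𝓘(ℝ, Eu n) 𝓘(ℝ, Eu n) ψ.symm (ψ x) : Eu n →L[ℝ] Eu n) u := by
      rintro y rfl u; rfl
    refine Eq.trans (congrArg (mfderiv 𝓘(ℝ, Eu n) 𝓘(ℝ, Eu n) ψ.symm (l 0) : Eu n →L[ℝ] Eu n) h3) ?_
    exact (h4 _ hl0 u).trans hu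

lemma mvfderiv_congr_curve {f h : N → ℝ} {p : N} (hf : SmoothFun m f p) (hh : SmoothFun m h p)
    {ι : ℝ → N} (hι : MDifferentiableAt 𝓘(ℝ) 𝓘(ℝ, Eu m) ι 0) (hp : ι 0 = p)
    {v : Tan m p} (hv : velocity ι = v) (e : ∀ᶠ t in 𝓝 (0 : ℝ), f (ι t) = h (ι t)) :
    mvfderiv 𝓘(ℝ, Eu m) f p v = mvfderiv 𝓘(ℝ, Eu m) h p v := by
  subst hp
  subst hv
  have h1 := mvfderiv_comp_apply (0 : ℝ) hf.mdifferentiableAt hι 1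
  have h2 := mvfderiv_comp_apply (0 : ℝ) hh.mdifferentiableAt hι 1
  refine h1.symm.trans (Eq.trans ?_ h2)
  have := Filter.EventuallyEq.mfderiv_eq (I := 𝓘(ℝ)) (I' := 𝓘(ℝ)) (show f ∘ ι =ᶠ[𝓝 0] h ∘ ι from e)
  exact congr($this (1 : ℝ))

/-- The covariant derivative of a smooth field only depends on the field along a curve with the
given velocity. -/
lemma PseudoRiemannianMetric.covDerivAlong_congr_curve (g : PseudoRiemannianMetric n M)
    {F : N → M} {V W : (q : N) → Tan n (F q)} {p : N}
    (hV : SmoothAlongAt m F V p) (hW : SmoothAlongAt m F W p)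
    {ι : ℝ → N} (hι : MDifferentiableAt 𝓘(ℝ) 𝓘(ℝ, Eu m) ι 0) (hp : ι 0 = p)
    {v : Tan m p} (hv : velocity ι = v) (e : ∀ᶠ t in 𝓝 (0 : ℝ), V (ι t) = W (ι t)) :
    g.covDerivAlong F V p v = g.covDerivAlong F W p v := by
  have hx := mem_chart_source (Eu n) (F p)
  have h0 : V p = W p := by have := e.self_of_nhds; rw [hp] at this; exact this
  refine ext_coord hx fun k ↦ ?_
  rw [coord_covDerivAlong, coord_covDerivAlong, h0, mvfderiv_congr_curve (hV.coord hx k)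
    (hW.coord hx k) hι hp hv]
  filter_upwards [e] with t ht
  rw [ht]

lemma velocity_comp {F : N → M} {ι : ℝ → N} {p : N} (hp : ι 0 = p)
    (hF : MDifferentiableAt 𝓘(ℝ, Eu m) 𝓘(ℝ, Eu n) F p)
    (hι : MDifferentiableAt 𝓘(ℝ) 𝓘(ℝ, Eu m) ι 0) :
    velocity (fun t ↦ F (ι t)) =
      (mfderiv 𝓘(ℝ, Eu m) 𝓘(ℝ, Eu n) F p : Eu m →L[ℝ] Eu n) (velocity ι) := by
  subst hp
  exact congr($(mfderiv_comp (0 : ℝ) hF hι) (1 : ℝ))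

/-- The `i`-th constant coordinate field on `ℝᵐ`. -/
def constField (i : Fin m) (z : Eu m) : Tan m z :=
  (EuclideanSpace.single i 1 : Eu m)

lemma smoothFieldAt_constField (i : Fin m) (z : Eu m) : SmoothFieldAt (constField i) z := by
  refine contMDiffAt_vectorSpace_iff_contDiffAt.2 ?_
  exact contDiffAt_const

lemma mlieBracket_constField (i j : Fin m) (z : Eu m) :
    mlieBracket 𝓘(ℝ, Eu m) (constField i) (constField j) z = 0 := by
  rw [← mlieBracketWithin_univ, mlieBracketWithin_eq_lieBracketWithin]
  refine (congrFun (lieBracketWithin_univ (𝕜 := ℝ) (V := (constField i : Eu m → Eu m))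
    (W := (constField j : Eu m → Eu m))) z).trans ?_
  have h : ∀ i : Fin m, HasFDerivAt (constField i : Eu m → Eu m) (0 : Eu m →L[ℝ] Eu m) z :=
    fun i ↦ hasFDerivAt_const _ _
  have h1 := (h i).fderiv
  have h2 := (h j).fderiv
  simp only [lieBracket]
  refine Eq.trans (congrArg₂ (fun u v : Eu m ↦ u - v) congr($h2 (constField i z))
    congr($h1 (constField j z))) ?_
  exact sub_zero (0 : Eu m)

lemma line_velocity (z : Eu m) (i : Fin m) :
    MDifferentiableAt 𝓘(ℝ) 𝓘(ℝ, Eu m) (fun t : ℝ ↦ z + t • (EuclideanSpace.single i 1 : Eu m)) 0 ∧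
    velocity (n := m) (fun t : ℝ ↦ z + t • (EuclideanSpace.single i 1 : Eu m)) =
      constField i z := by
  have h : HasDerivAt (fun t : ℝ ↦ z + t • (EuclideanSpace.single i 1 : Eu m))
      (EuclideanSpace.single i 1) 0 := by
    have := ((hasDerivAt_id (0 : ℝ)).smul_const (EuclideanSpace.single i 1 : Eu m)).const_add z
    simpa using this
  refine ⟨h.differentiableAt.mdifferentiableAt, ?_⟩
  rw [velocity, mfderiv_eq_fderiv]
  exact h.deriv

end Curves

/-! ### Isometric actions -/

section Killing
variable {k n : ℕ}
  {G : Type*} [TopologicalSpace G] [ChartedSpace (Eu k) G] [Group G] [LieGroup 𝓘(ℝ, Eu k) ∞ G]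
  {M : Type*} [TopologicalSpace M] [ChartedSpace (Eu n) M] [IsManifold 𝓘(ℝ, Eu n) ∞ M]
  [MulAction G M] [ContMDiffSMul 𝓘(ℝ, Eu k) 𝓘(ℝ, Eu n) ∞ G M]

/-- The fundamental fields of an isometric action have skew-symmetric covariant derivative. For
curves `c` in the group with velocity `w` and `γ` in `M` with velocity `u`, put
`φ(s, t) = c(s) • γ(t)`. Then `|∂_t φ|²` does not depend on `s` at `t = 0`, so that
`0 = ⟨∇_s ∂_t φ, ∂_t φ⟩ = ⟨∇_t ∂_s φ, ∂_t φ⟩`, where `∂_s φ` is the fundamental field of `w`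
along `s = 0`. -/
lemma val_covDerivAlong_fundField_self (g : PseudoRiemannianMetric n M)
    (hg : ∀ (a : G) (x : M) (v w : Tan n x),
      g.val (a • x) (mfderiv 𝓘(ℝ, Eu n) 𝓘(ℝ, Eu n) (fun y : M ↦ a • y) x v)
      (mfderiv 𝓘(ℝ, Eu n) 𝓘(ℝ, Eu n) (fun y : M ↦ a • y) x w) = g.val x v w)
    (w : GroupLieAlgebra 𝓘(ℝ, Eu k) G) (x : M) (u : Tan n x) :
    g.val x (g.covDerivAlong (fun y : M ↦ y) (fundField n w) x u) u = 0 := by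
  obtain ⟨c, hc, hc0, hcw⟩ := exists_curve (1 : G) w
  obtain ⟨γ, hγ, rfl, rfl⟩ := exists_curve x u
  set φ : Eu 2 → M := fun z ↦ c (z 0) • γ (z 1) with hφ
  have hpr : ∀ i : Fin 2, ContMDiff 𝓘(ℝ, Eu 2) 𝓘(ℝ) ∞ (fun z : Eu 2 ↦ z i) := fun i ↦
    (EuclideanSpace.proj (𝕜 := ℝ) i : Eu 2 →L[ℝ] ℝ).contMDiff
  have hφs : ContMDiffAt 𝓘(ℝ, Eu 2) 𝓘(ℝ, Eu n) ∞ φ 0 := by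
    have h1 : ContMDiffAt 𝓘(ℝ, Eu 2) 𝓘(ℝ, Eu k) ∞ (fun z : Eu 2 ↦ c (z 0)) 0 :=
      ContMDiffAt.comp (g := c) (0 : Eu 2) hc (hpr 0).contMDiffAt
    have h2 : ContMDiffAt 𝓘(ℝ, Eu 2) 𝓘(ℝ, Eu n) ∞ (fun z : Eu 2 ↦ γ (z 1)) 0 :=
      ContMDiffAt.comp (g := γ) (0 : Eu 2) hγ (hpr 1).contMDiffAt
    exact h1.smul h2
  have hφd : ∀ᶠ z in 𝓝 (0 : Eu 2), MDifferentiableAt 𝓘(ℝ, Eu 2) 𝓘(ℝ, Eu n) φ z := by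
    filter_upwards [(contMDiffAt_iff_contMDiffAt_nhds (n := 1) (by decide)).1
      (hφs.of_le one_le_infty)] with z hz
    exact hz.mdifferentiableAt (by simp)
  have hφ0 : φ 0 = γ 0 := by simp [hφ, hc0]
  set e : Fin 2 → Eu 2 := fun i ↦ EuclideanSpace.single i 1 with he
  have hline : ∀ i : Fin 2, ∀ᶠ t in 𝓝 (0 : ℝ),
      MDifferentiableAt 𝓘(ℝ, Eu 2) 𝓘(ℝ, Eu n) φ (0 + t • e i) := by
    intro i
    have hcont : ContinuousAt (fun t : ℝ ↦ (0 : Eu 2) + t • e i) 0 := by fun_prop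
    have : Tendsto (fun t : ℝ ↦ (0 : Eu 2) + t • e i) (𝓝 0) (𝓝 0) := by
      simpa [ContinuousAt] using hcont
    exact this.eventually hφd
  -- the two partial derivatives of `φ`, along the two axes
  have hd0 : ∀ᶠ t in 𝓝 (0 : ℝ), mfderiv 𝓘(ℝ, Eu 2) 𝓘(ℝ, Eu n) φ (0 + t • e 1)
      (constField 0 (0 + t • e 1)) = fundField n w (φ (0 + t • e 1)) := by
    filter_upwards [hline 1] with t ht
    obtain ⟨l1, l2⟩ := line_velocity (0 + t • e 1) (0 : Fin 2)
    have h1 := velocity_comp (F := φ) (by simp) ht l1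
    rw [l2] at h1
    refine Eq.trans h1.symm ?_
    have h2 : (fun s : ℝ ↦ φ (0 + t • e 1 + s • (EuclideanSpace.single 0 1 : Eu 2))) =
        fun s ↦ c s • γ t := by
      ext s; simp [hφ, he]
    rw [h2]
    have h3 := velocity_comp (F := fun a : G ↦ a • γ t) hc0
      ((contMDiff_orbit (n := n) (γ t)).contMDiffAt.mdifferentiableAt (by simp))
      (hc.mdifferentiableAt (by simp))
    rw [hcw] at h3
    exact h3.trans (fundField_apply w (by simp [hφ, he, hc0]))
  have hd1 : ∀ᶠ t in 𝓝 (0 : ℝ), g.val (φ (0 + t • e 0))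
      (mfderiv 𝓘(ℝ, Eu 2) 𝓘(ℝ, Eu n) φ (0 + t • e 0) (constField 1 (0 + t • e 0)))
      (mfderiv 𝓘(ℝ, Eu 2) 𝓘(ℝ, Eu n) φ (0 + t • e 0) (constField 1 (0 + t • e 0))) =
      g.val (γ 0) (velocity γ) (velocity γ) := by
    filter_upwards [hline 0] with t ht
    obtain ⟨l1, l2⟩ := line_velocity (0 + t • e 0) (1 : Fin 2)
    have h1 := velocity_comp (F := φ) (by simp) ht l1
    rw [l2] at h1
    have h2 : (fun s : ℝ ↦ φ (0 + t • e 0 + s • (EuclideanSpace.single 1 1 : Eu 2))) =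
        fun s ↦ c t • γ s := by
      ext s; simp [hφ, he]
    rw [h2] at h1
    have h3 := velocity_comp (F := fun y : M ↦ c t • y) rfl
      ((ContMDiffSMul.contMDiff_const_smul (I := 𝓘(ℝ, Eu k)) (I' := 𝓘(ℝ, Eu n)) (n := ∞)
        (c t)).contMDiffAt.mdifferentiableAt (by simp)) (hγ.mdifferentiableAt (by simp))
    have h4 : (mfderiv 𝓘(ℝ, Eu 2) 𝓘(ℝ, Eu n) φ (0 + t • e 0) (constField 1 (0 + t • e 0)) : Eu n) =
      (mfderiv 𝓘(ℝ, Eu n) 𝓘(ℝ, Eu n) (fun y : M ↦ c t • y) (γ 0) : Eu n →L[ℝ] Eu n)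
        (velocity γ) := h1.symm.trans h3
    rw [← hg (c t) (γ 0) (velocity γ) (velocity γ)]
    have h5 : φ (0 + t • e 0) = c t • γ 0 := by simp [hφ, he]
    have h6 : ∀ (y : M) (v v' : Eu n), y = c t • γ 0 → v = v' →
        g.val y v v = g.val (c t • γ 0) v' v' := by rintro y v v' rfl rfl; rfl
    exact h6 _ _ _ h5 h4
  have hE := fun i : Fin 2 ↦ smoothFieldAt_constField i (0 : Eu 2)
  have hV := fun i : Fin 2 ↦ (hE i).deriv_map hφs
  have hl := fun i : Fin 2 ↦ line_velocity (0 : Eu 2) i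
  have t1 := g.covDerivAlong_torsion hφs (hE 0) (hE 1)
  rw [mlieBracket_constField, map_zero, sub_eq_zero] at t1
  have t2 := g.mvfderiv_val (hV 1) (hV 1) (constField 0 0)
  rw [mvfderiv_congr_curve (g.smoothFun_val (hV 1) (hV 1)) (SmoothFun.const _ _) (hl 0).1 (by simp)
    (hl 0).2 hd1, t1, g.symm _ _ (g.covDerivAlong φ _ 0 _)] at t2
  have hfw : SmoothFieldAt (fundField n w) (φ 0) := smoothFieldAt_fundField w _
  rw [g.covDerivAlong_congr_curve (hV 0) (hfw.comp hφs) (hl 1).1 (by simp) (hl 1).2 hd0,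
    g.covDerivAlong_comp hfw hφs] at t2
  simp only [mvfderiv_const] at t2
  have t3 : (0 : ℝ) = _ := t2
  have t4 := (hl 1).2
  have t5 := hd1.self_of_nhds
  have h6 : ∀ (y : M) (v v' : Eu n), γ 0 = y → v' = v →
        g.val y (g.covDerivAlong (fun y : M ↦ y) (fundField n w) y v) v =
        g.val (γ 0) (g.covDerivAlong (fun y : M ↦ y) (fundField n w) (γ 0) v') v' := by
    rintro y v v' rfl rfl; rfl
  have h7 : velocity γ = (mfderiv 𝓘(ℝ, Eu 2) 𝓘(ℝ, Eu n) φ 0 (constField 1 0) : Eu n) := by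
    have h1 := velocity_comp (F := φ) (by simp) hφd.self_of_nhds (hl 1).1
    rw [(hl 1).2] at h1
    refine Eq.trans ?_ h1
    congr 1
    ext s
    simp [hφ, hc0]
  have h8 := h6 _ _ _ hφ0.symm h7
  linarith

end Killing

/-! ### Killing fields -/

section KillingFields
variable {n : ℕ}
  {M : Type*} [TopologicalSpace M] [ChartedSpace (Eu n) M] [IsManifold 𝓘(ℝ, Eu n) ∞ M]

/-- `X` is a smooth vector field on the whole manifold. -/
def SmoothField (X : (x : M) → Tan n x) : Prop := ∀ x, SmoothFieldAt X x

lemma SmoothField.near {X : (x : M) → Tan n x} (hX : SmoothField X) (x : M) :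
    SmoothFieldNear X x := Eventually.of_forall hX

lemma smoothField_of_near {X : (x : M) → Tan n x} (hX : ∀ x, SmoothFieldNear X x) :
    SmoothField X := fun x ↦ (hX x).at

lemma SmoothField.mlieBracket {X Y : (x : M) → Tan n x} (hX : SmoothField X) (hY : SmoothField Y) :
    SmoothField (mlieBracket 𝓘(ℝ, Eu n) X Y) := fun x ↦ SmoothFieldAt.mlieBracket (hX x) (hY x)

lemma SmoothField.nabla (g : PseudoRiemannianMetric n M) {X Y : (x : M) → Tan n x}
    (hX : SmoothField X) (hY : SmoothField Y) : SmoothField (g.nabla X Y) :=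
  smoothField_of_near fun x ↦ (hX.near x).nabla g (hY.near x)

lemma mlieBracket_jacobi {X Y Z : (x : M) → Tan n x} {x : M} (hX : SmoothFieldAt X x)
    (hY : SmoothFieldAt Y x) (hZ : SmoothFieldAt Z x) :
    mlieBracket 𝓘(ℝ, Eu n) X (mlieBracket 𝓘(ℝ, Eu n) Y Z) x =
      mlieBracket 𝓘(ℝ, Eu n) (mlieBracket 𝓘(ℝ, Eu n) X Y) Z x +
      mlieBracket 𝓘(ℝ, Eu n) Y (mlieBracket 𝓘(ℝ, Eu n) X Z) x := by
  have : IsManifold 𝓘(ℝ, Eu n) (minSmoothness ℝ 3) M := by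
    rw [minSmoothness_of_isRCLikeNormedField]
    exact IsManifold.of_le (n := ∞) three_le_infty
  have h : minSmoothness ℝ 2 ≤ ∞ := by
    rw [minSmoothness_of_isRCLikeNormedField]
    exact two_le_infty
  exact leibniz_identity_mlieBracket_apply (ContMDiffAt.of_le hX h) (ContMDiffAt.of_le hY h)
    (ContMDiffAt.of_le hZ h)

namespace PseudoRiemannianMetric
variable (g : PseudoRiemannianMetric n M)

lemma nabla_add {X Y Z : (x : M) → Tan n x} {x : M} (hY : SmoothFieldAt Y x)
    (hZ : SmoothFieldAt Z x) : g.nabla X (Y + Z) x = g.nabla X Y x + g.nabla X Z x :=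
  g.covDerivAlong_add hY hZ _

lemma nabla_add_left (X Y Z : (x : M) → Tan n x) (x : M) :
    g.nabla (X + Y) Z x = g.nabla X Z x + g.nabla Y Z x :=
  g.covDerivAlong_add_dir _ _

lemma val_ext {x : M} {u v : Tan n x} (h : ∀ w, g.val x u w = g.val x v w) : u = v := by
  rw [← sub_eq_zero]
  refine g.nondegenerate x _ fun w ↦ ?_
  rw [map_sub, sub_apply, h, sub_self]

/-- A Killing field: a smooth field with skew-symmetric covariant derivative. Skewness is expressed
by the vanishing of the associated quadratic form. -/
structure IsKilling (K : (x : M) → Tan n x) : Prop where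
  smooth : SmoothField K
  skew (x : M) (u : Tan n x) : g.val x (g.covDerivAlong (fun y : M ↦ y) K x u) u = 0

/-- The endomorphism `A_K : v ↦ ∇_v K` of the tangent space at `x`. -/
def covDeriv (K : (x : M) → Tan n x) (x : M) : Tan n x →ₗ[ℝ] Tan n x :=
  g.covDerivL (m := n) (fun y : M ↦ y) K x

lemma nabla_eq_covDeriv (K X : (x : M) → Tan n x) (x : M) :
    g.nabla X K x = g.covDeriv K x (X x) := rfl

variable {g}

namespace IsKilling
variable {K : (x : M) → Tan n x} (hK : g.IsKilling K)
include hK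

lemma val_covDeriv (x : M) (u v : Tan n x) :
    g.val x (g.covDeriv K x u) v = -g.val x u (g.covDeriv K x v) := by
  have h : ∀ u, g.val x (g.covDeriv K x u) u = 0 := hK.skew x
  have h1 := h (u + v)
  simp only [map_add, add_apply, h, zero_add, add_zero] at h1
  rw [g.symm x u]
  linarith

/-- The Killing equation `L_K g = 0`. -/
lemma mvfderiv_val {Y Z : (x : M) → Tan n x} {x : M} (hY : SmoothFieldAt Y x)
    (hZ : SmoothFieldAt Z x) :
    mvfderiv 𝓘(ℝ, Eu n) (fun y ↦ g.val y (Y y) (Z y)) x (K x) =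
      g.val x (mlieBracket 𝓘(ℝ, Eu n) K Y x) (Z x) +
      g.val x (Y x) (mlieBracket 𝓘(ℝ, Eu n) K Z x) := by
  have h := g.mvfderiv_val hY hZ (K x)
  have h1 := hK.val_covDeriv x (Y x) (Z x)
  rw [← g.nabla_sub_nabla (hK.smooth x) hY, ← g.nabla_sub_nabla (hK.smooth x) hZ,
    g.nabla_eq_covDeriv K, g.nabla_eq_covDeriv K]
  simp only [map_sub, sub_apply]
  rw [h1]
  refine h.trans ?_
  simp only [nabla]
  ring

/-- The flow of a Killing field preserves the Levi-Civita connection, `L_K ∇ = 0`: after lowering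
an index, the difference of the two sides is symmetric in its first two arguments, as `∇` has no
torsion, and skew in its last two, as `∇` and `L_K` preserve the metric. -/
theorem mlieBracket_nabla {Y Z : (x : M) → Tan n x} {x : M} (hY : SmoothFieldNear Y x)
    (hZ : SmoothFieldNear Z x) :
    mlieBracket 𝓘(ℝ, Eu n) K (g.nabla Y Z) x =
      g.nabla (mlieBracket 𝓘(ℝ, Eu n) K Y) Z x + g.nabla Y (mlieBracket 𝓘(ℝ, Eu n) K Z) x := by
  set B : (Y Z : (x : M) → Tan n x) → Tan n x := fun Y Z ↦
    mlieBracket 𝓘(ℝ, Eu n) K (g.nabla Y Z) x -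
      g.nabla (mlieBracket 𝓘(ℝ, Eu n) K Y) Z x - g.nabla Y (mlieBracket 𝓘(ℝ, Eu n) K Z) x with hB
  have hKn := hK.smooth.near x
  -- `L_K ∇` is symmetric, since `∇` has no torsion
  have hsymm : ∀ {Y Z : (x : M) → Tan n x}, SmoothFieldNear Y x → SmoothFieldNear Z x →
      B Y Z = B Z Y := by
    intro Y Z hY hZ
    have e : g.nabla Y Z =ᶠ[𝓝 x] g.nabla Z Y + mlieBracket 𝓘(ℝ, Eu n) Y Z := by
      filter_upwards [hY, hZ] with y h1 h2
      rw [Pi.add_apply, ← g.nabla_sub_nabla h1 h2]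
      abel
    have h1 : mlieBracket 𝓘(ℝ, Eu n) K (g.nabla Y Z) x = mlieBracket 𝓘(ℝ, Eu n) K (g.nabla Z Y) x +
        mlieBracket 𝓘(ℝ, Eu n) K (mlieBracket 𝓘(ℝ, Eu n) Y Z) x := by
      rw [(EventuallyEq.refl _ K).mlieBracket_vectorField_eq e]
      exact mlieBracket_add_right (hZ.nabla g hY).at.mdifferentiableAt
        (SmoothNear.mlieBracket hY hZ).at.mdifferentiableAt
    have h2 := mlieBracket_jacobi hKn.at hY.at hZ.at
    have h3 := g.nabla_sub_nabla (SmoothNear.mlieBracket hKn hY).at hZ.at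
    have h4 := g.nabla_sub_nabla hY.at (SmoothNear.mlieBracket hKn hZ).at
    simp only [hB]
    rw [h1, h2, ← h3, ← h4]
    abel
  -- `L_K ∇` is skew-symmetric, since `L_K g = 0` and `∇ g = 0`
  have hskew : ∀ {Y Z V : (x : M) → Tan n x}, SmoothFieldNear Y x → SmoothFieldNear Z x →
      SmoothFieldNear V x → g.val x (B Y Z) (V x) = -g.val x (B Y V) (Z x) := by
    intro Y Z V hY hZ hV
    have hf : SmoothFun n (fun y ↦ g.val y (Z y) (V y)) x := g.smoothFun_val hZ.at hV.at
    have e1 : (fun y ↦ mvfderiv 𝓘(ℝ, Eu n) (fun y ↦ g.val y (Z y) (V y)) y (Y y)) =ᶠ[𝓝 x]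
        fun y ↦ g.val y (g.nabla Y Z y) (V y) + g.val y (Z y) (g.nabla Y V y) := by
      filter_upwards [hZ, hV] with y h1 h2 using g.mvfderiv_val h1 h2 (Y y)
    have e2 : (fun y ↦ mvfderiv 𝓘(ℝ, Eu n) (fun y ↦ g.val y (Z y) (V y)) y (K y)) =ᶠ[𝓝 x]
        fun y ↦ g.val y (mlieBracket 𝓘(ℝ, Eu n) K Z y) (V y) +
          g.val y (Z y) (mlieBracket 𝓘(ℝ, Eu n) K V y) := by
      filter_upwards [hZ, hV] with y h1 h2 using hK.mvfderiv_val h1 h2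
    have h := mvfderiv_bracket hf hKn.at hY.at
    have a1 := (hY.nabla g hZ).at
    have a2 := (hY.nabla g hV).at
    have a3 := (SmoothNear.mlieBracket hKn hZ).at
    have a4 := (SmoothNear.mlieBracket hKn hV).at
    rw [mvfderiv_congr e1, mvfderiv_congr e2,
      mvfderiv_fun_add (g.smoothFun_val a1 hV.at).mdifferentiableAt
        (g.smoothFun_val hZ.at a2).mdifferentiableAt,
      mvfderiv_fun_add (g.smoothFun_val a3 hV.at).mdifferentiableAt
        (g.smoothFun_val hZ.at a4).mdifferentiableAt, add_apply, add_apply,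
      hK.mvfderiv_val a1 hV.at, hK.mvfderiv_val hZ.at a2] at h
    have b1 := g.mvfderiv_val hZ.at hV.at (mlieBracket 𝓘(ℝ, Eu n) K Y x)
    have b2 := g.mvfderiv_val a3 hV.at (Y x)
    have b3 := g.mvfderiv_val hZ.at a4 (Y x)
    have b := (b1.symm.trans h).trans (congrArg (fun r ↦ _ - r) (congrArg₂ (· + ·) b2 b3))
    simp only [hB, map_sub, sub_apply]
    rw [g.symm x _ (Z x), g.symm x _ (Z x), g.symm x _ (Z x)]
    simp only [nabla] at b ⊢
    linarith
  have h0 : B Y Z = 0 := by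
    refine g.nondegenerate x _ fun v ↦ ?_
    obtain ⟨V, hV, rfl⟩ := exists_smoothFieldOn x v
    have hV := hV.near (chartAt (Eu n) x).open_source (mem_chart_source (Eu n) x)
    have h1 := hskew hY hZ hV
    have h2 := hskew hV hY hZ
    have h3 := hskew hZ hV hY
    rw [hsymm hY hV] at h1
    rw [hsymm hV hZ] at h2
    rw [hsymm hZ hY] at h3
    linarith
  rw [hB] at h0
  simp only [sub_sub, sub_eq_zero] at h0
  exact h0

lemma mlieBracket_nabla_field {Y Z : (x : M) → Tan n x} (hY : SmoothField Y) (hZ : SmoothField Z) :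
    mlieBracket 𝓘(ℝ, Eu n) K (g.nabla Y Z) =
      g.nabla (mlieBracket 𝓘(ℝ, Eu n) K Y) Z + g.nabla Y (mlieBracket 𝓘(ℝ, Eu n) K Z) :=
  funext fun x ↦ hK.mlieBracket_nabla (hY.near x) (hZ.near x)

lemma nabla_eq {Z : (x : M) → Tan n x} (hZ : SmoothField Z) :
    g.nabla K Z = mlieBracket 𝓘(ℝ, Eu n) K Z + g.nabla Z K := by
  funext x
  rw [Pi.add_apply, ← g.nabla_sub_nabla (hK.smooth x) (hZ x), sub_add_cancel]

/-- The curvature in terms of the covariant derivatives of Killing fields,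
`R(K, L) = [A_K, A_L] + A_[K,L]`. -/
theorem riem_apply {L : (x : M) → Tan n x} (hL : g.IsKilling L) {Z : (x : M) → Tan n x}
    (hZ : SmoothField Z) (x : M) :
    g.riem x (K x) (L x) (Z x) = g.covDeriv K x (g.covDeriv L x (Z x)) -
      g.covDeriv L x (g.covDeriv K x (Z x)) +
      g.covDeriv (mlieBracket 𝓘(ℝ, Eu n) K L) x (Z x) := by
  have hKs := hK.smooth
  have hLs := hL.smooth
  rw [← g.curvature_eq_riem (hKs.near x) (hLs.near x) (hZ.near x), curvature]
  have h1 : g.nabla K (g.nabla L Z) x =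
      g.nabla (mlieBracket 𝓘(ℝ, Eu n) K L) Z x + g.nabla L (mlieBracket 𝓘(ℝ, Eu n) K Z) x +
      g.covDeriv K x (g.nabla L Z x) := by
    rw [hK.nabla_eq (hLs.nabla g hZ), hK.mlieBracket_nabla_field hLs hZ]
    rfl
  have h2 : g.nabla L (g.nabla K Z) x = g.nabla L (mlieBracket 𝓘(ℝ, Eu n) K Z) x +
      (g.covDeriv K x (mlieBracket 𝓘(ℝ, Eu n) L Z x) +
      g.covDeriv (mlieBracket 𝓘(ℝ, Eu n) L K) x (Z x) + g.covDeriv L x (g.covDeriv K x (Z x))) := by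
    rw [hK.nabla_eq hZ, g.nabla_add ((hKs.mlieBracket hZ) x) ((hZ.nabla g hKs) x),
      hL.nabla_eq (hZ.nabla g hKs), hL.mlieBracket_nabla_field hZ hKs]
    rfl
  have h3 : g.nabla L Z x = mlieBracket 𝓘(ℝ, Eu n) L Z x + g.covDeriv L x (Z x) := by
    rw [hL.nabla_eq hZ]; rfl
  have h4 : g.covDeriv (mlieBracket 𝓘(ℝ, Eu n) L K) x (Z x) =
      -g.covDeriv (mlieBracket 𝓘(ℝ, Eu n) K L) x (Z x) := by
    have e : mlieBracket 𝓘(ℝ, Eu n) L K = fun y ↦ (-1 : ℝ) • mlieBracket 𝓘(ℝ, Eu n) K L y := by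
      funext y
      rw [mlieBracket_swap_apply]; simp
    have := g.covDerivAlong_smul (SmoothFun.const (-1) x) ((hKs.mlieBracket hLs) x) (Z x)
    rw [e]
    refine this.trans ?_
    simp [mvfderiv_const]
    rfl
  rw [h1, h2, h3, h4, map_add]
  abel

/-- The flow of a Killing field preserves the curvature, `L_K R = 0`. -/
theorem mlieBracket_curvature {X Y Z : (x : M) → Tan n x} (hX : SmoothField X)
    (hY : SmoothField Y) (hZ : SmoothField Z) (x : M) :
    mlieBracket 𝓘(ℝ, Eu n) K (g.curvature X Y Z) x =
      g.curvature (mlieBracket 𝓘(ℝ, Eu n) K X) Y Z x +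
      g.curvature X (mlieBracket 𝓘(ℝ, Eu n) K Y) Z x +
      g.curvature X Y (mlieBracket 𝓘(ℝ, Eu n) K Z) x := by
  have hKs := hK.smooth
  have hXY := hX.mlieBracket hY
  have hKX := hKs.mlieBracket hX
  have hKY := hKs.mlieBracket hY
  have hKZ := hKs.mlieBracket hZ
  have e : g.curvature X Y Z = g.nabla X (g.nabla Y Z) + ((-1 : ℝ) • g.nabla Y (g.nabla X Z) +
      (-1 : ℝ) • g.nabla (mlieBracket 𝓘(ℝ, Eu n) X Y) Z) := by
    funext y
    simp [curvature]
    abel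
  have s1 := hX.nabla g (hY.nabla g hZ)
  have s2 := hY.nabla g (hX.nabla g hZ)
  have s3 := hXY.nabla g hZ
  have c : ∀ {U : (x : M) → Tan n x}, SmoothField U → SmoothField ((-1 : ℝ) • U) := fun hU y ↦
    SmoothAlongAt.smul (SmoothFun.const (-1) y) (hU y)
  have s4 : SmoothField ((-1 : ℝ) • g.nabla Y (g.nabla X Z) +
      (-1 : ℝ) • g.nabla (mlieBracket 𝓘(ℝ, Eu n) X Y) Z) := fun y ↦
    SmoothAlongAt.add (c s2 y) (c s3 y)
  have j : mlieBracket 𝓘(ℝ, Eu n) K (mlieBracket 𝓘(ℝ, Eu n) X Y) =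
      mlieBracket 𝓘(ℝ, Eu n) (mlieBracket 𝓘(ℝ, Eu n) K X) Y +
      mlieBracket 𝓘(ℝ, Eu n) X (mlieBracket 𝓘(ℝ, Eu n) K Y) :=
    funext fun y ↦ mlieBracket_jacobi (hKs y) (hX y) (hY y)
  rw [e, mlieBracket_add_right (s1 x).mdifferentiableAt
      (s4 x).mdifferentiableAt,
    mlieBracket_add_right (c s2 x).mdifferentiableAt (c s3 x).mdifferentiableAt,
    mlieBracket_const_smul_right (s2 x).mdifferentiableAt,
    mlieBracket_const_smul_right (s3 x).mdifferentiableAt,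
    hK.mlieBracket_nabla_field hX (hY.nabla g hZ), hK.mlieBracket_nabla_field hY (hX.nabla g hZ),
    hK.mlieBracket_nabla_field hXY hZ, hK.mlieBracket_nabla_field hX hZ, hK.mlieBracket_nabla_field
      hY hZ, j]
  simp only [Pi.add_apply, g.nabla_add_left]
  rw [g.nabla_add ((hKY.nabla g hZ) x) ((hY.nabla g hKZ) x),
    g.nabla_add ((hKX.nabla g hZ) x) ((hX.nabla g hKZ) x)]
  simp only [curvature]
  module

/-- The covariant derivative of the curvature in the direction of a Killing field is the derivation
`A_K` applied to the curvature, since `∇_K = L_K + A_K` and `L_K R = 0`. -/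
theorem nablaRiem_apply {X Y Z : (x : M) → Tan n x} (hX : SmoothField X)
    (hY : SmoothField Y) (hZ : SmoothField Z) (x : M) :
    g.nablaRiem x (K x) (X x) (Y x) (Z x) =
      g.covDeriv K x (g.riem x (X x) (Y x) (Z x)) - g.riem x (g.covDeriv K x (X x)) (Y x) (Z x) -
      g.riem x (X x) (g.covDeriv K x (Y x)) (Z x) -
      g.riem x (X x) (Y x) (g.covDeriv K x (Z x)) := by
  have hKs := hK.smooth
  have hR : SmoothField (g.curvature X Y Z) := smoothField_of_near fun x ↦
    g.smoothFieldNear_curvature (hX.near x) (hY.near x) (hZ.near x)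
  rw [← g.nablaCurvature_eq_nablaRiem (hKs.near x) (hX.near x) (hY.near x) (hZ.near x),
    nablaCurvature,
    g.curvature_eq_riem ((hKs.nabla g hX).near x) (hY.near x) (hZ.near x),
    g.curvature_eq_riem (hX.near x) ((hKs.nabla g hY).near x) (hZ.near x),
    g.curvature_eq_riem (hX.near x) (hY.near x) ((hKs.nabla g hZ).near x),
    hK.nabla_eq hR, hK.nabla_eq hX, hK.nabla_eq hY, hK.nabla_eq hZ]
  simp only [Pi.add_apply, map_add, LinearMap.add_apply]
  rw [hK.mlieBracket_curvature hX hY hZ,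
    g.curvature_eq_riem ((hKs.mlieBracket hX).near x) (hY.near x) (hZ.near x),
    g.curvature_eq_riem (hX.near x) ((hKs.mlieBracket hY).near x) (hZ.near x),
    g.curvature_eq_riem (hX.near x) (hY.near x) ((hKs.mlieBracket hZ).near x)]
  simp only [nabla_eq_covDeriv, g.curvature_eq_riem (hX.near x) (hY.near x) (hZ.near x)]
  abel

end IsKilling

end PseudoRiemannianMetric
end KillingFields

/-! ### The Koszul formula for Killing fields -/

section KillingKoszul

namespace PseudoRiemannianMetric
variable {n : ℕ}
  {M : Type*} [TopologicalSpace M] [ChartedSpace (Eu n) M] [IsManifold 𝓘(ℝ, Eu n) ∞ M]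
  {g : PseudoRiemannianMetric n M}

lemma riem_swap (x : M) (u v w : Tan n x) : g.riem x u v w = -g.riem x v u w := by
  have hx := mem_chart_source (Eu n) x
  have ho := (chartAt (Eu n) x).open_source
  obtain ⟨X, hX, rfl⟩ := exists_smoothFieldOn x u
  obtain ⟨Y, hY, rfl⟩ := exists_smoothFieldOn x v
  obtain ⟨Z, hZ, rfl⟩ := exists_smoothFieldOn x w
  have hX := hX.near ho hx
  have hY := hY.near ho hx
  have hZ := hZ.near ho hx
  rw [← g.curvature_eq_riem hX hY hZ, ← g.curvature_eq_riem hY hX hZ, curvature, curvature,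
    g.nabla_eq_covDeriv Z (mlieBracket 𝓘(ℝ, Eu n) X Y),
    g.nabla_eq_covDeriv Z (mlieBracket 𝓘(ℝ, Eu n) Y X), mlieBracket_swap_apply, map_neg]
  abel

lemma covDeriv_smul (c : ℝ) {K : (x : M) → Tan n x} {x : M} (hK : SmoothFieldAt K x) :
    g.covDeriv (c • K) x = c • g.covDeriv K x := by
  ext1 v
  have := g.covDerivAlong_smul (SmoothFun.const c x) hK v
  refine this.trans ?_
  simp [mvfderiv_const]
  rfl

lemma covDeriv_zero (x : M) : g.covDeriv 0 x = 0 := by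
  ext1 v
  exact g.covDerivAlong_zero (contMDiff_id.contMDiffAt) v

/-- The Koszul formula for Killing fields, in which the Killing equation turns all derivatives of
scalar products into brackets. -/
lemma IsKilling.koszul {X Y Z : (x : M) → Tan n x} (hX : g.IsKilling X) (hY : g.IsKilling Y)
    (hZ : g.IsKilling Z) (x : M) : 2 * g.val x (g.covDeriv Y x (X x)) (Z x) =
      g.val x (mlieBracket 𝓘(ℝ, Eu n) X Y x) (Z x) +
      g.val x (mlieBracket 𝓘(ℝ, Eu n) X Z x) (Y x) +
      g.val x (mlieBracket 𝓘(ℝ, Eu n) Y Z x) (X x) := by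
  have h := g.nabla_koszul (hX.smooth x) (hY.smooth x) (hZ.smooth x)
  rw [hX.mvfderiv_val (hY.smooth x) (hZ.smooth x), hY.mvfderiv_val (hX.smooth x) (hZ.smooth x),
    hZ.mvfderiv_val (hX.smooth x) (hY.smooth x), mlieBracket_swap_apply (V := Y) (W := X),
    mlieBracket_swap_apply (V := Z) (W := X), mlieBracket_swap_apply (V := Z) (W := Y),
    g.nabla_eq_covDeriv] at h
  simp only [map_neg, neg_apply, g.symm x (Y x) (mlieBracket 𝓘(ℝ, Eu n) X Z x),
    g.symm x (X x) (mlieBracket 𝓘(ℝ, Eu n) Y Z x)] at h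
  linarith

end PseudoRiemannianMetric
end KillingKoszul

/-! ### Adapted frames of Killing fields -/

section Frame

open PseudoRiemannianMetric

variable {M : Type*} [TopologicalSpace M] [ChartedSpace (Eu 4) M] [IsManifold 𝓘(ℝ, Eu 4) ∞ M]

/-- Killing fields on a four-manifold adapted at the point `x` to an isometric action of type A1.
The fields `k₁, …, k₄` correspond to the basis elements `e₁, …, e₄`, and `τ` to `½ e₁ + e₅ + s e₄`
for some `s`; the brackets are opposite to those of the Lie algebra. The generator `k₃ + k₄` of the
isotropy algebra vanishes at `x`, where the other fields span the tangent space. The multiple of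
`e₁` in `τ` makes `τ` commute with `k₁` and act on the isotropy algebra by a scalar. -/
structure IsA1Frame (g : PseudoRiemannianMetric 4 M) (x : M)
    (k₁ k₂ k₃ k₄ τ : (y : M) → Tan 4 y) : Prop where
  killing₁ : g.IsKilling k₁
  killing₂ : g.IsKilling k₂
  killing₃ : g.IsKilling k₃
  killing₄ : g.IsKilling k₄
  killingτ : g.IsKilling τ
  b₁₂ : mlieBracket 𝓘(ℝ, Eu 4) k₁ k₂ = (-2 : ℝ) • k₂
  b₁₃ : mlieBracket 𝓘(ℝ, Eu 4) k₁ k₃ = (2 : ℝ) • k₃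
  b₂₃ : mlieBracket 𝓘(ℝ, Eu 4) k₂ k₃ = (-1 : ℝ) • k₁
  b₁₄ : mlieBracket 𝓘(ℝ, Eu 4) k₁ k₄ = 0
  b₂₄ : mlieBracket 𝓘(ℝ, Eu 4) k₂ k₄ = 0
  b₃₄ : mlieBracket 𝓘(ℝ, Eu 4) k₃ k₄ = 0
  b₁τ : mlieBracket 𝓘(ℝ, Eu 4) k₁ τ = 0
  b₂τ : mlieBracket 𝓘(ℝ, Eu 4) k₂ τ = (1 : ℝ) • k₂
  b₃τ : mlieBracket 𝓘(ℝ, Eu 4) k₃ τ = (-1 : ℝ) • k₃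
  b₄τ : mlieBracket 𝓘(ℝ, Eu 4) k₄ τ = (-1 : ℝ) • k₄
  isotropy : k₄ x = -k₃ x
  span (v : Tan 4 x) : ∃ p q r s : ℝ, v = p • k₁ x + q • k₂ x + r • k₃ x + s • τ x

namespace IsA1Frame
variable {g : PseudoRiemannianMetric 4 M} {x : M} {k₁ k₂ k₃ k₄ τ : (y : M) → Tan 4 y}
  (F : IsA1Frame g x k₁ k₂ k₃ k₄ τ)
include F

/-- The isotropy representation, induced by the bracket with `k₃ + k₄`, is skew-symmetric. -/
lemma val_isotropy {U V : (y : M) → Tan 4 y} (hU : SmoothField U) (hV : SmoothField V) :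
    g.val x (mlieBracket 𝓘(ℝ, Eu 4) k₃ U x + mlieBracket 𝓘(ℝ, Eu 4) k₄ U x) (V x) +
      g.val x (U x) (mlieBracket 𝓘(ℝ, Eu 4) k₃ V x + mlieBracket 𝓘(ℝ, Eu 4) k₄ V x) = 0 := by
  have h3 := F.killing₃.mvfderiv_val (hU x) (hV x)
  have h4 := F.killing₄.mvfderiv_val (hU x) (hV x)
  rw [F.isotropy, map_neg] at h4
  simp only [map_add, add_apply]
  linarith

/-- Invariance under the isotropy representation determines the metric at `x` up to the four
constants `⟨k₁, k₁⟩`, `⟨k₂, k₂⟩`, `⟨k₂, τ⟩` and `⟨τ, τ⟩`. -/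
lemma gram : g.val x (k₁ x) (k₂ x) = 0 ∧ g.val x (k₁ x) (k₃ x) = 0 ∧
    g.val x (k₂ x) (k₃ x) = g.val x (k₁ x) (k₁ x) / 2 ∧ g.val x (k₃ x) (k₃ x) = 0 ∧
    g.val x (k₁ x) (τ x) = 0 ∧ g.val x (k₃ x) (τ x) = 0 := by
  have s1 := F.killing₁.smooth
  have s2 := F.killing₂.smooth
  have s3 := F.killing₃.smooth
  have sτ := F.killingτ.smooth
  have c31 : mlieBracket 𝓘(ℝ, Eu 4) k₃ k₁ x = (-2 : ℝ) • k₃ x := by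
    rw [mlieBracket_swap_apply, F.b₁₃]; simp
  have c41 : mlieBracket 𝓘(ℝ, Eu 4) k₄ k₁ x = 0 := by
    rw [mlieBracket_swap_apply, F.b₁₄]; simp
  have c32 : mlieBracket 𝓘(ℝ, Eu 4) k₃ k₂ x = k₁ x := by
    rw [mlieBracket_swap_apply, F.b₂₃]; simp
  have c42 : mlieBracket 𝓘(ℝ, Eu 4) k₄ k₂ x = 0 := by
    rw [mlieBracket_swap_apply, F.b₂₄]; simp
  have c33 : mlieBracket 𝓘(ℝ, Eu 4) k₃ k₃ x = 0 := by simp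
  have c43 : mlieBracket 𝓘(ℝ, Eu 4) k₄ k₃ x = 0 := by
    rw [mlieBracket_swap_apply, F.b₃₄]; simp
  have c3τ : mlieBracket 𝓘(ℝ, Eu 4) k₃ τ x = (-1 : ℝ) • k₃ x := by rw [F.b₃τ]; rfl
  have c4τ : mlieBracket 𝓘(ℝ, Eu 4) k₄ τ x = k₃ x := by rw [F.b₄τ]; simp [F.isotropy]
  have h11 := F.val_isotropy s1 s1
  have h12 := F.val_isotropy s1 s2
  have h13 := F.val_isotropy s1 s3
  have h22 := F.val_isotropy s2 s2
  have h1τ := F.val_isotropy s1 sτ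
  have h2τ := F.val_isotropy s2 sτ
  simp only [c31, c41, c32, c42, c33, c43, c3τ, c4τ, map_add, map_smul, smul_apply,
    map_zero, smul_eq_mul, add_zero] at h11 h12 h13 h22 h1τ h2τ
  have y21 := g.symm x (k₂ x) (k₁ x)
  have y31 := g.symm x (k₃ x) (k₁ x)
  have y32 := g.symm x (k₃ x) (k₂ x)
  refine ⟨?_, ?_, ?_, ?_, ?_, ?_⟩ <;> linarith

lemma ext {u v : Tan 4 x} (h1 : g.val x u (k₁ x) = g.val x v (k₁ x))
    (h2 : g.val x u (k₂ x) = g.val x v (k₂ x)) (h3 : g.val x u (k₃ x) = g.val x v (k₃ x))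
    (h4 : g.val x u (τ x) = g.val x v (τ x)) : u = v := by
  refine g.val_ext fun w ↦ ?_
  obtain ⟨p, q, r, s, rfl⟩ := F.span w
  simp only [map_add, map_smul, h1, h2, h3, h4]

lemma dims : FiniteDimensional ℝ (Tan 4 x) ∧ Module.finrank ℝ (Tan 4 x) = 4 :=
  ⟨inferInstanceAs (FiniteDimensional ℝ (Eu 4)), finrank_euclideanSpace_fin (𝕜 := ℝ) (n := 4)⟩

lemma linearIndependent : LinearIndependent ℝ ![k₁ x, k₂ x, k₃ x, τ x] := by
  obtain ⟨hfd, hdim⟩ := F.dims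
  refine linearIndependent_of_top_le_span_of_card_eq_finrank (fun v _ ↦ ?_) (by simp [hdim])
  obtain ⟨p, q, r, s, rfl⟩ := F.span v
  refine add_mem (add_mem (add_mem ?_ ?_) ?_) ?_
  · exact Submodule.smul_mem _ _ (Submodule.subset_span ⟨0, rfl⟩)
  · exact Submodule.smul_mem _ _ (Submodule.subset_span ⟨1, rfl⟩)
  · exact Submodule.smul_mem _ _ (Submodule.subset_span ⟨2, rfl⟩)
  · exact Submodule.smul_mem _ _ (Submodule.subset_span ⟨3, rfl⟩)

lemma k₃_ne_zero : k₃ x ≠ 0 := F.linearIndependent.ne_zero 2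

lemma τ_ne_zero : τ x ≠ 0 := F.linearIndependent.ne_zero 3

/-- The constant `a = ⟨k₁, k₁⟩` does not vanish. -/
lemma a_ne_zero : g.val x (k₁ x) (k₁ x) ≠ 0 := by
  intro h0
  obtain ⟨h12, h13, h23, h33, h1τ, h3τ⟩ := F.gram
  refine F.k₃_ne_zero (F.ext ?_ ?_ ?_ ?_)
  · rw [g.symm, h13, map_zero, zero_apply]
  · rw [g.symm, h23, h0, map_zero, zero_apply, zero_div]
  · rw [h33, map_zero, zero_apply]
  · rw [h3τ, map_zero, zero_apply]

lemma t_ne_zero (h2τ : g.val x (k₂ x) (τ x) = 0) : g.val x (τ x) (τ x) ≠ 0 := by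
  intro h0
  obtain ⟨h12, h13, h23, h33, h1τ, h3τ⟩ := F.gram
  refine F.τ_ne_zero (F.ext ?_ ?_ ?_ ?_)
  · rw [g.symm, h1τ, map_zero, zero_apply]
  · rw [g.symm, h2τ, map_zero, zero_apply]
  · rw [g.symm, h3τ, map_zero, zero_apply]
  · rw [h0, map_zero, zero_apply]

/-! ### The covariant derivatives of the frame fields -/

variable {β γ : ℝ}

lemma gram_symm (h2τ : g.val x (k₂ x) (τ x) = 0) :
    g.val x (k₂ x) (k₁ x) = 0 ∧ g.val x (k₃ x) (k₁ x) = 0 ∧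
    g.val x (k₃ x) (k₂ x) = g.val x (k₁ x) (k₁ x) / 2 ∧
    g.val x (τ x) (k₁ x) = 0 ∧ g.val x (τ x) (k₂ x) = 0 ∧ g.val x (τ x) (k₃ x) = 0 := by
  obtain ⟨h12, h13, h23, h33, h1τ, h3τ⟩ := F.gram
  exact ⟨(g.symm _ _ _).trans h12, (g.symm _ _ _).trans h13, (g.symm _ _ _).trans h23,
    (g.symm _ _ _).trans h1τ, (g.symm _ _ _).trans h2τ, (g.symm _ _ _).trans h3τ⟩

lemma brackets :
    mlieBracket 𝓘(ℝ, Eu 4) k₁ k₂ x = (-2 : ℝ) • k₂ x ∧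
    mlieBracket 𝓘(ℝ, Eu 4) k₁ k₃ x = (2 : ℝ) • k₃ x ∧
    mlieBracket 𝓘(ℝ, Eu 4) k₁ τ x = 0 ∧
    mlieBracket 𝓘(ℝ, Eu 4) k₂ k₁ x = (2 : ℝ) • k₂ x ∧
    mlieBracket 𝓘(ℝ, Eu 4) k₂ k₃ x = (-1 : ℝ) • k₁ x ∧
    mlieBracket 𝓘(ℝ, Eu 4) k₂ τ x = (1 : ℝ) • k₂ x ∧
    mlieBracket 𝓘(ℝ, Eu 4) k₃ k₁ x = (-2 : ℝ) • k₃ x ∧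
    mlieBracket 𝓘(ℝ, Eu 4) k₃ k₂ x = (1 : ℝ) • k₁ x ∧
    mlieBracket 𝓘(ℝ, Eu 4) k₃ τ x = (-1 : ℝ) • k₃ x ∧
    mlieBracket 𝓘(ℝ, Eu 4) τ k₁ x = 0 ∧
    mlieBracket 𝓘(ℝ, Eu 4) τ k₂ x = (-1 : ℝ) • k₂ x ∧
    mlieBracket 𝓘(ℝ, Eu 4) τ k₃ x = (1 : ℝ) • k₃ x := by
  rw [mlieBracket_swap_apply (V := k₂) (W := k₁), mlieBracket_swap_apply (V := k₃) (W := k₁),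
    mlieBracket_swap_apply (V := k₃) (W := k₂), mlieBracket_swap_apply (V := τ) (W := k₁),
    mlieBracket_swap_apply (V := τ) (W := k₂), mlieBracket_swap_apply (V := τ) (W := k₃),
    F.b₁₂, F.b₁₃, F.b₂₃, F.b₁τ, F.b₂τ, F.b₃τ]
  simp

/-- The covariant derivative of Killing fields is determined by the Koszul formula, tested on the
frame. -/
lemma covDeriv_eq {X Y : (y : M) → Tan 4 y} (hX : g.IsKilling X) (hY : g.IsKilling Y)
    {v : Tan 4 x}
    (h : ∀ Z, g.IsKilling Z → Z = k₁ ∨ Z = k₂ ∨ Z = k₃ ∨ Z = τ → 2 * g.val x v (Z x) =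
      g.val x (mlieBracket 𝓘(ℝ, Eu 4) X Y x) (Z x) +
      g.val x (mlieBracket 𝓘(ℝ, Eu 4) X Z x) (Y x) +
      g.val x (mlieBracket 𝓘(ℝ, Eu 4) Y Z x) (X x)) : g.covDeriv Y x (X x) = v := by
  have key (Z) (hZ : g.IsKilling Z) (h' : Z = k₁ ∨ Z = k₂ ∨ Z = k₃ ∨ Z = τ) :
      g.val x (g.covDeriv Y x (X x)) (Z x) = g.val x v (Z x) := by
    linarith [h Z hZ h', hX.koszul hY hZ x]
  exact F.ext (key _ F.killing₁ (by simp)) (key _ F.killing₂ (by simp))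
    (key _ F.killing₃ (by simp)) (key _ F.killingτ (by simp))

lemma covDeriv_k₁ (h2τ : g.val x (k₂ x) (τ x) = 0)
    (hβ : β * g.val x (k₁ x) (k₁ x) = 2 * g.val x (k₂ x) (k₂ x)) :
    g.covDeriv k₁ x (k₁ x) = 0 ∧
    g.covDeriv k₁ x (k₂ x) = k₂ x - β • k₃ x ∧
    g.covDeriv k₁ x (k₃ x) = -k₃ x ∧
    g.covDeriv k₁ x (τ x) = 0 := by
  obtain ⟨g12, g13, g23, g33, g1τ, g3τ⟩ := F.gram
  obtain ⟨g21, g31, g32, gτ1, gτ2, gτ3⟩ := F.gram_symm h2τ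
  obtain ⟨c12, c13, c1τ, c21, c23, c2τ, c31, c32, c3τ, cτ1, cτ2, cτ3⟩ := F.brackets
  have c (X : (y : M) → Tan 4 y) : mlieBracket 𝓘(ℝ, Eu 4) X X x = 0 := by simp
  refine ⟨F.covDeriv_eq F.killing₁ F.killing₁ ?_, F.covDeriv_eq F.killing₂ F.killing₁ ?_,
    F.covDeriv_eq F.killing₃ F.killing₁ ?_, F.covDeriv_eq F.killingτ F.killing₁ ?_⟩ <;>
  · rintro Z - (rfl | rfl | rfl | rfl) <;>
    simp only [c, c12, c13, c1τ, c21, c23, c2τ, c31, c32, c3τ, cτ1, cτ2, cτ3, g23, g33,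
      g3τ, g21, g31, g32, h2τ, map_smul, map_zero, map_sub, map_neg,
      smul_apply, zero_apply, sub_apply, neg_apply, smul_eq_mul] <;>
    linarith

lemma covDeriv_k₂ (h2τ : g.val x (k₂ x) (τ x) = 0)
    (hβ : β * g.val x (k₁ x) (k₁ x) = 2 * g.val x (k₂ x) (k₂ x))
    (hγ : γ * g.val x (τ x) (τ x) = g.val x (k₂ x) (k₂ x)) :
    g.covDeriv k₂ x (k₁ x) = -k₂ x - β • k₃ x ∧
    g.covDeriv k₂ x (k₂ x) = β • k₁ x + γ • τ x ∧
    g.covDeriv k₂ x (k₃ x) = (1 / 2 : ℝ) • k₁ x ∧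
    g.covDeriv k₂ x (τ x) = -(β • k₃ x) := by
  obtain ⟨g12, g13, g23, g33, g1τ, g3τ⟩ := F.gram
  obtain ⟨g21, g31, g32, gτ1, gτ2, gτ3⟩ := F.gram_symm h2τ
  obtain ⟨c12, c13, c1τ, c21, c23, c2τ, c31, c32, c3τ, cτ1, cτ2, cτ3⟩ := F.brackets
  have c (X : (y : M) → Tan 4 y) : mlieBracket 𝓘(ℝ, Eu 4) X X x = 0 := by simp
  refine ⟨F.covDeriv_eq F.killing₁ F.killing₂ ?_, F.covDeriv_eq F.killing₂ F.killing₂ ?_,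
    F.covDeriv_eq F.killing₃ F.killing₂ ?_, F.covDeriv_eq F.killingτ F.killing₂ ?_⟩ <;>
  · rintro Z - (rfl | rfl | rfl | rfl) <;>
    simp only [c, c12, c13, c1τ, c21, c23, c2τ, c31, c32, c3τ, cτ1, cτ2, cτ3, g12, g13, g23, g33,
      g1τ, g3τ, g21, g31, g32, gτ1, gτ2, gτ3, h2τ, map_smul, map_zero, map_add, map_sub, map_neg,
      smul_apply, zero_apply, add_apply, sub_apply, neg_apply, smul_eq_mul] <;>
    linarith

lemma covDeriv_k₃ (h2τ : g.val x (k₂ x) (τ x) = 0) :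
    g.covDeriv k₃ x (k₁ x) = k₃ x ∧
    g.covDeriv k₃ x (k₂ x) = -((1 / 2 : ℝ) • k₁ x) ∧
    g.covDeriv k₃ x (k₃ x) = 0 ∧
    g.covDeriv k₃ x (τ x) = 0 := by
  obtain ⟨g12, g13, g23, g33, g1τ, g3τ⟩ := F.gram
  obtain ⟨g21, g31, g32, gτ1, gτ2, gτ3⟩ := F.gram_symm h2τ
  obtain ⟨c12, c13, c1τ, c21, c23, c2τ, c31, c32, c3τ, cτ1, cτ2, cτ3⟩ := F.brackets
  have c (X : (y : M) → Tan 4 y) : mlieBracket 𝓘(ℝ, Eu 4) X X x = 0 := by simp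
  refine ⟨F.covDeriv_eq F.killing₁ F.killing₃ ?_, F.covDeriv_eq F.killing₂ F.killing₃ ?_,
    F.covDeriv_eq F.killing₃ F.killing₃ ?_, F.covDeriv_eq F.killingτ F.killing₃ ?_⟩ <;>
  · rintro Z - (rfl | rfl | rfl | rfl) <;>
    simp only [c, c12, c13, c1τ, c21, c23, c2τ, c31, c32, c3τ, cτ1, cτ2, cτ3, g12, g13, g23, g33,
      g1τ, g3τ, g31, g32, map_smul, map_zero, map_neg,
      smul_apply, zero_apply, neg_apply, smul_eq_mul] <;>
    linarith

lemma covDeriv_τ (h2τ : g.val x (k₂ x) (τ x) = 0)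
    (hβ : β * g.val x (k₁ x) (k₁ x) = 2 * g.val x (k₂ x) (k₂ x)) :
    g.covDeriv τ x (k₁ x) = 0 ∧
    g.covDeriv τ x (k₂ x) = k₂ x - β • k₃ x ∧
    g.covDeriv τ x (k₃ x) = -k₃ x ∧
    g.covDeriv τ x (τ x) = 0 := by
  obtain ⟨g12, g13, g23, g33, g1τ, g3τ⟩ := F.gram
  obtain ⟨g21, g31, g32, gτ1, gτ2, gτ3⟩ := F.gram_symm h2τ
  obtain ⟨c12, c13, c1τ, c21, c23, c2τ, c31, c32, c3τ, cτ1, cτ2, cτ3⟩ := F.brackets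
  have c (X : (y : M) → Tan 4 y) : mlieBracket 𝓘(ℝ, Eu 4) X X x = 0 := by simp
  refine ⟨F.covDeriv_eq F.killing₁ F.killingτ ?_, F.covDeriv_eq F.killing₂ F.killingτ ?_,
    F.covDeriv_eq F.killing₃ F.killingτ ?_, F.covDeriv_eq F.killingτ F.killingτ ?_⟩ <;>
  · rintro Z - (rfl | rfl | rfl | rfl) <;>
    simp only [c, c12, c13, c1τ, c21, c23, c2τ, c31, c32, c3τ, cτ1, cτ2, cτ3, g23, g33,
      g1τ, g3τ, g21, g31, g32, h2τ, map_smul, map_zero, map_sub, map_neg,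
      smul_apply, zero_apply, sub_apply, neg_apply, smul_eq_mul] <;>
    linarith

/-! ### The curvature tensor in the frame -/

lemma riem_k₁_k₂ (h2τ : g.val x (k₂ x) (τ x) = 0)
    (hβ : β * g.val x (k₁ x) (k₁ x) = 2 * g.val x (k₂ x) (k₂ x))
    (hγ : γ * g.val x (τ x) (τ x) = g.val x (k₂ x) (k₂ x)) :
    g.riem x (k₁ x) (k₂ x) (k₁ x) = (4 * β) • k₃ x + k₂ x ∧
    g.riem x (k₁ x) (k₂ x) (k₂ x) = -((3 * γ) • τ x) - (5 / 2 * β) • k₁ x ∧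
    g.riem x (k₁ x) (k₂ x) (k₃ x) = -((1 / 2 : ℝ) • k₁ x) ∧
    g.riem x (k₁ x) (k₂ x) (τ x) = (3 * β) • k₃ x := by
  obtain ⟨a1, a2, a3, a4⟩ := F.covDeriv_k₁ h2τ hβ
  obtain ⟨b1, b2, b3, b4⟩ := F.covDeriv_k₂ h2τ hβ hγ
  have h (Z : (y : M) → Tan 4 y) (hZ : g.IsKilling Z) : g.riem x (k₁ x) (k₂ x) (Z x) =
      g.covDeriv k₁ x (g.covDeriv k₂ x (Z x)) - g.covDeriv k₂ x (g.covDeriv k₁ x (Z x)) + (-2 : ℝ)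
        • g.covDeriv k₂ x (Z x) := by
    rw [F.killing₁.riem_apply F.killing₂ hZ.smooth, F.b₁₂, covDeriv_smul _ (F.killing₂.smooth x),
      LinearMap.smul_apply]
  refine ⟨(h _ F.killing₁).trans ?_, (h _ F.killing₂).trans ?_, (h _ F.killing₃).trans ?_,
    (h _ F.killingτ).trans ?_⟩ <;>
  · simp only [a1, a2, a3, a4, b1, b2, b3, b4, map_add, map_sub, map_neg, map_smul, map_zero]
    module

lemma riem_k₁_k₃ (h2τ : g.val x (k₂ x) (τ x) = 0)
    (hβ : β * g.val x (k₁ x) (k₁ x) = 2 * g.val x (k₂ x) (k₂ x)) :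
    g.riem x (k₁ x) (k₃ x) (k₁ x) = k₃ x ∧
    g.riem x (k₁ x) (k₃ x) (k₂ x) = -((1 / 2 : ℝ) • k₁ x) ∧
    g.riem x (k₁ x) (k₃ x) (k₃ x) = 0 ∧
    g.riem x (k₁ x) (k₃ x) (τ x) = 0 := by
  obtain ⟨a1, a2, a3, a4⟩ := F.covDeriv_k₁ h2τ hβ
  obtain ⟨c1, c2, c3, c4⟩ := F.covDeriv_k₃ h2τ
  have h (Z : (y : M) → Tan 4 y) (hZ : g.IsKilling Z) : g.riem x (k₁ x) (k₃ x) (Z x) =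
      g.covDeriv k₁ x (g.covDeriv k₃ x (Z x)) - g.covDeriv k₃ x (g.covDeriv k₁ x (Z x)) + (2 : ℝ) •
        g.covDeriv k₃ x (Z x) := by
    rw [F.killing₁.riem_apply F.killing₃ hZ.smooth, F.b₁₃, covDeriv_smul _ (F.killing₃.smooth x),
      LinearMap.smul_apply]
  refine ⟨(h _ F.killing₁).trans ?_, (h _ F.killing₂).trans ?_, (h _ F.killing₃).trans ?_,
    (h _ F.killingτ).trans ?_⟩ <;>
  · simp only [a1, a2, a3, a4, c1, c2, c3, c4, map_sub, map_neg, map_smul, map_zero]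
    module

lemma riem_k₂_k₃ (h2τ : g.val x (k₂ x) (τ x) = 0)
    (hβ : β * g.val x (k₁ x) (k₁ x) = 2 * g.val x (k₂ x) (k₂ x))
    (hγ : γ * g.val x (τ x) (τ x) = g.val x (k₂ x) (k₂ x)) :
    g.riem x (k₂ x) (k₃ x) (k₁ x) = 0 ∧
    g.riem x (k₂ x) (k₃ x) (k₂ x) = (1 / 2 * β) • k₃ x - (1 / 2 : ℝ) • k₂ x ∧
    g.riem x (k₂ x) (k₃ x) (k₃ x) = (1 / 2 : ℝ) • k₃ x ∧
    g.riem x (k₂ x) (k₃ x) (τ x) = 0 := by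
  obtain ⟨a1, a2, a3, a4⟩ := F.covDeriv_k₁ h2τ hβ
  obtain ⟨b1, b2, b3, b4⟩ := F.covDeriv_k₂ h2τ hβ hγ
  obtain ⟨c1, c2, c3, c4⟩ := F.covDeriv_k₃ h2τ
  have h (Z : (y : M) → Tan 4 y) (hZ : g.IsKilling Z) : g.riem x (k₂ x) (k₃ x) (Z x) =
      g.covDeriv k₂ x (g.covDeriv k₃ x (Z x)) - g.covDeriv k₃ x (g.covDeriv k₂ x (Z x)) + (-1 : ℝ)
        • g.covDeriv k₁ x (Z x) := by
    rw [F.killing₂.riem_apply F.killing₃ hZ.smooth, F.b₂₃, covDeriv_smul _ (F.killing₁.smooth x),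
      LinearMap.smul_apply]
  refine ⟨(h _ F.killing₁).trans ?_, (h _ F.killing₂).trans ?_, (h _ F.killing₃).trans ?_,
    (h _ F.killingτ).trans ?_⟩ <;>
  · simp only [a1, a2, a3, a4, b1, b2, b3, b4, c1, c2, c3, c4, map_add, map_sub, map_neg, map_smul,
    map_zero]
    module

lemma riem_k₁_τ (h2τ : g.val x (k₂ x) (τ x) = 0)
    (hβ : β * g.val x (k₁ x) (k₁ x) = 2 * g.val x (k₂ x) (k₂ x)) :
    g.riem x (k₁ x) (τ x) (k₁ x) = 0 ∧
    g.riem x (k₁ x) (τ x) (k₂ x) = 0 ∧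
    g.riem x (k₁ x) (τ x) (k₃ x) = 0 ∧
    g.riem x (k₁ x) (τ x) (τ x) = 0 := by
  obtain ⟨a1, a2, a3, a4⟩ := F.covDeriv_k₁ h2τ hβ
  obtain ⟨d1, d2, d3, d4⟩ := F.covDeriv_τ h2τ hβ
  have h (Z : (y : M) → Tan 4 y) (hZ : g.IsKilling Z) : g.riem x (k₁ x) (τ x) (Z x) =
      g.covDeriv k₁ x (g.covDeriv τ x (Z x)) - g.covDeriv τ x (g.covDeriv k₁ x (Z x)) + 0 := by
    rw [F.killing₁.riem_apply F.killingτ hZ.smooth, F.b₁τ, covDeriv_zero, LinearMap.zero_apply]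
  refine ⟨(h _ F.killing₁).trans ?_, (h _ F.killing₂).trans ?_, (h _ F.killing₃).trans ?_,
    (h _ F.killingτ).trans ?_⟩ <;>
  · simp only [a1, a2, a3, a4, d1, d2, d3, d4, map_sub, map_neg, map_smul, map_zero]
    module

lemma riem_k₂_τ (h2τ : g.val x (k₂ x) (τ x) = 0)
    (hβ : β * g.val x (k₁ x) (k₁ x) = 2 * g.val x (k₂ x) (k₂ x))
    (hγ : γ * g.val x (τ x) (τ x) = g.val x (k₂ x) (k₂ x)) :
    g.riem x (k₂ x) (τ x) (k₁ x) = -((3 * β) • k₃ x) ∧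
    g.riem x (k₂ x) (τ x) (k₂ x) = (2 * γ) • τ x + (3 / 2 * β) • k₁ x ∧
    g.riem x (k₂ x) (τ x) (k₃ x) = 0 ∧
    g.riem x (k₂ x) (τ x) (τ x) = -((2 * β) • k₃ x) := by
  obtain ⟨b1, b2, b3, b4⟩ := F.covDeriv_k₂ h2τ hβ hγ
  obtain ⟨d1, d2, d3, d4⟩ := F.covDeriv_τ h2τ hβ
  have h (Z : (y : M) → Tan 4 y) (hZ : g.IsKilling Z) : g.riem x (k₂ x) (τ x) (Z x) =
      g.covDeriv k₂ x (g.covDeriv τ x (Z x)) - g.covDeriv τ x (g.covDeriv k₂ x (Z x)) + (1 : ℝ) •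
        g.covDeriv k₂ x (Z x) := by
    rw [F.killing₂.riem_apply F.killingτ hZ.smooth, F.b₂τ, covDeriv_smul _ (F.killing₂.smooth x),
      LinearMap.smul_apply]
  refine ⟨(h _ F.killing₁).trans ?_, (h _ F.killing₂).trans ?_, (h _ F.killing₃).trans ?_,
    (h _ F.killingτ).trans ?_⟩ <;>
  · simp only [b1, b2, b3, b4, d1, d2, d3, d4, map_add, map_sub, map_neg, map_smul, map_zero]
    module

lemma riem_k₃_τ (h2τ : g.val x (k₂ x) (τ x) = 0)
    (hβ : β * g.val x (k₁ x) (k₁ x) = 2 * g.val x (k₂ x) (k₂ x)) :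
    g.riem x (k₃ x) (τ x) (k₁ x) = 0 ∧
    g.riem x (k₃ x) (τ x) (k₂ x) = 0 ∧
    g.riem x (k₃ x) (τ x) (k₃ x) = 0 ∧
    g.riem x (k₃ x) (τ x) (τ x) = 0 := by
  obtain ⟨c1, c2, c3, c4⟩ := F.covDeriv_k₃ h2τ
  obtain ⟨d1, d2, d3, d4⟩ := F.covDeriv_τ h2τ hβ
  have h (Z : (y : M) → Tan 4 y) (hZ : g.IsKilling Z) : g.riem x (k₃ x) (τ x) (Z x) =
      g.covDeriv k₃ x (g.covDeriv τ x (Z x)) - g.covDeriv τ x (g.covDeriv k₃ x (Z x)) + (-1 : ℝ) •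
        g.covDeriv k₃ x (Z x) := by
    rw [F.killing₃.riem_apply F.killingτ hZ.smooth, F.b₃τ, covDeriv_smul _ (F.killing₃.smooth x),
      LinearMap.smul_apply]
  refine ⟨(h _ F.killing₁).trans ?_, (h _ F.killing₂).trans ?_, (h _ F.killing₃).trans ?_,
    (h _ F.killingτ).trans ?_⟩ <;>
  · simp only [c1, c2, c3, c4, d1, d2, d3, d4, map_sub, map_neg, map_smul, map_zero]
    module

/-! ### Local symmetry -/

/-- A linear map vanishes if it does on the frame. The test fields are given as Killing fields so
that the hypothesis can be checked with the formulas for these. -/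
lemma linearMap_eq_zero {E : Type*} [AddCommGroup E] [Module ℝ E] {f : Tan 4 x →ₗ[ℝ] E}
    (hf : ∀ X, g.IsKilling X → X = k₁ ∨ X = k₂ ∨ X = k₃ ∨ X = τ → f (X x) = 0) : f = 0 := by
  ext1 v
  obtain ⟨p, q, r, s, rfl⟩ := F.span v
  simp only [map_add, map_smul, hf k₁ F.killing₁ (by simp), hf k₂ F.killing₂ (by simp),
    hf k₃ F.killing₃ (by simp), hf τ F.killingτ (by simp), smul_zero, add_zero,
      LinearMap.zero_apply]

lemma riem_self (u w : Tan 4 x) : g.riem x u u w = 0 := by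
  have h : (2 : ℝ) • g.riem x u u w = 0 := by
    rw [two_smul]
    exact add_eq_zero_iff_eq_neg.2 (riem_swap x u u w)
  exact (smul_eq_zero.1 h).resolve_left two_ne_zero

/-- If `b ≠ 0`, the curvature tensor is not parallel: `(∇_{k₁} R)(k₂, τ) τ = 4β k₃`. -/
theorem nablaRiem_ne_zero (h2τ : g.val x (k₂ x) (τ x) = 0)
    (hb : g.val x (k₂ x) (k₂ x) ≠ 0) : g.nablaRiem x ≠ 0 := by
  have ha0 := F.a_ne_zero
  have ht0 := F.t_ne_zero h2τ
  obtain ⟨β, hβ⟩ : ∃ β, β * g.val x (k₁ x) (k₁ x) = 2 * g.val x (k₂ x) (k₂ x) :=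
    ⟨_, div_mul_cancel₀ _ ha0⟩
  obtain ⟨γ, hγ⟩ : ∃ γ, γ * g.val x (τ x) (τ x) = g.val x (k₂ x) (k₂ x) :=
    ⟨_, div_mul_cancel₀ _ ht0⟩
  have hβ0 : β ≠ 0 := by
    rintro rfl
    exact hb (by linarith)
  intro h0
  have h := F.killing₁.nablaRiem_apply F.killing₂.smooth F.killingτ.smooth F.killingτ.smooth x
  obtain ⟨-, a2, a3, aτ⟩ := F.covDeriv_k₁ h2τ hβ
  obtain ⟨-, -, -, r2⟩ := F.riem_k₂_τ h2τ hβ hγ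
  obtain ⟨-, -, -, r3⟩ := F.riem_k₃_τ h2τ hβ
  have h1 : (4 * β) • k₃ x = 0 := by
    rw [h0, a2, aτ, r2] at h
    simp only [map_sub, map_neg, map_smul, map_zero, LinearMap.sub_apply, LinearMap.smul_apply,
      LinearMap.zero_apply, a3, r2, r3] at h
    rw [h]
    module
  exact (smul_ne_zero (by positivity) F.k₃_ne_zero) h1

set_option maxHeartbeats 1000000 in
/-- If `b = 0`, the curvature tensor is parallel. -/
theorem nablaRiem_eq_zero (h2τ : g.val x (k₂ x) (τ x) = 0)
    (hb : g.val x (k₂ x) (k₂ x) = 0) : g.nablaRiem x = 0 := by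
  have hβ : 0 * g.val x (k₁ x) (k₁ x) = 2 * g.val x (k₂ x) (k₂ x) := by rw [hb]; simp
  have hγ : 0 * g.val x (τ x) (τ x) = g.val x (k₂ x) (k₂ x) := by rw [hb]; simp
  obtain ⟨a1, a2, a3, a4⟩ := F.covDeriv_k₁ h2τ hβ
  obtain ⟨b1, b2, b3, b4⟩ := F.covDeriv_k₂ h2τ hβ hγ
  obtain ⟨c1, c2, c3, c4⟩ := F.covDeriv_k₃ h2τ
  obtain ⟨d1, d2, d3, d4⟩ := F.covDeriv_τ h2τ hβ
  obtain ⟨p1, p2, p3, p4⟩ := F.riem_k₁_k₂ h2τ hβ hγ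
  obtain ⟨q1, q2, q3, q4⟩ := F.riem_k₁_k₃ h2τ hβ
  obtain ⟨r1, r2, r3, r4⟩ := F.riem_k₁_τ h2τ hβ
  obtain ⟨s1, s2, s3, s4⟩ := F.riem_k₂_k₃ h2τ hβ hγ
  obtain ⟨t1, t2, t3, t4⟩ := F.riem_k₂_τ h2τ hβ hγ
  obtain ⟨u1, u2, u3, u4⟩ := F.riem_k₃_τ h2τ hβ
  have e12 := riem_swap (g := g) x (k₂ x) (k₁ x)
  have e13 := riem_swap (g := g) x (k₃ x) (k₁ x)
  have e1τ := riem_swap (g := g) x (τ x) (k₁ x)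
  have e23 := riem_swap (g := g) x (k₃ x) (k₂ x)
  have e2τ := riem_swap (g := g) x (τ x) (k₂ x)
  have e3τ := riem_swap (g := g) x (τ x) (k₃ x)
  -- both sides of `∇_K R = A_K • R` are known on the frame, and `A_K • R` is multilinear
  refine F.linearMap_eq_zero fun W hW hW' ↦ F.linearMap_eq_zero fun X hX hX' ↦
    F.linearMap_eq_zero fun Y hY hY' ↦ F.linearMap_eq_zero fun Z hZ hZ' ↦ ?_
  rw [hW.nablaRiem_apply hX.smooth hY.smooth hZ.smooth]
  rcases hW' with rfl | rfl | rfl | rfl <;> rcases hX' with rfl | rfl | rfl | rfl <;>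
  rcases hY' with rfl | rfl | rfl | rfl <;> rcases hZ' with rfl | rfl | rfl | rfl <;>
  simp only [a1, a2, a3, a4, b1, b2, b3, b4, c1, c2, c3, c4, d1, d2, d3, d4, p1, p2, p3, p4, q1,
    q2, q3, q4, r1, r2, r3, r4, s1, s2, s3, s4, t1, t2, t3, t4, u1, u2, u3, u4, e12, e13, e1τ, e23,
    e2τ, e3τ, F.riem_self, map_neg, map_smul, map_zero, LinearMap.neg_apply, LinearMap.smul_apply,
    LinearMap.zero_apply,
    mul_zero, zero_smul, smul_zero, neg_zero, sub_zero, add_zero, zero_add, zero_sub, neg_neg,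
    smul_neg, sub_self] <;> module

/-! ### Hyperplanes invariant under curvature operators -/

/-- If `b ≠ 0`, no hyperplane `ν^⊥` with `ν` non-null is invariant under its curvature operators.
The hypothesis is tested on tangent vectors that successively force the components of `ν` in the
frame to vanish. -/
theorem false_of_val_riem_eq_zero (h2τ : g.val x (k₂ x) (τ x) = 0)
    (hb : g.val x (k₂ x) (k₂ x) ≠ 0) {ν : Tan 4 x} (hν : g.val x ν ν ≠ 0)
    (h : ∀ u v w : Tan 4 x, g.val x ν u = 0 → g.val x ν v = 0 → g.val x ν w = 0 →
      g.val x (g.riem x u v w) ν = 0) : False := by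
  have ha0 := F.a_ne_zero
  have ht0 := F.t_ne_zero h2τ
  obtain ⟨β, hβ⟩ : ∃ β, β * g.val x (k₁ x) (k₁ x) = 2 * g.val x (k₂ x) (k₂ x) :=
    ⟨_, div_mul_cancel₀ _ ha0⟩
  obtain ⟨γ, hγ⟩ : ∃ γ, γ * g.val x (τ x) (τ x) = g.val x (k₂ x) (k₂ x) :=
    ⟨_, div_mul_cancel₀ _ ht0⟩
  have hβ0 : β ≠ 0 := by
    rintro rfl
    exact hb (by linarith)
  have hγ0 : γ ≠ 0 := by
    rintro rfl
    exact hb (by linarith)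
  obtain ⟨g12, g13, g23, g33, g1τ, g3τ⟩ := F.gram
  obtain ⟨g21, g31, g32, gτ1, gτ2, gτ3⟩ := F.gram_symm h2τ
  obtain ⟨p1, p2, p3, p4⟩ := F.riem_k₁_k₂ h2τ hβ hγ
  obtain ⟨q1, q2, q3, q4⟩ := F.riem_k₁_k₃ h2τ hβ
  obtain ⟨r1, r2, r3, r4⟩ := F.riem_k₁_τ h2τ hβ
  obtain ⟨s1, s2, s3, s4⟩ := F.riem_k₂_k₃ h2τ hβ hγ
  obtain ⟨t1, t2, t3, t4⟩ := F.riem_k₂_τ h2τ hβ hγ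
  obtain ⟨u1, u2, u3, u4⟩ := F.riem_k₃_τ h2τ hβ
  have e13 := riem_swap (g := g) x (k₃ x) (k₁ x)
  have e1τ := riem_swap (g := g) x (τ x) (k₁ x)
  have e23 := riem_swap (g := g) x (k₃ x) (k₂ x)
  have eττ := F.riem_self (τ x)
  obtain ⟨p, q, r, s, hpq⟩ := F.span ν
  generalize ha : g.val x (k₁ x) (k₁ x) = a at *
  generalize ht : g.val x (τ x) (τ x) = t at *
  generalize hb' : g.val x (k₂ x) (k₂ x) = b at *
  have n1 : g.val x ν (k₁ x) = p * a := by
    rw [hpq]; simp only [map_add, map_smul, add_apply, smul_apply, smul_eq_mul, ha, g21, g31, gτ1]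
    ring
  have n2 : g.val x ν (k₂ x) = q * b + r * (a / 2) := by
    rw [hpq]; simp only [map_add, map_smul, add_apply, smul_apply, smul_eq_mul, g12, hb', g32, gτ2]
    ring
  have n3 : g.val x ν (k₃ x) = q * (a / 2) := by
    rw [hpq]; simp only [map_add, map_smul, add_apply, smul_apply, smul_eq_mul, g13, g23, g33, gτ3]
    ring
  have nτ : g.val x ν (τ x) = s * t := by
    rw [hpq]; simp only [map_add, map_smul, add_apply, smul_apply, smul_eq_mul, g1τ, h2τ, g3τ, ht]
    ring
  have m1 := (g.symm x (k₁ x) ν).trans n1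
  have m2 := (g.symm x (k₂ x) ν).trans n2
  have m3 := (g.symm x (k₃ x) ν).trans n3
  have mτ := (g.symm x (τ x) ν).trans nτ
  by_cases hs : s = 0
  · subst hs
    rw [zero_mul] at nτ mτ
    by_cases hq : q = 0
    · subst hq
      by_cases hp : p = 0
      · subst hp
        apply hν
        nth_rewrite 1 [hpq]
        simp [m3]
      -- `τ` and `p a k₂ - (r a / 2) k₁` are tangent
      have hv : g.val x ν ((p * a) • k₂ x - (r * (a / 2)) • k₁ x) = 0 := by
        simp only [map_sub, map_smul, smul_eq_mul, n1, n2]; ring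
      have h1 := h _ _ _ hv nτ hv
      simp only [map_sub, map_smul, LinearMap.sub_apply, LinearMap.smul_apply, t1, t2, r1, r2,
        map_neg, map_add, sub_apply, smul_apply, neg_apply, add_apply, smul_eq_mul, m1, m3, mτ,
        smul_zero, sub_zero] at h1
      have h2 : (p * a) ^ 3 * β = 0 := by linarith
      simp [hp, ha0, hβ0] at h2
    -- `τ` and `(q a / 2) k₂ - ⟨ν, k₂⟩ k₃` are tangent
    · have hv : g.val x ν ((q * (a / 2)) • k₂ x - (q * b + r * (a / 2)) • k₃ x) = 0 := by
        simp only [map_sub, map_smul, smul_eq_mul, n2, n3]; ring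
      have h1 := h _ _ _ hv nτ nτ
      simp only [map_sub, map_smul, LinearMap.sub_apply, LinearMap.smul_apply, t4, u4,
        map_neg, smul_apply, neg_apply, smul_eq_mul, m3, smul_zero, sub_zero] at h1
      have h2 : (q * a) ^ 2 * β = 0 := by linarith
      simp [hq, ha0, hβ0] at h2
  -- now `τ` is transversal to the hyperplane; `v - (⟨ν, v⟩ / s t) τ` is its projection of `v`,
  -- used here after multiplication by `s t`
  have hst : s * t ≠ 0 := mul_ne_zero hs ht0
  have hv (u : Tan 4 x) : g.val x ν ((s * t) • u - g.val x ν u • τ x) = 0 := by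
    simp only [map_sub, map_smul, smul_eq_mul, nτ]; ring
  have hq : q = 0 := by
    have h1 := h _ _ _ (hv (k₃ x)) (hv (k₁ x)) (hv (k₁ x))
    simp only [map_sub, map_smul, LinearMap.sub_apply, LinearMap.smul_apply, e13, e1τ, eττ, q1, q4,
      r1, r4, u1, u4, map_neg, neg_zero, neg_apply, smul_apply, smul_eq_mul, m3, smul_zero,
      sub_zero] at h1
    simpa [hst, ha0, hs, ht0] using h1
  subst hq
  rw [zero_mul] at n3
  have hr : r = 0 := by
    have h1 := h _ _ _ n3 (hv (k₂ x)) (hv (k₂ x))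
    simp only [map_sub, map_smul, LinearMap.sub_apply, LinearMap.smul_apply, e23, s2, s4, u2, u4,
      map_neg, neg_zero, neg_apply, sub_apply, smul_apply, smul_eq_mul, m2, m3, smul_zero,
      sub_zero] at h1
    simpa [hst, ha0, hs, ht0] using h1
  subst hr
  have hp : p = 0 := by
    have h1 := h _ _ _ n3 (hv (k₁ x)) (n2.trans (by ring))
    simp only [map_sub, map_smul, LinearMap.sub_apply, LinearMap.smul_apply, e13, q2, u2,
      map_neg, neg_apply, smul_apply, smul_eq_mul, m1, smul_zero, sub_zero] at h1
    simpa [hst, ha0, hs, ht0] using h1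
  subst hp
  have h1 := h _ _ _ (n1.trans (by ring)) (n2.trans (by ring)) (n2.trans (by ring))
  simp only [p2, map_sub, map_neg, map_smul, sub_apply, neg_apply, smul_apply, smul_eq_mul, m1,
    mτ] at h1
  have h2 : γ * (s * t) = 0 := by linarith
  simp [hst, hγ0] at h2

end IsA1Frame
end Frame

/-! ### Existence of adapted frames -/

section Existence
open PseudoRiemannianMetric

/-- The brackets with `½ e₁ + e₅ + s e₄`. -/
lemma IsA1Basis.lie_transversal {L : Type*} [LieRing L] [LieAlgebra ℝ L] {K : Submodule ℝ L}
    {e : Module.Basis (Fin 5) ℝ L} (he : IsA1Basis K e) (s : ℝ) :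
    ⁅e 0, (1 / 2 : ℝ) • e 0 + e 4 + s • e 3⁆ = 0 ∧
    ⁅e 1, (1 / 2 : ℝ) • e 0 + e 4 + s • e 3⁆ = -e 1 ∧
    ⁅e 2, (1 / 2 : ℝ) • e 0 + e 4 + s • e 3⁆ = e 2 ∧
    ⁅e 3, (1 / 2 : ℝ) • e 0 + e 4 + s • e 3⁆ = e 3 := by
  have h10 : ⁅e 1, e 0⁆ = (-2 : ℝ) • e 1 := by rw [← lie_skew, he.b12, neg_smul]
  have h20 : ⁅e 2, e 0⁆ = (2 : ℝ) • e 2 := by rw [← lie_skew, he.b13, neg_smul, neg_neg]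
  have h30 : ⁅e 3, e 0⁆ = 0 := by rw [← lie_skew, he.b14, neg_zero]
  simp only [lie_add, lie_smul, lie_self, he.b14, he.b15, h10, he.b24, he.b25, h20, he.b34,
    he.b35, h30, he.b45]
  refine ⟨?_, ?_, ?_, ?_⟩ <;> module

variable {G : Type*} [TopologicalSpace G] [ChartedSpace (Eu 5) G] [Group G]
  [LieGroup 𝓘(ℝ, Eu 5) ∞ G]
  {M : Type*} [TopologicalSpace M] [ChartedSpace (Eu 4) M] [IsManifold 𝓘(ℝ, Eu 4) ∞ M]
  [MulAction G M] [ContMDiffSMul 𝓘(ℝ, Eu 5) 𝓘(ℝ, Eu 4) ∞ G M]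

variable (M) in
/-- The linear map sending an element of the Lie algebra to its fundamental field. -/
def fundFieldL : GroupLieAlgebra 𝓘(ℝ, Eu 5) G →ₗ[ℝ] ((x : M) → Tan 4 x) where
  toFun w := fundField 4 w
  map_add' v w := funext fun x ↦
    map_add (mfderiv 𝓘(ℝ, Eu 5) 𝓘(ℝ, Eu 4) (fun a : G ↦ a • x) 1 : Eu 5 →L[ℝ] Eu 4) v w
  map_smul' c w := funext fun x ↦
    map_smul (mfderiv 𝓘(ℝ, Eu 5) 𝓘(ℝ, Eu 4) (fun a : G ↦ a • x) 1 : Eu 5 →L[ℝ] Eu 4) c w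

lemma isKilling_fundFieldL {g : PseudoRiemannianMetric 4 M} (hg : ActsByIsometries G g)
    (w : GroupLieAlgebra 𝓘(ℝ, Eu 5) G) : g.IsKilling (fundFieldL M w) where
  smooth x := smoothFieldAt_fundField w x
  skew x u := val_covDerivAlong_fundField_self g hg w x u

lemma mlieBracket_fundFieldL (v w : GroupLieAlgebra 𝓘(ℝ, Eu 5) G) :
    mlieBracket 𝓘(ℝ, Eu 4) (fundFieldL M v) (fundFieldL M w) = -fundFieldL M ⁅v, w⁆ :=
  funext fun x ↦ mlieBracket_fundField v w x

lemma fundFieldL_Ad (a : G) (w : GroupLieAlgebra 𝓘(ℝ, Eu 5) G) (x : M) :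
    fundFieldL M (Ad a w) (a • x) =
      mfderiv 𝓘(ℝ, Eu 4) 𝓘(ℝ, Eu 4) (fun y : M ↦ a • y) x (fundFieldL M w x) :=
  fundField_Ad a w x

/-- An isometry has injective differentials. -/
lemma ActsByIsometries.injective {g : PseudoRiemannianMetric 4 M} (hg : ActsByIsometries G g)
    (a : G) (x : M) :
    Function.Injective (mfderiv 𝓘(ℝ, Eu 4) 𝓘(ℝ, Eu 4) (fun y : M ↦ a • y) x) := by
  refine (injective_iff_map_eq_zero _).2 fun v hv ↦ g.nondegenerate x v fun w ↦ ?_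
  rw [← hg a x v w, hv, map_zero, zero_apply]

variable {o : M} {e : Module.Basis (Fin 5) ℝ (GroupLieAlgebra 𝓘(ℝ, Eu 5) G)}

lemma fundFieldL_eq_zero_iff (he : IsA1Basis (isotropyAlgebra G o) e)
    (w : GroupLieAlgebra 𝓘(ℝ, Eu 5) G) :
    fundFieldL M w o = 0 ↔ w ∈ Submodule.span ℝ {e 2 + e 3} := by
  rw [← he.isotropy]
  rfl

/-- Fundamental fields span all tangent spaces. Since the isotropy algebra is one-dimensional and
`5 = 4 + 1`, this needs no argument on the regularity of the orbit maps. -/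
lemma exists_fundFieldL_Ad_eq {g : PseudoRiemannianMetric 4 M} (hg : ActsByIsometries G g)
    (he : IsA1Basis (isotropyAlgebra G o) e) (a : G) (v : Tan 4 (a • o)) :
    ∃ w, fundFieldL M (Ad a (w : GroupLieAlgebra 𝓘(ℝ, Eu 5) G)) (a • o) = v := by
  let T : GroupLieAlgebra 𝓘(ℝ, Eu 5) G →ₗ[ℝ] Eu 4 :=
    (LinearMap.proj (a • o) : ((x : M) → Tan 4 x) →ₗ[ℝ] Tan 4 (a • o)) ∘ₗ
      fundFieldL M ∘ₗ Ad a
  have : FiniteDimensional ℝ (GroupLieAlgebra 𝓘(ℝ, Eu 5) G) := e.finiteDimensional_of_finite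
  have hker : LinearMap.ker T = Submodule.span ℝ {e 2 + e 3} := by
    ext w
    rw [← fundFieldL_eq_zero_iff he, LinearMap.mem_ker, ← (hg.injective a o).eq_iff, map_zero,
      ← fundFieldL_Ad]
    rfl
  have hne : e 2 + e 3 ≠ 0 := by
    intro h0
    have := congrArg (fun z ↦ e.repr z 2) h0
    simp at this
  have h1 := LinearMap.finrank_range_add_finrank_ker T
  rw [hker, finrank_span_singleton hne, Module.finrank_eq_card_basis e, Fintype.card_fin] at h1
  have h2 : LinearMap.range T = ⊤ :=
    Submodule.eq_top_of_finrank_eq (by rw [finrank_euclideanSpace_fin]; omega)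
  exact LinearMap.range_eq_top.1 h2 v

/-- The translates by `a` of the A1 basis at `o` induce Killing fields adapted at `a • o`. -/
lemma isA1Frame_fundFieldL {g : PseudoRiemannianMetric 4 M} (hg : ActsByIsometries G g)
    (he : IsA1Basis (isotropyAlgebra G o) e) (a : G) (s : ℝ) :
    IsA1Frame g (a • o) (fundFieldL M (Ad a (e 0))) (fundFieldL M (Ad a (e 1)))
      (fundFieldL M (Ad a (e 2))) (fundFieldL M (Ad a (e 3)))
      (fundFieldL M (Ad a ((1 / 2 : ℝ) • e 0 + e 4 + s • e 3))) := by
  have h3 : LieGroup 𝓘(ℝ, Eu 5) (minSmoothness ℝ 3) G := by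
    rw [minSmoothness_of_isRCLikeNormedField]
    exact LieGroup.of_le (n := ∞) three_le_infty
  obtain ⟨h1, h2, h3, h4⟩ := IsA1Basis.lie_transversal he s
  have hiso : fundFieldL M (Ad a (e 3)) (a • o) = -fundFieldL M (Ad a (e 2)) (a • o) := by
    have h0 := (fundFieldL_eq_zero_iff he (e 2 + e 3)).2 (Submodule.mem_span_singleton_self _)
    have h5 := fundFieldL_Ad a (e 2 + e 3) o
    rw [h0, map_zero, map_add, map_add, Pi.add_apply] at h5
    exact (neg_eq_of_add_eq_zero_right h5).symm
  constructor
  iterate 5 exact isKilling_fundFieldL hg _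
  iterate 10
    rw [mlieBracket_fundFieldL, ← Ad_lie]
    simp only [he.b12, he.b13, he.b23, he.b14, he.b24, he.b34, h1, h2, h3, h4, map_smul, map_neg,
      map_zero, neg_zero]
    try module
  · exact hiso
  · intro v
    obtain ⟨w, rfl⟩ := exists_fundFieldL_Ad_eq hg he a v
    refine ⟨e.repr w 0 - e.repr w 4 / 2, e.repr w 1, e.repr w 2 - e.repr w 3 + s * e.repr w 4,
      e.repr w 4, ?_⟩
    conv_lhs => rw [← e.sum_repr w]
    simp only [Fin.sum_univ_five, map_add, map_smul, Pi.add_apply, Pi.smul_apply, hiso]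
    module

/-- Every point carries adapted Killing fields with `k₂ ⟂ τ` and `⟨k₂, k₂⟩ = b`. -/
theorem exists_isA1Frame [MulAction.IsPretransitive G M] {g : PseudoRiemannianMetric 4 M}
    (hg : ActsByIsometries G g) (he : IsA1Basis (isotropyAlgebra G o) e) (x : M) :
    ∃ k₁ k₂ k₃ k₄ τ : (y : M) → Tan 4 y, IsA1Frame g x k₁ k₂ k₃ k₄ τ ∧
      g.val x (k₂ x) (τ x) = 0 ∧ g.val x (k₂ x) (k₂ x) = coeffB G g o e := by
  obtain ⟨a, rfl⟩ := MulAction.exists_smul_eq G o x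
  have h0 := isA1Frame_fundFieldL hg he a 0
  have ha := h0.a_ne_zero
  obtain ⟨-, -, h23, -, -, -⟩ := h0.gram
  set k₂ := fundFieldL M (Ad a (e 1))
  set τ := fundFieldL M (Ad a ((1 / 2 : ℝ) • e 0 + e 4 + (0 : ℝ) • e 3)) with hτ
  set c := g.val (a • o) (fundFieldL M (Ad a (e 0)) (a • o)) (fundFieldL M (Ad a (e 0)) (a • o))
  refine ⟨_, _, _, _, _, isA1Frame_fundFieldL hg he a (2 * g.val (a • o) (k₂ (a • o)) (τ (a • o)) /
    c),
    ?_, ?_⟩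
  · have h1 : ∀ s : ℝ, fundFieldL M (Ad a ((1 / 2 : ℝ) • e 0 + e 4 + s • e 3)) (a • o) =
        τ (a • o) - s • fundFieldL M (Ad a (e 2)) (a • o) := by
      intro s
      rw [hτ]
      simp only [map_add, map_smul, Pi.add_apply, Pi.smul_apply, h0.isotropy]
      module
    rw [h1, map_sub, map_smul, h23, smul_eq_mul]
    field_simp
    ring
  · have h1 : ∀ y, y = o → ∀ v : Eu 4, g.val y v v = g.val o v v := by rintro y rfl v; rfl
    refine Eq.trans ?_ (h1 _ (one_smul G o) (fundFieldL M (e 1) o)).symm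
    exact (congrArg₂ (fun v w ↦ g.val (a • o) v w) (fundFieldL_Ad a (e 1) o)
      (fundFieldL_Ad a (e 1) o)).trans (hg a o _ _)

end Existence

section LocallySymmetric
variable {n : ℕ}
  {M : Type*} [TopologicalSpace M] [ChartedSpace (Eu n) M] [IsManifold 𝓘(ℝ, Eu n) ∞ M]

lemma PseudoRiemannianMetric.IsLocallySymmetric.nablaRiem_eq_zero {g : PseudoRiemannianMetric n M}
    (h : g.IsLocallySymmetric) (x : M) : g.nablaRiem x = 0 := by
  have hx := mem_chart_source (Eu n) x
  have ho := (chartAt (Eu n) x).open_source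
  ext w u v z
  obtain ⟨W, hW, rfl⟩ := exists_smoothFieldOn x w
  obtain ⟨X, hX, rfl⟩ := exists_smoothFieldOn x u
  obtain ⟨Y, hY, rfl⟩ := exists_smoothFieldOn x v
  obtain ⟨Z, hZ, rfl⟩ := exists_smoothFieldOn x z
  have h0 := h _ ho W X Y Z hW hX hY hZ x hx
  rw [g.nablaCurvature_eq_nablaRiem (hW.near ho hx) (hX.near ho hx) (hY.near ho hx)
    (hZ.near ho hx)] at h0
  rw [h0]
  rfl
end LocallySymmetric

end A1Space

end

theorem mainTheorem1
    {G : Type*} [TopologicalSpace G] [ChartedSpace (A1Space.Eu 5) G] [Group G]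
    [LieGroup 𝓘(ℝ, A1Space.Eu 5) ∞ G] [T2Space G] [ConnectedSpace G]
    {M : Type*} [TopologicalSpace M] [ChartedSpace (A1Space.Eu 4) M]
    [IsManifold 𝓘(ℝ, A1Space.Eu 4) ∞ M] [T2Space M]
    [MulAction G M] [ContMDiffSMul 𝓘(ℝ, A1Space.Eu 5) 𝓘(ℝ, A1Space.Eu 4) ∞ G M]
    [MulAction.IsPretransitive G M]
    (g : A1Space.PseudoRiemannianMetric 4 M) (hg : A1Space.ActsByIsometries G g)
    (o : M) (e : Module.Basis (Fin 5) ℝ (GroupLieAlgebra 𝓘(ℝ, A1Space.Eu 5) G))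
    (he : A1Space.IsA1Basis (A1Space.isotropyAlgebra G o) e) :
    (g.IsLocallySymmetric ↔ A1Space.coeffB G g o e = 0) ∧
    (¬ g.IsLocallySymmetric →
      ∀ {S : Type*} [TopologicalSpace S] [ChartedSpace (A1Space.Eu 3) S]
        [IsManifold 𝓘(ℝ, A1Space.Eu 3) ∞ S] [T2Space S] [Nonempty S]
        (gS : A1Space.PseudoRiemannianMetric 3 S) (F : S → M),
        A1Space.IsIsometricHypersurface gS g F →
          ¬ A1Space.IsCodazzi gS g F ∧ ¬ A1Space.IsParallel gS g F ∧
            ¬ A1Space.IsTotallyGeodesic g F) := by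
  have hsymm : g.IsLocallySymmetric ↔ A1Space.coeffB G g o e = 0 := by
    refine ⟨fun h ↦ ?_, fun h U hU W X Y Z hW hX hY hZ x hx ↦ ?_⟩
    · obtain ⟨k₁, k₂, k₃, k₄, τ, F, h2τ, hb⟩ := A1Space.exists_isA1Frame hg he o
      by_contra h0
      exact F.nablaRiem_ne_zero h2τ (hb ▸ h0) (h.nablaRiem_eq_zero o)
    · obtain ⟨k₁, k₂, k₃, k₄, τ, F, h2τ, hb⟩ := A1Space.exists_isA1Frame hg he x
      rw [g.nablaCurvature_eq_nablaRiem (hW.near hU hx) (hX.near hU hx) (hY.near hU hx)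
        (hZ.near hU hx), F.nablaRiem_eq_zero h2τ (hb.trans h)]
      rfl
  refine ⟨hsymm, fun hns S _ _ _ _ _ gS F hF ↦ ?_⟩
  have key : ¬ A1Space.IsCodazzi gS g F := by
    intro h
    obtain ⟨p⟩ := ‹Nonempty S›
    obtain ⟨ν, hν, hR⟩ := h.val_riem_eq_zero hF p
    obtain ⟨k₁, k₂, k₃, k₄, τ, E, h2τ, hb⟩ := A1Space.exists_isA1Frame hg he (F p)
    exact E.false_of_val_riem_eq_zero h2τ (fun h0 ↦ hns (hsymm.2 (hb.symm.trans h0))) hν hR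
  exact ⟨key, fun h ↦ key h.isCodazzi, fun h ↦ key (h.isParallel gS).isCodazzi⟩
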